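/- Let $k$ be an algebraically closed field. A $k$-linear (Quillen) exact category $\mathcal E$ with finite-dimensional $\mathrm{Hom}$ and $\mathrm{Ext}^1$ spaces is called thin if it has full, extension-closed subcategories $0=\mathcal T_0\subset\mathcal T_1\subset\dots\subset\mathcal T_n=\mathcal E$ such that each $\mathcal T_i$ is right admissible, i.e. every $E\in\mathcal E$ fits into a conflation $T\to E\to F$ with $T\in\mathcal T_i$ and $F\in\mathcal T_i^{\perp}:=\{F\mid \mathrm{Hom}(\mathcal T_i,F)=0=\mathrm{Ext}^1(\mathcal T_i,F)\}$, and each $\mathcal T_{i-1}^{\perp}\cap\mathcal T_i$ is equivalent to the category of finite-dimensional $k$-vector spaces. A nonzero object $E$ of $\mathcal E$ is irreducible if every inflation $A\to E$ is zero or an isomorphism. Let $\Lambda$ be the set of isomorphism classes of irreducible objects, $E(\lambda)$ the object corresponding to $\lambda\in\Lambda$, and order $\Lambda$ by the smallest partial order such that $E(\lambda)\notin E(\mu)^{\perp}$ implies $\lambda\preceq\mu$. A right (left) abelian envelope of $\mathcal E$ is an abelian category $\mathcal A_r(\mathcal E)$ (resp. $\mathcal A_l(\mathcal E)$) with a right exact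 functor $i_R:\mathcal E\to\mathcal A_r(\mathcal E)$ (resp. a left exact functor $i_L:\mathcal E\to\mathcal A_l(\mathcal E)$) such that, for every abelian category $\mathcal B$, composition with it is an equivalence $\mathrm{Rex}(\mathcal A_r(\mathcal E),\mathcal B)\to\mathrm{Rex}(\mathcal E,\mathcal B)$ (resp. $\mathrm{Lex}(\mathcal A_l(\mathcal E),\mathcal B)\to\mathrm{Lex}(\mathcal E,\mathcal B)$) of categories of right (left) exact functors. Let $\mathcal A$ be a $k$-linear abelian category with finite-dimensional $\mathrm{Hom}$ and $\mathrm{Ext}^1$, finitely many simple objects up to isomorphism, all objects of finite length, and a projective generator, and let $\preceq$ be a partial order on a set $M$ indexing the isomorphism classes of simple objects $L(\mu)$, $\mu\in M$. The standard object $\Delta(\mu)$ is the largest quotient of the projective cover $P(\mu)$ of $L(\mu)$ all of whose simple factors are of the form $L(\nu)$ with $\nu\preceq\mu$; the costandard object $\nabla(\mu)$ is the standard object of $\mu$ in $\mathcal A^{\mathrm{op}}$. Write $\mathcal F(\Delta)$, $\mathcal F(\nabla)$ for the extension closures of the standard, respectively costandard, objects. The pair $(\mathcal A,M)$ is a highest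 weight category if, for all $\mu\in M$, $\mathrm{End}(\Delta(\mu))\simeq k$ and $P(\mu)\in\mathcal F(\Delta)$. Theorem. Let $\mathcal E$ be a thin exact category over $k$ and $\Lambda$ its poset of irreducible objects as above. Then the right and left abelian envelopes $\mathcal A_r(\mathcal E)$ and $\mathcal A_l(\mathcal E)$ exist and carry $k$-linear structures for which $i_R$, $i_L$ are $k$-linear, and, for any such structures, the following hold. (1) $(\mathcal A_r(\mathcal E),\Lambda^{\mathrm{op}})$ is a highest weight category with standard objects $\Delta(\lambda)\simeq i_R(E(\lambda))$, $\lambda\in\Lambda$, and $i_R$ induces an equivalence of exact categories $\mathcal E\simeq\mathcal F(\Delta)$, where the conflations of $\mathcal F(\Delta)$ are the short exact sequences of $\mathcal A_r(\mathcal E)$ with all terms in $\mathcal F(\Delta)$. (2) $(\mathcal A_l(\mathcal E),\Lambda)$ is a highest weight category with costandard objects $\nabla(\lambda)\simeq i_L(E(\lambda))$, $\lambda\in\Lambda$, and $i_L$ induces an equivalence of exact categories $\mathcal E\simeq\mathcal F(\nabla)$, where the conflations of $\mathcal F(\nabla)$ are the short exact sequences of $\mathcal A_l(\mathcal E)$ with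 all terms in $\mathcal F(\nabla)$. -/

import Mathlib

open CategoryTheory CategoryTheory.Limits

universe w₁ w₂ v v' v'' u u' u'' w

attribute [local instance] Abelian.hasFiniteBiproducts

namespace ThinEnvelope

/-! ### Exact categories -/

/-- A (Quillen) exact structure on an additive category: a class of kernel-cokernel pairs
`X ⟶ Y ⟶ Z`, the conflations, closed under isomorphisms and subject to Keller's axioms. -/
structure ExactStructure (C : Type u) [Category.{v} C] [Preadditive C] where
  /-- `Confl f g` says that `X --f--> Y --g--> Z` is a conflation. -/
  Confl : ∀ {X Y Z : C}, (X ⟶ Y) → (Y ⟶ Z) → Prop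
  confl_of_iso : ∀ {X Y Z X' Y' Z' : C} {f : X ⟶ Y} {g : Y ⟶ Z} {f' : X' ⟶ Y'} {g' : Y' ⟶ Z'}
    (eX : X ≅ X') (eY : Y ≅ Y') (eZ : Z ≅ Z'),
    f ≫ eY.hom = eX.hom ≫ f' → g ≫ eZ.hom = eY.hom ≫ g' → Confl f g → Confl f' g'
  isKernel_isCokernel : ∀ {X Y Z : C} {f : X ⟶ Y} {g : Y ⟶ Z}, Confl f g →
    ∃ w : f ≫ g = 0, Nonempty (IsLimit (KernelFork.ofι f w)) ∧
      Nonempty (IsColimit (CokernelCofork.ofπ g w))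
  /-- (Ex 0) `0 ⟶ X ⟶ X` is a conflation. -/
  ex0 : ∀ {Z X : C}, IsZero Z → ∀ f : Z ⟶ X, Confl f (𝟙 X)
  /-- (Ex 1) The composite of two deflations is a deflation. -/
  ex1 : ∀ {K X Y K' Z : C} {i : K ⟶ X} {d : X ⟶ Y} {i' : K' ⟶ Y} {d' : Y ⟶ Z},
    Confl i d → Confl i' d' → ∃ (K'' : C) (i'' : K'' ⟶ X), Confl i'' (d ≫ d')
  /-- (Ex 2) The pullback of a deflation against any morphism exists and is a deflation. -/
  ex2 : ∀ {K Y Z Z' : C} {i : K ⟶ Y} {d : Y ⟶ Z} (g : Z' ⟶ Z), Confl i d →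
    ∃ (Y' K' : C) (g' : Y' ⟶ Y) (d' : Y' ⟶ Z') (i' : K' ⟶ Y'),
      IsPullback g' d' d g ∧ Confl i' d'
  /-- (Ex 2') The pushout of an inflation along any morphism exists and is an inflation. -/
  ex2' : ∀ {X Y Z X' : C} {i : X ⟶ Y} {d : Y ⟶ Z} (f : X ⟶ X'), Confl i d →
    ∃ (Y' Z' : C) (f' : Y ⟶ Y') (i' : X' ⟶ Y') (d' : Y' ⟶ Z'),
      IsPushout i f f' i' ∧ Confl i' d'

namespace ExactStructure

variable {C : Type u} [Category.{v} C] [Preadditive C] (S : ExactStructure C)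

/-- Inflations are the first components of conflations. -/
def Inflation {X Y : C} (i : X ⟶ Y) : Prop := ∃ (Z : C) (d : Y ⟶ Z), S.Confl i d

/-- Deflations are the second components of conflations. -/
def Deflation {Y Z : C} (d : Y ⟶ Z) : Prop := ∃ (X : C) (i : X ⟶ Y), S.Confl i d

end ExactStructure

/-- The exact structure of an abelian category: all short exact sequences are conflations. -/
def abelianExact (A : Type u) [Category.{v} A] [Abelian A] : ExactStructure A where
  Confl f g := ∃ w : f ≫ g = 0, (ShortComplex.mk f g w).ShortExact
  confl_of_iso := by
    rintro X Y Z X' Y' Z' f g f' g' eX eY eZ h₁ h₂ ⟨w, h⟩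
    have w' : f' ≫ g' = 0 := by
      rw [← cancel_epi eX.hom, ← Category.assoc, ← h₁, Category.assoc, ← h₂, ← Category.assoc, w]
      simp
    exact ⟨w', ShortComplex.shortExact_of_iso
      (ShortComplex.isoMk (S₁ := ShortComplex.mk f g w) (S₂ := ShortComplex.mk f' g' w')
        eX eY eZ h₁.symm h₂.symm) h⟩
  isKernel_isCokernel := by
    rintro X Y Z f g ⟨w, h⟩
    exact ⟨w, ⟨h.fIsKernel⟩, ⟨h.gIsCokernel⟩⟩
  ex0 := by
    intro Z X hZ f
    have w : f ≫ 𝟙 X = 0 := hZ.eq_of_src _ _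
    have : Mono f := ⟨fun _ _ _ => hZ.eq_of_tgt _ _⟩
    refine ⟨w, ShortComplex.ShortExact.mk' ?_ this (by dsimp; infer_instance)⟩
    exact (ShortComplex.exact_iff_mono _ (hZ.eq_of_src _ _)).2 (by dsimp; infer_instance)
  ex1 := by
    rintro K X Y K' Z i d i' d' ⟨w, h⟩ ⟨w', h'⟩
    have := h.epi_g
    have := h'.epi_g
    dsimp at *
    exact ⟨_, kernel.ι (d ≫ d'), kernel.condition _,
      ShortComplex.ShortExact.mk' (ShortComplex.exact_kernel _) (by dsimp; infer_instance)
        (by dsimp; infer_instance)⟩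
  ex2 := by
    rintro K Y Z Z' i d g ⟨w, h⟩
    have := h.epi_g
    dsimp at *
    exact ⟨_, _, pullback.fst d g, pullback.snd d g, kernel.ι (pullback.snd d g),
      IsPullback.of_hasPullback d g, kernel.condition _,
      ShortComplex.ShortExact.mk' (ShortComplex.exact_kernel _) (by dsimp; infer_instance)
        (by dsimp; infer_instance)⟩
  ex2' := by
    rintro X Y Z X' i d f ⟨w, h⟩
    have := h.mono_f
    dsimp at *
    exact ⟨_, _, pushout.inl i f, pushout.inr i f, cokernel.π (pushout.inr i f),
      IsPushout.of_hasPushout i f, cokernel.condition _,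
      ShortComplex.ShortExact.mk' (ShortComplex.exact_cokernel _) (by dsimp; infer_instance)
        (by dsimp; infer_instance)⟩

/-! ### Extensions and `Ext¹` -/

section Ext

variable {C : Type u} [Category.{v} C] [Preadditive C]

/-- A conflation `Y ⟶ mid ⟶ X`, i.e. a representative of a class in `Ext¹(X, Y)`. -/
structure Extension (S : ExactStructure C) (X Y : C) where
  mid : C
  i : Y ⟶ mid
  d : mid ⟶ X
  confl : S.Confl i d

/-- The extension splits, i.e. its class in `Ext¹(X, Y)` is zero. -/
def Extension.Splits {S : ExactStructure C} {X Y : C} (ξ : Extension S X Y) : Prop :=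
  ∃ s : X ⟶ ξ.mid, s ≫ ξ.d = 𝟙 X

/-- `Ext¹(X, Y) = 0`. -/
def ExtVanishes (S : ExactStructure C) (X Y : C) : Prop :=
  ∀ ξ : Extension S X Y, ξ.Splits

/-- The class of `ξ'` in `Ext¹(X, Y')` is the push-forward `f_* ξ` of the class of `ξ`: there is
a morphism of conflations from `ξ` to `ξ'` given by `f` on the left and by the identity of `X`
on the right. For `f = 𝟙 Y` this says that `ξ` and `ξ'` represent the same class. -/
def Extension.IsPushforward {S : ExactStructure C} {X Y Y' : C} (f : Y ⟶ Y')
    (ξ : Extension S X Y) (ξ' : Extension S X Y') : Prop :=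
  ∃ m : ξ.mid ⟶ ξ'.mid, ξ.i ≫ m = f ≫ ξ'.i ∧ m ≫ ξ'.d = ξ.d

/-- The class of `η` in the `k`-vector space `Ext¹(X, Y)` (with the Baer sum) is the linear
combination `∑ j, a j • [ξ j]`. Here `ζ` represents the class `([ξ j])_j` in
`Ext¹(X, Y ⊕ ⋯ ⊕ Y)`, and `η` is its push-forward along `(a j)_j : Y ⊕ ⋯ ⊕ Y ⟶ Y`. -/
def IsBaerCombination (k : Type w) [Field k] [Linear k C] [HasFiniteBiproducts C]
    {S : ExactStructure C} {X Y : C} {n : ℕ} (a : Fin n → k) (ξ : Fin n → Extension S X Y)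
    (η : Extension S X Y) : Prop :=
  ∃ ζ : Extension S X (⨁ fun _ : Fin n => Y),
    (∀ j, ζ.IsPushforward (biproduct.π (fun _ : Fin n => Y) j) (ξ j)) ∧
      ζ.IsPushforward (biproduct.desc fun j => a j • 𝟙 Y) η

/-- The `k`-vector space `Ext¹(X, Y)` is spanned by finitely many classes, for all `X` and `Y`. -/
def IsExtFinite (k : Type w) [Field k] [Linear k C] [HasFiniteBiproducts C]
    (S : ExactStructure C) : Prop :=
  ∀ X Y : C, ∃ (n : ℕ) (ξ : Fin n → Extension S X Y),
    ∀ η : Extension S X Y, ∃ a : Fin n → k, IsBaerCombination k a ξ η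

/-- All `Hom` spaces are finite dimensional. -/
def IsHomFinite (k : Type w) [Field k] (C : Type u) [Category.{v} C] [Preadditive C]
    [Linear k C] : Prop :=
  ∀ X Y : C, Module.Finite k (X ⟶ Y)

end Ext

/-! ### Filtrations of objects, extension closures, admissible subcategories -/

section Subcategories

variable {C : Type u} [Category.{v} C] [Preadditive C] (S : ExactStructure C)

/-- Objects `X` having a finite filtration `0 = X₀ → X₁ → ⋯ → Xₙ = X` by inflations, all of
whose graded factors satisfy `P`. -/
inductive HasFiltration (P : ObjectProperty C) : C → Prop
  | zero {X : C} : IsZero X → HasFiltration P X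
  | step {X Y Z : C} {f : X ⟶ Y} {g : Y ⟶ Z} :
      S.Confl f g → HasFiltration P X → P Z → HasFiltration P Y

/-- A full subcategory that contains zero and is closed under extensions (hence is closed under
isomorphisms and finite direct sums); it carries the induced exact structure. -/
structure IsFullyExact (P : ObjectProperty C) : Prop where
  zero : ∀ {X : C}, IsZero X → P X
  ext : ∀ {X Y Z : C} {f : X ⟶ Y} {g : Y ⟶ Z}, S.Confl f g → P X → P Z → P Y

/-- `F(P)`: the smallest fully exact subcategory that contains all objects satisfying `P`. -/
inductive ExtClosure (P : ObjectProperty C) : C → Prop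
  | of {X : C} : P X → ExtClosure P X
  | zero {X : C} : IsZero X → ExtClosure P X
  | ext {X Y Z : C} {f : X ⟶ Y} {g : Y ⟶ Z} :
      S.Confl f g → ExtClosure P X → ExtClosure P Z → ExtClosure P Y

/-- The right perpendicular subcategory `{X | Hom(T, X) = 0 = Ext¹(T, X) for all T in P}`. -/
def RightPerp (P : ObjectProperty C) : ObjectProperty C :=
  fun X => ∀ T : C, P T → (∀ f : T ⟶ X, f = 0) ∧ ExtVanishes S T X

/-- `P` is a right admissible subcategory: it is fully exact, and `(P, RightPerp P)` is a torsion
pair (there are no nonzero morphisms from `P` to `RightPerp P` by definition). -/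
structure IsRightAdmissible (P : ObjectProperty C) : Prop where
  fullyExact : IsFullyExact S P
  torsion : ∀ X : C, ∃ (T F : C) (i : T ⟶ X) (d : X ⟶ F),
    P T ∧ RightPerp S P F ∧ S.Confl i d

/-- A thin exact category over `k`: `Hom`- and `Ext¹`-finite, with a right admissible filtration
`0 = T₀ ⊆ T₁ ⊆ ⋯ ⊆ Tₙ = C` whose graded factors `T_{i-1}^⊥ ∩ T_i` are (`k`-linearly) equivalent
to the category of finite dimensional vector spaces. -/
structure IsThin (k : Type w) [Field k] [Linear k C] [HasFiniteBiproducts C] : Prop where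
  homFinite : IsHomFinite k C
  extFinite : IsExtFinite k S
  exists_filtration : ∃ (n : ℕ) (T : Fin (n + 1) → ObjectProperty C),
    (∀ i, IsRightAdmissible S (T i)) ∧ Monotone T ∧
    (∀ X, T 0 X ↔ IsZero X) ∧ (∀ X, T (Fin.last n) X) ∧
    ∀ i : Fin n, ∃ e : (RightPerp S (T i.castSucc) ⊓ T i.succ).FullSubcategory ≌
      FGModuleCat.{w} k, e.functor.Linear k

/-- Irreducible objects: nonzero objects `X` such that each inflation into `X` is zero or an
isomorphism. -/
def IsIrreducible : ObjectProperty C :=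
  fun X => ¬ IsZero X ∧ ∀ {Y : C} (f : Y ⟶ X), S.Inflation f → f = 0 ∨ IsIso f

/-- The set `Λ` of isomorphism classes of irreducible objects. -/
def Irr : Type u := Quotient (isIsomorphicSetoid (IsIrreducible S).FullSubcategory)

/-- The irreducible object `E(λ)` (a representative of the class `λ`). -/
noncomputable def Irr.obj {S : ExactStructure C} (l : Irr S) : C := (Quotient.out l).obj

/-- The canonical order on `Λ`: the smallest reflexive and transitive relation such that
`E(λ) ∉ E(μ)^⊥` implies `λ ≼ μ`. -/
def Irr.le (l m : Irr S) : Prop :=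
  Relation.ReflTransGen
    (fun a b : Irr S => ¬ RightPerp S (fun X => X = b.obj) a.obj) l m

end Subcategories

/-! ### Right and left exact functors, abelian envelopes -/

section Exactness

variable {C : Type u} [Category.{v} C] [Preadditive C]
variable {D : Type u'} [Category.{v'} D] [Preadditive D]
variable {B : Type u''} [Category.{v''} B] [Preadditive B]

/-- Right exact functors: for each conflation `X --i--> Y --d--> Z`, `F d` is a deflation with
kernel `i'`, and `F i` is a deflation followed by `i'`. -/
structure IsRightExact (S : ExactStructure C) (T : ExactStructure D) (F : C ⥤ D) : Prop where
  additive : F.Additive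
  exact : ∀ {X Y Z : C} {i : X ⟶ Y} {d : Y ⟶ Z}, S.Confl i d →
    ∃ (X' : D) (d' : F.obj X ⟶ X') (i' : X' ⟶ F.obj Y),
      T.Confl i' (F.map d) ∧ T.Deflation d' ∧ F.map i = d' ≫ i'

/-- Left exact functors: for each conflation `X --i--> Y --d--> Z`, `F i` is an inflation with
cokernel `d'`, and `F d` is `d'` followed by an inflation. -/
structure IsLeftExact (S : ExactStructure C) (T : ExactStructure D) (F : C ⥤ D) : Prop where
  additive : F.Additive
  exact : ∀ {X Y Z : C} {i : X ⟶ Y} {d : Y ⟶ Z}, S.Confl i d →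
    ∃ (Z' : D) (d' : F.obj Y ⟶ Z') (i' : Z' ⟶ F.obj Z),
      T.Confl (F.map i) d' ∧ T.Inflation i' ∧ F.map d = d' ≫ i'

theorem IsRightExact.comp {S : ExactStructure C} {T : ExactStructure D} {U : ExactStructure B}
    {F : C ⥤ D} {G : D ⥤ B} (hF : IsRightExact S T F) (hG : IsRightExact T U G) :
    IsRightExact S U (F ⋙ G) where
  additive := by
    have := hF.additive
    have := hG.additive
    infer_instance
  exact h := by
    obtain ⟨X', d', i', h₁, ⟨K, j, h₂⟩, h₃⟩ := hF.exact h
    obtain ⟨X'', d'', i'', h₄, ⟨K', j', h₅⟩, h₆⟩ := hG.exact h₁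
    obtain ⟨_, _, _, h₇, _, _⟩ := hG.exact h₂
    refine ⟨X'', G.map d' ≫ d'', i'', h₄, U.ex1 h₇ h₅, ?_⟩
    simp [h₃, h₆]

theorem IsLeftExact.comp {B : Type u''} [Category.{v''} B] [Abelian B]
    {S : ExactStructure C} {T : ExactStructure D}
    {F : C ⥤ D} {G : D ⥤ B} (hF : IsLeftExact S T F) (hG : IsLeftExact T (abelianExact B) G) :
    IsLeftExact S (abelianExact B) (F ⋙ G) where
  additive := by
    have := hF.additive
    have := hG.additive
    infer_instance
  exact h := by
    obtain ⟨Z', d', i', h₁, ⟨K, j, h₂⟩, h₃⟩ := hF.exact h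
    obtain ⟨Z'', d'', i'', h₄, ⟨K', j', w₅, h₅⟩, h₆⟩ := hG.exact h₁
    obtain ⟨_, _, _, ⟨w₇, h₇⟩, _, _⟩ := hG.exact h₂
    have := h₅.mono_f
    have := h₇.mono_f
    dsimp at *
    refine ⟨Z'', d'', i'' ≫ G.map i', h₄, ⟨_, cokernel.π (i'' ≫ G.map i'), cokernel.condition _,
      ShortComplex.ShortExact.mk' (ShortComplex.exact_cokernel _) (by dsimp; infer_instance)
        (by dsimp; infer_instance)⟩, ?_⟩
    simp [h₃, reassoc_of% h₆]

/-- The category `Rex(C, D)` of right exact functors and natural transformations. -/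
abbrev Rex (S : ExactStructure C) (T : ExactStructure D) :=
  ObjectProperty.FullSubcategory (C := C ⥤ D) (IsRightExact S T)

/-- The category `Lex(C, D)` of left exact functors and natural transformations. -/
abbrev Lex (S : ExactStructure C) (T : ExactStructure D) :=
  ObjectProperty.FullSubcategory (C := C ⥤ D) (IsLeftExact S T)

end Exactness

section Envelopes

variable {C : Type u} [Category.{v} C] [Preadditive C] {S : ExactStructure C}
variable {A : Type u'} [Category.{v'} A] [Abelian A] {F : C ⥤ A}

/-- Precomposition `(-) ∘ F : Rex(A, B) ⥤ Rex(C, B)` with a right exact functor `F : C ⥤ A`. -/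
def rexPrecomp (hF : IsRightExact S (abelianExact A) F) (B : Type u'') [Category.{v''} B]
    [Abelian B] : Rex (abelianExact A) (abelianExact B) ⥤ Rex S (abelianExact B) :=
  ObjectProperty.lift _ (ObjectProperty.ι _ ⋙ (Functor.whiskeringLeft C A B).obj F)
    fun G => hF.comp G.property

/-- Precomposition `(-) ∘ F : Lex(A, B) ⥤ Lex(C, B)` with a left exact functor `F : C ⥤ A`. -/
def lexPrecomp (hF : IsLeftExact S (abelianExact A) F) (B : Type u'') [Category.{v''} B]
    [Abelian B] : Lex (abelianExact A) (abelianExact B) ⥤ Lex S (abelianExact B) :=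
  ObjectProperty.lift _ (ObjectProperty.ι _ ⋙ (Functor.whiskeringLeft C A B).obj F)
    fun G => hF.comp G.property

variable (S F)

/-- `F : C ⥤ A` is the right abelian envelope of the exact category `(C, S)`: it is right exact,
and `(-) ∘ F : Rex(A, B) ⥤ Rex(C, B)` is an equivalence for all abelian categories `B` (with
objects in `Type w₁` and morphisms in `Type w₂`). -/
structure IsRightAbelianEnvelope : Prop where
  rightExact : IsRightExact S (abelianExact A) F
  isEquivalence : ∀ (B : Type w₁) [Category.{w₂} B] [Abelian B],
    (rexPrecomp rightExact B).IsEquivalence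

/-- `F : C ⥤ A` is the left abelian envelope of the exact category `(C, S)`: it is left exact,
and `(-) ∘ F : Lex(A, B) ⥤ Lex(C, B)` is an equivalence for all abelian categories `B` (with
objects in `Type w₁` and morphisms in `Type w₂`). -/
structure IsLeftAbelianEnvelope : Prop where
  leftExact : IsLeftExact S (abelianExact A) F
  isEquivalence : ∀ (B : Type w₁) [Category.{w₂} B] [Abelian B],
    (lexPrecomp leftExact B).IsEquivalence

/-- `F` induces an equivalence of the exact category `(C, S)` with the full subcategory `P` of the
abelian category `A`, where the conflations in `P` are the short exact sequences with all terms
in `P`. -/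
structure InducesExactEquivalence (P : ObjectProperty A) : Prop where
  mem : ∀ X : C, P (F.obj X)
  isEquivalence : (P.lift F mem).IsEquivalence
  confl_iff : ∀ {X Y Z : C} (i : X ⟶ Y) (d : Y ⟶ Z),
    S.Confl i d ↔ (abelianExact A).Confl (F.map i) (F.map d)

end Envelopes

/-! ### Highest weight categories -/

section HighestWeight

variable {A : Type u} [Category.{v} A] [Abelian A]

/-- A `k`-linear abelian category of finite length (`Hom`- and `Ext¹`-finite, with finitely many
simple objects up to isomorphism, all objects having a finite filtration with simple factors) that
has a projective generator. -/
structure IsDeligneFinite (k : Type w) [Field k] (A : Type u) [Category.{v} A] [Abelian A]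
    [Linear k A] : Prop where
  homFinite : IsHomFinite k A
  extFinite : IsExtFinite k (abelianExact A)
  finite_simple : Finite
    (Quotient (isIsomorphicSetoid (ObjectProperty.FullSubcategory fun X : A => Simple X)))
  finite_length : ∀ X : A, HasFiltration (abelianExact A) (fun Y => Simple Y) X
  exists_generator : ∃ P : A, Projective P ∧
    ∀ X : A, ∃ (n : ℕ) (f : (⨁ fun _ : Fin n => P) ⟶ X), Epi f

/-- `P` is a projective cover of `X`: it is projective and has a superfluous epimorphism to `X`. -/
def IsProjectiveCover (P X : A) : Prop :=
  Projective P ∧ ∃ p : P ⟶ X, Epi p ∧ ∀ {Y : A} (g : Y ⟶ P), Epi (g ≫ p) → Epi g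

variable {ι : Type w₁} (le : ι → ι → Prop) (L : ι → A)

/-- All simple factors of `X` are isomorphic to `L μ` for some `μ ≼ l`. -/
def FactorsLE (l : ι) (X : A) : Prop :=
  HasFiltration (abelianExact A) (fun Y => ∃ m, le m l ∧ Nonempty (Y ≅ L m)) X

/-- `D` is the standard object `Δ(l)`: the largest quotient of the projective cover `P` of `L l`
all of whose simple factors are isomorphic to `L m` with `m ≼ l`. -/
def IsStandard (l : ι) : ObjectProperty A := fun D =>
  ∃ (P : A) (q : P ⟶ D), IsProjectiveCover P (L l) ∧ Epi q ∧ FactorsLE le L l D ∧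
    ∀ {Q : A} (r : P ⟶ Q), Epi r → FactorsLE le L l Q → ∃ s : D ⟶ Q, q ≫ s = r

/-- `D` is the costandard object `∇(l)`: it is the standard object in the opposite category, i.e.
the largest subobject of the injective hull of `L l` all of whose simple factors are isomorphic
to `L m` with `m ≼ l`. -/
def IsCostandard (l : ι) : ObjectProperty A := fun D =>
  IsStandard le (fun m => Opposite.op (L m)) l (Opposite.op D)

/-- `F(Δ)`: the extension closure of the standard objects. -/
def StandardlyFiltered : ObjectProperty A :=
  ExtClosure (abelianExact A) fun X => ∃ l, IsStandard le L l X

/-- `F(∇)`: the extension closure of the costandard objects. -/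
def CostandardlyFiltered : ObjectProperty A :=
  ExtClosure (abelianExact A) fun X => ∃ l, IsCostandard le L l X

/-- `(A, Λ)` is a highest weight category, where `Λ` is the partial order `le` on the set of
isomorphism classes of simple objects of `A`, enumerated as `L`. -/
structure IsHighestWeight (k : Type w) [Field k] [Linear k A] : Prop where
  deligneFinite : IsDeligneFinite k A
  partialOrder : IsPartialOrder ι le
  simple : ∀ l, Simple (L l)
  eq_of_iso : ∀ l m, Nonempty (L l ≅ L m) → l = m
  exists_iso : ∀ X : A, Simple X → ∃ l, Nonempty (X ≅ L l)
  /-- (st1) `End(Δ(l)) ≃ k` -/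
  st1 : ∀ l D, IsStandard le L l D → Nonempty (End D ≃ₐ[k] k)
  /-- (st2) `P(l)` lies in `F(Δ)` -/
  st2 : ∀ l P, IsProjectiveCover P (L l) → StandardlyFiltered le L P

end HighestWeight

end ThinEnvelope

open ThinEnvelope

/-!
The argument replaces the filtration of a thin exact category by a self-dual notion, an
`ExceptionalFamily`: finitely many partially ordered objects that generate the category under
extensions, have scalar endomorphisms, and have morphisms and extensions between them in one
direction only. The layers of the filtration provide such a family
(`IsThin.exists_exceptionalFamily`), and its members are exactly the irreducible objects up to
isomorphism (`ExceptionalFamily.irr`). Finite-dimensionality of `Ext¹` is used only to form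
universal extensions and their duals, so that a family for `E` is also one for the opposite
category, with reversed order; the statements on left envelopes and costandard objects are those on
right envelopes and standard objects for `Eᵒᵖ`.

Iterated universal extensions put a projective object `Q` above each member of the family, with
kernel filtered by smaller members (`ExceptionalFamily.exists_projective`). Hence `E` has a
projective generator `P`, and `Hom(P, -)` embeds `E` into the finitely generated right modules over
the finite dimensional algebra `End P`. This embedding is a *realization* (`IsRealization`,
`exists_isRealization`): fully faithful, exact, and such that the projective objects in its image
cover everything. A realization `F` is a right abelian envelope
(`IsRealization.isRightAbelianEnvelope`): a right exact functor on `E` has a pointwise left Kan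
extension along `F`, computed by presentations `F Q₁ ⟶ F Q₀ ⟶ M ⟶ 0`. By uniqueness of envelopes,
conversely each right envelope is a realization, and scalars act on it through the endomorphisms of
the identity functor.

A realization identifies `E` with the extension closure of the images of the irreducible objects,
including conflations, because extensions of objects in the image are pushouts of images of
conflations (`IsRealization.inducesExactEquivalence`). The images of the irreducible objects have
simple tops, which enumerate the simple objects, and satisfy the axioms of `StandardData`: other
simple factors are smaller, and a projective object covers them with kernel filtered by larger ones
(`ExceptionalFamily.exists_standardData`). This makes them the standard objects.

It remains to see that all projective covers are filtered by standard objects. Given standard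
objects `Δ l`, the costandard objects `N i`, defined as the largest suitable subobjects of
injective hulls, satisfy `Ext¹(Δ l, N i) = 0`, and an object `X` with `Ext¹(Δ l, X) = 0` for all
`l` is filtered by costandard objects. Thus the `N i` are standard data for the opposite category,
and injective objects are filtered by them (`StandardData.exists_costandardData`). Applying this a
second time, in the opposite category, yields standard objects which filter the projective ones
(`StandardData.exists_standardData`), and standard objects are unique up to isomorphism. For the
left envelope, the irreducible objects give standard data of the opposite category, and the second
half of this argument suffices.
-/

namespace ThinEnvelope

open Opposite ZeroObject

attribute [local instance] hasBinaryBiproducts_of_finite_biproducts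

set_option linter.unusedSectionVars false

/-! ### Calculus of conflations -/

section ExactBasics

variable {C : Type u} [Category.{v} C] [Preadditive C] {S : ExactStructure C}

namespace ExactStructure

theorem Confl.w {X Y Z : C} {f : X ⟶ Y} {g : Y ⟶ Z} (h : S.Confl f g) : f ≫ g = 0 :=
  (S.isKernel_isCokernel h).1

theorem Confl.mono {X Y Z : C} {f : X ⟶ Y} {g : Y ⟶ Z} (h : S.Confl f g) : Mono f := by
  obtain ⟨w, ⟨hk⟩, -⟩ := S.isKernel_isCokernel h
  exact mono_of_isLimit_fork hk

theorem Confl.epi {X Y Z : C} {f : X ⟶ Y} {g : Y ⟶ Z} (h : S.Confl f g) : Epi g := by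
  obtain ⟨w, -, ⟨hk⟩⟩ := S.isKernel_isCokernel h
  exact epi_of_isColimit_cofork hk

theorem Confl.lift {X Y Z : C} {f : X ⟶ Y} {g : Y ⟶ Z} (h : S.Confl f g) {W : C} (t : W ⟶ Y)
    (ht : t ≫ g = 0) : ∃ s : W ⟶ X, s ≫ f = t := by
  obtain ⟨w, ⟨hk⟩, -⟩ := S.isKernel_isCokernel h
  exact ⟨hk.lift (KernelFork.ofι t ht), hk.fac _ WalkingParallelPair.zero⟩

theorem Confl.desc {X Y Z : C} {f : X ⟶ Y} {g : Y ⟶ Z} (h : S.Confl f g) {W : C} (t : Y ⟶ W)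
    (ht : f ≫ t = 0) : ∃ s : Z ⟶ W, g ≫ s = t := by
  obtain ⟨w, -, ⟨hk⟩⟩ := S.isKernel_isCokernel h
  exact ⟨hk.desc (CokernelCofork.ofπ t ht), hk.fac _ WalkingParallelPair.one⟩

/-- A deflation together with any of its kernels is a conflation. -/
theorem Confl.of_kernel {X Y Z X' : C} {f : X ⟶ Y} {g : Y ⟶ Z} (h : S.Confl f g)
    {f' : X' ⟶ Y} (w : f' ≫ g = 0) (hm : Mono f')
    (hl : ∀ {W : C} (t : W ⟶ Y), t ≫ g = 0 → ∃ s : W ⟶ X', s ≫ f' = t) : S.Confl f' g := by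
  have := h.mono
  obtain ⟨a, ha⟩ := h.lift f' w
  obtain ⟨b, hb⟩ := hl f h.w
  refine S.confl_of_iso ⟨b, a, ?_, ?_⟩ (Iso.refl _) (Iso.refl _) ?_ ?_ h
  · rw [← cancel_mono f]; simp [ha, hb]
  · rw [← cancel_mono f']; simp [ha, hb]
  · simp [hb]
  · simp

/-- An inflation together with any of its cokernels is a conflation. -/
theorem Confl.of_cokernel {X Y Z Z' : C} {f : X ⟶ Y} {g : Y ⟶ Z} (h : S.Confl f g)
    {g' : Y ⟶ Z'} (w : f ≫ g' = 0) (he : Epi g')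
    (hd : ∀ {W : C} (t : Y ⟶ W), f ≫ t = 0 → ∃ s : Z' ⟶ W, g' ≫ s = t) : S.Confl f g' := by
  have := h.epi
  obtain ⟨a, ha⟩ := h.desc g' w
  obtain ⟨b, hb⟩ := hd g h.w
  refine S.confl_of_iso (Iso.refl _) (Iso.refl _) ⟨a, b, ?_, ?_⟩ ?_ ?_ h
  · rw [← cancel_epi g]; simp [reassoc_of% ha, hb]
  · rw [← cancel_epi g']; simp [reassoc_of% hb, ha]
  · simp
  · simp [ha]

theorem Confl.precomp_iso {X Y Z X' : C} {f : X ⟶ Y} {g : Y ⟶ Z} (h : S.Confl f g) (e : X' ≅ X) :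
    S.Confl (e.hom ≫ f) g :=
  S.confl_of_iso e.symm (Iso.refl _) (Iso.refl _) (by simp) (by simp) h

theorem Confl.postcomp_iso {X Y Z Z' : C} {f : X ⟶ Y} {g : Y ⟶ Z} (h : S.Confl f g) (e : Z ≅ Z') :
    S.Confl f (g ≫ e.hom) :=
  S.confl_of_iso (Iso.refl _) (Iso.refl _) e (by simp) (by simp) h

/-- Pulling back a conflation: the pulled back deflation has the same kernel. -/
theorem Confl.exists_pullback {K Y Z Z' : C} {i : K ⟶ Y} {d : Y ⟶ Z} (h : S.Confl i d)
    (g : Z' ⟶ Z) : ∃ (Y' : C) (g' : Y' ⟶ Y) (d' : Y' ⟶ Z') (i' : K ⟶ Y'),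
      IsPullback g' d' d g ∧ S.Confl i' d' ∧ i' ≫ g' = i := by
  obtain ⟨Y', K', g', d', j, hp, hc⟩ := S.ex2 g h
  have := h.mono
  refine ⟨Y', g', d', hp.lift i 0 (by simp [h.w]), hp, ?_, by simp⟩
  refine hc.of_kernel (by simp) ?_ ?_
  · refine ⟨fun a b hab => ?_⟩
    rw [← cancel_mono i]
    simpa using congr($hab ≫ g')
  · intro W t ht
    obtain ⟨s, hs⟩ := h.lift (t ≫ g') (by rw [Category.assoc, hp.w, reassoc_of% ht, zero_comp])
    exact ⟨s, hp.hom_ext (by simp [hs]) (by simp [ht])⟩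

/-- Pushing out a conflation: the pushed out inflation has the same cokernel. -/
theorem Confl.exists_pushout {X Y Z X' : C} {i : X ⟶ Y} {d : Y ⟶ Z} (h : S.Confl i d)
    (f : X ⟶ X') : ∃ (Y' : C) (f' : Y ⟶ Y') (i' : X' ⟶ Y') (d' : Y' ⟶ Z),
      IsPushout i f f' i' ∧ S.Confl i' d' ∧ f' ≫ d' = d := by
  obtain ⟨Y', K', f', i', j, hp, hc⟩ := S.ex2' f h
  have := h.epi
  refine ⟨Y', f', i', hp.desc d 0 (by simp [h.w]), hp, ?_, by simp⟩
  refine hc.of_cokernel (by simp) ?_ ?_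
  · refine ⟨fun a b hab => ?_⟩
    rw [← cancel_epi d]
    simpa using congr(f' ≫ $hab)
  · intro W t ht
    obtain ⟨s, hs⟩ := h.desc (f' ≫ t) (by
      rw [← Category.assoc, hp.w, Category.assoc, ht, comp_zero])
    exact ⟨s, hp.hom_ext (by simp [hs]) (by simp [ht])⟩

/-- A deflation may be pulled back along any given pullback square. -/
theorem Confl.of_isPullback {K Y Z Y' Z' : C} {i : K ⟶ Y} {d : Y ⟶ Z} (h : S.Confl i d)
    {g : Z' ⟶ Z} {g' : Y' ⟶ Y} {d' : Y' ⟶ Z'} (hp : IsPullback g' d' d g) {i' : K ⟶ Y'}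
    (h₁ : i' ≫ g' = i) (h₂ : i' ≫ d' = 0) : S.Confl i' d' := by
  obtain ⟨Y'', g'', d'', i'', hp', hc, hi⟩ := h.exists_pullback g
  refine S.confl_of_iso (Iso.refl _) (hp'.isoIsPullback _ _ hp) (Iso.refl _) ?_ (by simp) hc
  exact hp.hom_ext (by simp [h₁, hi]) (by simp [h₂, hc.w])

/-- An inflation may be pushed out along any given pushout square. -/
theorem Confl.of_isPushout {X Y Z X' Y' : C} {i : X ⟶ Y} {d : Y ⟶ Z} (h : S.Confl i d)
    {f : X ⟶ X'} {f' : Y ⟶ Y'} {i' : X' ⟶ Y'} (hp : IsPushout i f f' i') {d' : Y' ⟶ Z}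
    (h₁ : f' ≫ d' = d) (h₂ : i' ≫ d' = 0) : S.Confl i' d' := by
  obtain ⟨Y'', f'', i'', d'', hp', hc, hi⟩ := h.exists_pushout f
  refine S.confl_of_iso (Iso.refl _) (hp'.isoIsPushout _ _ hp) (Iso.refl _) (by simp) ?_ hc
  exact hp'.hom_ext (by simp [h₁, hi]) (by simp [h₂, hc.w])

variable (S)

/-- The dual of the axiom (Ex 0): `X ⟶ X ⟶ 0` is a conflation. -/
theorem confl_id_zero (X : C) {Z : C} (hZ : IsZero Z) (f : X ⟶ Z) :
    S.Confl (𝟙 X) f := by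
  have h0 : S.Confl (𝟙 Z) (𝟙 Z) := S.ex0 hZ (𝟙 Z)
  obtain ⟨Y', f', i', d', hp, hc, hd⟩ := h0.exists_pushout (hZ.to_ X)
  have : IsIso i' := hp.isIso_inr_of_isIso
  refine S.confl_of_iso (Iso.refl X) (asIso i').symm (Iso.refl Z) (by simp) (hZ.eq_of_tgt _ _) hc

theorem confl_zero_iso {X Y Z : C} (hZ : IsZero Z) (e : X ≅ Y) (f : Z ⟶ X) :
    S.Confl f e.hom :=
  S.confl_of_iso (Iso.refl _) (Iso.refl _) e (by simp) (by simp) (S.ex0 hZ f)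

variable [HasFiniteBiproducts C]

theorem confl_biprod (X Y : C) :
    S.Confl (biprod.inl : X ⟶ X ⊞ Y) (biprod.snd : X ⊞ Y ⟶ Y) := by
  refine (S.confl_id_zero X (isZero_zero C) 0).of_isPullback (g := 0) (g' := biprod.fst)
    ⟨⟨by simp⟩, ⟨PullbackCone.IsLimit.mk _ (fun s => biprod.lift s.fst s.snd) ?_ ?_ ?_⟩⟩
    (by simp) (by simp)
  · intro s; simp
  · intro s; simp
  · intro s m h₁ h₂
    ext <;> simp [h₁, h₂]

variable {S}

theorem Confl.map_id_left {X Y Z : C} {i : X ⟶ Y} {d : Y ⟶ Z} (h : S.Confl i d) (D : C) :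
    S.Confl (i ≫ biprod.inr) (biprod.map (𝟙 D) d) := by
  refine h.of_isPullback (g := biprod.snd) (g' := biprod.snd)
    ⟨⟨by simp⟩, ⟨PullbackCone.IsLimit.mk _ (fun s => biprod.lift (s.snd ≫ biprod.fst) s.fst)
      ?_ ?_ ?_⟩⟩ (by simp) (by simp [reassoc_of% h.w])
  · intro s; simp
  · intro s
    ext
    · simp
    · simpa using s.condition
  · intro s m h₁ h₂
    ext
    · simp [← h₂]
    · simp [h₁]

/-- The composite of two inflations is an inflation. More precisely, if `p` is the cokernel of the
first inflation `i`, then the pushout of the second inflation `j` along `p` exists and pushes `j`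
out to an inflation, whose companion `p'` is a cokernel of the composite. -/
theorem Confl.comp_inflation {X B P D F : C} {i : X ⟶ B} {p : B ⟶ P} {j : B ⟶ D} {q : D ⟶ F}
    (h₁ : S.Confl i p) (h₂ : S.Confl j q) :
    ∃ (D' : C) (p' : D ⟶ D') (j' : P ⟶ D') (q' : D' ⟶ F), IsPushout j p p' j' ∧
      S.Confl j' q' ∧ p' ≫ q' = q ∧ S.Confl (i ≫ j) p' := by
  obtain ⟨D', p', j', q', hp, hc, hq⟩ := h₂.exists_pushout p
  refine ⟨D', p', j', q', hp, hc, hq, ?_⟩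
  have := h₁.mono
  have := h₂.mono
  -- pull back `q'` along `q`: the result is `D ⊞ P`, mapping to `D'` by `(p', j')`
  have hpb : IsPullback (biprod.desc p' j') (biprod.fst : D ⊞ P ⟶ D) q' q := by
    refine ⟨⟨by ext <;> simp [hq, hc.w]⟩, ⟨PullbackCone.IsLimit.mk _ (fun s =>
      biprod.lift s.snd (hc.lift (s.fst - s.snd ≫ p') (by
        simp [s.condition, hq])).choose) ?_ ?_ ?_⟩⟩
    · intro s
      have := (hc.lift (s.fst - s.snd ≫ p') (by simp [s.condition, hq])).choose_spec
      simp [biprod.lift_desc, this]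
    · intro s; simp
    · intro s m h1 h2
      have := (hc.lift (s.fst - s.snd ≫ p') (by simp [s.condition, hq])).choose_spec
      have := hc.mono
      ext
      · simpa using h2
      · rw [← cancel_mono j']
        simp only [biprod.lift_snd, *]
        rw [← h1, ← h2]
        have : m = (m ≫ biprod.fst) ≫ biprod.inl + (m ≫ biprod.snd) ≫ biprod.inr := by
          ext <;> simp
        nth_rw 2 [this]
        simp
  have hA : S.Confl (biprod.lift j (-p)) (biprod.desc p' j') :=
    h₂.of_isPullback hpb.flip (by simp) (by simp [hp.w])
  -- By (Ex 1) there is a deflation `D ⊞ B ⟶ D'`. Up to an automorphism of `D ⊞ B` it is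
  -- `fst ≫ p'`, with kernel `X ⊞ B`, and pushing out along `fst` removes the summand `B`.
  obtain ⟨K, l, hl⟩ := S.ex1 (h₁.map_id_left D) hA
  have hE : biprod.map (𝟙 D) p ≫ biprod.desc p' j' = biprod.desc (𝟙 D) j ≫ p' := by
    ext <;> simp [hp.w]
  let e : D ⊞ B ≅ D ⊞ B :=
    ⟨biprod.lift (biprod.desc (𝟙 D) j) biprod.snd, biprod.lift (biprod.desc (𝟙 D) (-j)) biprod.snd,
      by ext <;> simp, by ext <;> simp⟩
  have hl' : S.Confl (l ≫ e.hom) (biprod.fst ≫ p') := by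
    refine S.confl_of_iso (Iso.refl _) e (Iso.refl _) (by simp) ?_ hl
    simp [hE, e]
  have hker : ∀ {W : C} (t : W ⟶ D), t ≫ p' = 0 → ∃ s : W ⟶ X, s ≫ i ≫ j = t := by
    intro W t ht
    obtain ⟨s, rfl⟩ := h₂.lift t (by rw [← hq, reassoc_of% ht, zero_comp])
    have := hc.mono
    obtain ⟨u, rfl⟩ := h₁.lift s (by
      rw [← cancel_mono j', Category.assoc, ← hp.w, zero_comp, ← Category.assoc, ht])
    exact ⟨u, by simp⟩
  have hz : i ≫ j ≫ p' = 0 := by rw [hp.w, reassoc_of% h₁.w, zero_comp]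
  have hl'' : S.Confl (biprod.map (i ≫ j) (𝟙 B)) (biprod.fst ≫ p') := by
    refine hl'.of_kernel (by ext <;> simp [hz]) inferInstance ?_
    intro W t ht
    obtain ⟨s, hs⟩ := hker (t ≫ biprod.fst) (by simpa using ht)
    exact ⟨biprod.lift s (t ≫ biprod.snd), by ext <;> simp [hs]⟩
  refine hl''.of_isPushout (f := biprod.fst) (f' := biprod.fst)
    ⟨⟨by ext <;> simp⟩, ⟨PushoutCocone.IsColimit.mk _ (fun s => biprod.inl ≫ s.inl) ?_ ?_ ?_⟩⟩
    rfl (by simpa using hz)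
  · intro s
    have h1 : biprod.inr ≫ s.inl = 0 := by
      simpa using congr((biprod.inr : B ⟶ X ⊞ B) ≫ $(s.condition))
    ext <;> simp [h1]
  · intro s
    simpa using congr((biprod.inl : X ⟶ X ⊞ B) ≫ $(s.condition))
  · intro s m h₁ h₂
    simp [← h₁]

end ExactStructure
end ExactBasics

/-! ### Opposite exact structures and the vanishing of `Ext¹` -/

section OppositeExact

variable {C : Type u} [Category.{v} C] [Preadditive C]

/-- The opposite exact structure: its conflations are the conflations of `S`, read backwards. -/
def ExactStructure.op [HasFiniteBiproducts C] (S : ExactStructure C) : ExactStructure Cᵒᵖ where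
  Confl f g := S.Confl g.unop f.unop
  confl_of_iso eX eY eZ h₁ h₂ h :=
    S.confl_of_iso eZ.symm.unop eY.symm.unop eX.symm.unop
      (by
        have := congr(eY.inv ≫ $h₂ ≫ eZ.inv)
        simp only [Category.assoc, Iso.hom_inv_id, Category.comp_id, Iso.inv_hom_id_assoc] at this
        exact congr(($this).unop))
      (by
        have := congr(eX.inv ≫ $h₁ ≫ eY.inv)
        simp only [Category.assoc, Iso.hom_inv_id, Category.comp_id, Iso.inv_hom_id_assoc] at this
        exact congr(($this).unop)) h
  isKernel_isCokernel h := by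
    obtain ⟨w, ⟨hk⟩, ⟨hc⟩⟩ := S.isKernel_isCokernel h
    exact ⟨Quiver.Hom.unop_inj w, ⟨CokernelCofork.IsColimit.ofπOp _ _ hc⟩,
      ⟨KernelFork.IsLimit.ofιOp _ _ hk⟩⟩
  ex0 hZ f := S.confl_id_zero _ hZ.unop _
  ex1 h h' := by
    obtain ⟨D, p, -, -, -, -, -, hc⟩ := h'.comp_inflation h
    exact ⟨_, p.op, hc⟩
  ex2 g h := by
    obtain ⟨Y', Z', f', i', d', hp, hc⟩ := S.ex2' g.unop h
    exact ⟨_, _, f'.op, i'.op, d'.op, hp.op.flip, hc⟩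
  ex2' f h := by
    obtain ⟨Y', K', g', d', i', hp, hc⟩ := S.ex2 f.unop h
    exact ⟨_, _, g'.op, d'.op, i'.op, hp.op.flip, hc⟩

variable [HasFiniteBiproducts C] {S : ExactStructure C}

theorem ExactStructure.op_confl_iff {X Y Z : Cᵒᵖ} {f : X ⟶ Y} {g : Y ⟶ Z} :
    S.op.Confl f g ↔ S.Confl g.unop f.unop := Iff.rfl

theorem ExactStructure.Confl.op {X Y Z : C} {f : X ⟶ Y} {g : Y ⟶ Z} (h : S.Confl f g) :
    S.op.Confl g.op f.op := h

instance : HasFiniteBiproducts Cᵒᵖ := HasFiniteBiproducts.of_hasFiniteProducts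

end OppositeExact

section ExtensionCalculus

variable {C : Type u} [Category.{v} C] [Preadditive C] [HasFiniteBiproducts C]
  {S : ExactStructure C}

namespace ExactStructure

theorem Confl.exists_section_of_retraction {X Y Z : C} {i : X ⟶ Y} {d : Y ⟶ Z}
    (h : S.Confl i d) {r : Y ⟶ X} (hr : i ≫ r = 𝟙 X) : ∃ s : Z ⟶ Y, s ≫ d = 𝟙 Z := by
  have := h.epi
  obtain ⟨s, hs⟩ := h.desc (𝟙 Y - r ≫ i) (by simp [reassoc_of% hr])
  exact ⟨s, by rw [← cancel_epi d, reassoc_of% hs]; simp [h.w]⟩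

theorem Confl.exists_retraction_of_section {X Y Z : C} {i : X ⟶ Y} {d : Y ⟶ Z}
    (h : S.Confl i d) {s : Z ⟶ Y} (hs : s ≫ d = 𝟙 Z) : ∃ r : Y ⟶ X, i ≫ r = 𝟙 X := by
  have := h.mono
  obtain ⟨r, hr⟩ := h.lift (𝟙 Y - d ≫ s) (by simp [hs])
  exact ⟨r, by rw [← cancel_mono i, Category.assoc, hr]; simp [reassoc_of% h.w]⟩

/-- In a morphism of conflations which is the identity on the kernels, the square of the
deflations has the lifting property of a pullback. -/
theorem Confl.pullback_lift {K Y₁ Z₁ Y₂ Z₂ : C} {i₁ : K ⟶ Y₁} {d₁ : Y₁ ⟶ Z₁} {i₂ : K ⟶ Y₂}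
    {d₂ : Y₂ ⟶ Z₂} (h₁ : S.Confl i₁ d₁) (h₂ : S.Confl i₂ d₂) {m : Y₁ ⟶ Y₂} {g : Z₁ ⟶ Z₂}
    (hi : i₁ ≫ m = i₂) (hd : m ≫ d₂ = d₁ ≫ g) {W : C} (a : W ⟶ Y₂) (b : W ⟶ Z₁)
    (hab : a ≫ d₂ = b ≫ g) : ∃ u : W ⟶ Y₁, u ≫ m = a ∧ u ≫ d₁ = b := by
  obtain ⟨V, x, e, k, hp, hc, hk⟩ := h₁.exists_pullback b
  have := h₂.mono
  have := hc.epi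
  obtain ⟨y, hy⟩ := h₂.lift (x ≫ m - e ≫ a) (by
    simp only [Preadditive.sub_comp, Category.assoc, hd, hab, hp.w_assoc, sub_self])
  have h3 : (x - y ≫ i₁) ≫ m = e ≫ a := by
    simp [hi, hy]
  have h4 : (x - y ≫ i₁) ≫ d₁ = e ≫ b := by simp [h₁.w, hp.w]
  obtain ⟨z, hz⟩ := h₁.lift (k ≫ (x - y ≫ i₁)) (by
    rw [Category.assoc, h4, reassoc_of% hc.w, zero_comp])
  have hz0 : z = 0 := by
    rw [← cancel_mono i₂, ← hi, reassoc_of% hz, h3, reassoc_of% hc.w, zero_comp, zero_comp]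
  obtain ⟨u, hu⟩ := hc.desc (x - y ≫ i₁) (by rw [← hz, hz0, zero_comp])
  exact ⟨u, by rw [← cancel_epi e, reassoc_of% hu, h3], by rw [← cancel_epi e, reassoc_of% hu, h4]⟩

/-- In a morphism of conflations which is the identity on the cokernels, the square of the
inflations has the factorization property of a pushout. -/
theorem Confl.pushout_desc {X₁ Y₁ X₂ Y₂ Z : C} {i₁ : X₁ ⟶ Y₁} {d₁ : Y₁ ⟶ Z} {i₂ : X₂ ⟶ Y₂}
    {d₂ : Y₂ ⟶ Z} (h₁ : S.Confl i₁ d₁) (h₂ : S.Confl i₂ d₂) {f : X₁ ⟶ X₂} {m : Y₁ ⟶ Y₂}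
    (hi : i₁ ≫ m = f ≫ i₂) (hd : m ≫ d₂ = d₁) {W : C} (a : Y₁ ⟶ W) (b : X₂ ⟶ W)
    (hab : i₁ ≫ a = f ≫ b) : ∃ u : Y₂ ⟶ W, m ≫ u = a ∧ i₂ ≫ u = b := by
  obtain ⟨t, h, h'⟩ := h₂.op.pullback_lift h₁.op (m := m.op) (g := f.op) congr(($hd).op)
    congr(($hi).op) a.op b.op congr(($hab).op)
  exact ⟨t.unop, congr(($h).unop), congr(($h').unop)⟩

/-- The composite of two deflations is a deflation, whose kernel is an extension of the kernels. -/
theorem Confl.comp_deflation {X M Q' P Q : C} {j : X ⟶ M} {p : M ⟶ Q'} {i : P ⟶ Q'} {d : Q' ⟶ Q}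
    (h₁ : S.Confl j p) (h₂ : S.Confl i d) :
    ∃ (N : C) (n : N ⟶ M) (p' : N ⟶ P) (j' : X ⟶ N), IsPullback n p' p i ∧
      S.Confl j' p' ∧ j' ≫ n = j ∧ S.Confl n (p ≫ d) := by
  obtain ⟨D, p', j', q', hp, hc, hq, hc'⟩ := h₂.op.comp_inflation h₁.op
  exact ⟨D.unop, p'.unop, j'.unop, q'.unop, hp.unop.flip, hc, congr(($hq).unop), hc'⟩

end ExactStructure

theorem ExtVanishes.exists_section {X Y M : C} (h : ExtVanishes S X Y) {i : Y ⟶ M} {d : M ⟶ X}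
    (hc : S.Confl i d) : ∃ s : X ⟶ M, s ≫ d = 𝟙 X := h ⟨M, i, d, hc⟩

theorem ExtVanishes.op {X Y : C} (h : ExtVanishes S X Y) : ExtVanishes S.op (op Y) (op X) := by
  rintro ⟨M, i, d, hc⟩
  obtain ⟨s, hs⟩ := h.exists_section (ExactStructure.op_confl_iff.1 hc)
  obtain ⟨r, hr⟩ := (ExactStructure.op_confl_iff.1 hc).exists_retraction_of_section hs
  exact ⟨r.op, congr(($hr).op)⟩

theorem ExtVanishes.unop {X Y : C} (h : ExtVanishes S.op (Opposite.op Y) (Opposite.op X)) :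
    ExtVanishes S X Y := by
  rintro ⟨M, i, d, hc⟩
  obtain ⟨s, hs⟩ := h.exists_section hc.op
  obtain ⟨r, hr⟩ := hc.exists_section_of_retraction (r := s.unop) congr(($hs).unop)
  exact ⟨r, hr⟩

/-- If `Ext¹(T, X) = 0`, morphisms out of `T` lift along deflations with kernel `X`. -/
theorem ExtVanishes.lift {T X M Z : C} (h : ExtVanishes S T X) {i : X ⟶ M} {d : M ⟶ Z}
    (hc : S.Confl i d) (f : T ⟶ Z) : ∃ f' : T ⟶ M, f' ≫ d = f := by
  obtain ⟨V, x, e, k, hp, hc', hk⟩ := hc.exists_pullback f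
  obtain ⟨s, hs⟩ := h.exists_section hc'
  exact ⟨s ≫ x, by rw [Category.assoc, hp.w, reassoc_of% hs]⟩

/-- If `Ext¹(Z, X) = 0`, morphisms into `X` extend along inflations with cokernel `Z`. -/
theorem ExtVanishes.extend {T X M Z : C} (h : ExtVanishes S Z X) {i : T ⟶ M} {d : M ⟶ Z}
    (hc : S.Confl i d) (f : T ⟶ X) : ∃ f' : M ⟶ X, i ≫ f' = f := by
  obtain ⟨t, ht⟩ := h.op.lift hc.op f.op
  exact ⟨t.unop, congr(($ht).unop)⟩

theorem ExtVanishes.of_confl_right {Q X Y Z : C} {i : X ⟶ Y} {d : Y ⟶ Z} (hc : S.Confl i d)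
    (hX : ExtVanishes S Q X) (hZ : ExtVanishes S Q Z) : ExtVanishes S Q Y := by
  rintro ⟨M, j, p, hM⟩
  obtain ⟨D, p', j', q', hp, hc₁, hq, hc₂⟩ := hc.comp_inflation hM
  obtain ⟨s, hs⟩ := hZ.exists_section hc₁
  obtain ⟨t, ht⟩ := hX.lift hc₂ s
  exact ⟨t, by change t ≫ p = _; rw [← hq, reassoc_of% ht, hs]⟩

theorem ExtVanishes.of_confl_left {Q X Y Z : C} {i : X ⟶ Y} {d : Y ⟶ Z} (hc : S.Confl i d)
    (hX : ExtVanishes S X Q) (hZ : ExtVanishes S Z Q) : ExtVanishes S Y Q :=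
  (ExtVanishes.of_confl_right hc.op hZ.op hX.op).unop

theorem ExtVanishes.of_isZero_left {X Y : C} (hX : IsZero X) : ExtVanishes S X Y :=
  fun _ => ⟨0, hX.eq_of_src _ _⟩

theorem ExtVanishes.of_isZero_right {X Y : C} (hY : IsZero Y) : ExtVanishes S X Y :=
  (ExtVanishes.of_isZero_left (S := S.op) hY.op).unop

theorem ExtVanishes.of_iso_left {X X' Y : C} (e : X ≅ X') (h : ExtVanishes S X Y) :
    ExtVanishes S X' Y :=
  .of_confl_left (S.confl_zero_iso (isZero_zero C) e.symm 0)
    (.of_isZero_left (isZero_zero C)) h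

theorem ExtVanishes.of_iso_right {X Y Y' : C} (e : Y ≅ Y') (h : ExtVanishes S X Y) :
    ExtVanishes S X Y' :=
  .of_confl_right (S.confl_zero_iso (isZero_zero C) e.symm 0)
    (.of_isZero_right (isZero_zero C)) h

namespace ExtClosure

variable {P Q : ObjectProperty C}

theorem of_iso {X Y : C} (e : X ≅ Y) (h : ExtClosure S P X) : ExtClosure S P Y :=
  .ext (S.confl_zero_iso (isZero_zero C) e.symm 0) (.zero (isZero_zero C)) h

theorem bind {X : C} (h : ExtClosure S P X) (H : ∀ Y, P Y → ExtClosure S Q Y) :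
    ExtClosure S Q X := by
  induction h with
  | of h => exact H _ h
  | zero h => exact .zero h
  | ext hc _ _ h₁ h₂ => exact .ext hc h₁ h₂

theorem mono {X : C} (h : ExtClosure S P X) (H : ∀ Y, P Y → Q Y) : ExtClosure S Q X :=
  h.bind fun _ hY => .of (H _ hY)

theorem op {X : C} (h : ExtClosure S P X) :
    ExtClosure S.op (fun Y => P Y.unop) (Opposite.op X) := by
  induction h with
  | of h => exact .of h
  | zero h => exact .zero h.op
  | ext hc _ _ h₁ h₂ => exact .ext hc.op h₂ h₁

theorem unop {P : ObjectProperty Cᵒᵖ} {X : Cᵒᵖ} (h : ExtClosure S.op P X) :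
    ExtClosure S (fun Y => P (Opposite.op Y)) X.unop := by
  induction h with
  | of h => exact .of h
  | zero h => exact .zero h.unop
  | ext hc _ _ h₁ h₂ => exact .ext hc h₂ h₁

theorem extVanishes_left {X Y : C} (h : ExtClosure S P X) (H : ∀ Z, P Z → ExtVanishes S Z Y) :
    ExtVanishes S X Y := by
  induction h with
  | of h => exact H _ h
  | zero h => exact .of_isZero_left h
  | ext hc _ _ h₁ h₂ => exact .of_confl_left hc h₁ h₂

theorem extVanishes_right {X Y : C} (h : ExtClosure S P Y) (H : ∀ Z, P Z → ExtVanishes S X Z) :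
    ExtVanishes S X Y := by
  induction h with
  | of h => exact H _ h
  | zero h => exact .of_isZero_right h
  | ext hc _ _ h₁ h₂ => exact .of_confl_right hc h₁ h₂

theorem hom_eq_zero {X Y : C} (h : ExtClosure S P X) (H : ∀ Z, P Z → ∀ f : Z ⟶ Y, f = 0)
    (f : X ⟶ Y) : f = 0 := by
  induction h with
  | of h => exact H _ h f
  | zero h => exact h.eq_of_src _ _
  | ext hc _ _ h₁ h₂ =>
    obtain ⟨g, rfl⟩ := hc.desc f (h₁ _)
    rw [h₂ g, comp_zero]

theorem biprod {X Y : C} (hX : ExtClosure S P X) (hY : ExtClosure S P Y) :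
    ExtClosure S P (X ⊞ Y) := .ext (S.confl_biprod X Y) hX hY

/-- The extension closure contains finite direct sums of copies of its objects. -/
theorem of_sum_copies {Y : C} (hY : ExtClosure S P Y) (n : ℕ) :
    ExtClosure S P (⨁ fun _ : Fin n => Y) := by
  induction n with
  | zero => exact .zero (by
      rw [IsZero.iff_id_eq_zero]
      ext j
      exact j.elim0)
  | succ n ih =>
    refine (ih.biprod hY).of_iso
      ⟨biprod.desc (biproduct.desc fun j => biproduct.ι (fun _ : Fin (n + 1) => Y) j.castSucc)
        (biproduct.ι (fun _ : Fin (n + 1) => Y) (Fin.last n)),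
       biprod.lift (biproduct.lift fun j => biproduct.π (fun _ : Fin (n + 1) => Y) j.castSucc)
        (biproduct.π (fun _ : Fin (n + 1) => Y) (Fin.last n)), ?_, ?_⟩
    · ext j <;> simp [biproduct.ι_π, (Fin.castSucc_lt_last _).ne']
    · rw [biprod.lift_desc, biproduct.lift_desc, ← biproduct.total, Fin.sum_univ_castSucc]

end ExtClosure

end ExtensionCalculus

/-! ### Universal extensions -/

section UniversalExtensions

variable {C : Type u} [Category.{v} C] [Preadditive C] [HasFiniteBiproducts C]

/-- `Ext¹(X, Y)` has a universal extension: a conflation `K ⟶ Q ⟶ X` whose kernel is an iterated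
extension of copies of `Y`, and of which each extension of `X` by `Y` is a push-forward. -/
def HasUniversalExtension (S : ExactStructure C) (X Y : C) : Prop :=
  ∃ (K Q : C) (i : K ⟶ Q) (d : Q ⟶ X), S.Confl i d ∧ ExtClosure S (fun Z => Z = Y) K ∧
    ∀ ξ : Extension S X Y, ∃ (f : K ⟶ Y) (m : Q ⟶ ξ.mid), i ≫ m = f ≫ ξ.i ∧ m ≫ ξ.d = d

/-- The dual notion: a conflation `Y ⟶ Q ⟶ K` whose cokernel is an iterated extension of copies
of `X`, and of which each extension of `X` by `Y` is a pull-back. -/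
def HasCouniversalExtension (S : ExactStructure C) (X Y : C) : Prop :=
  ∃ (K Q : C) (i : Y ⟶ Q) (d : Q ⟶ K), S.Confl i d ∧ ExtClosure S (fun Z => Z = X) K ∧
    ∀ ξ : Extension S X Y, ∃ (f : X ⟶ K) (m : ξ.mid ⟶ Q), ξ.i ≫ m = i ∧ m ≫ d = ξ.d ≫ f

variable {S : ExactStructure C}

theorem HasUniversalExtension.op {X Y : C} (h : HasUniversalExtension S X Y) :
    HasCouniversalExtension S.op (op Y) (op X) := by
  obtain ⟨K, Q, i, d, hc, hK, H⟩ := h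
  refine ⟨Opposite.op K, Opposite.op Q, d.op, i.op, hc.op,
    hK.op.mono fun Z hZ => congr(Opposite.op $hZ), fun ξ => ?_⟩
  obtain ⟨f, m, h₁, h₂⟩ := H ⟨ξ.mid.unop, ξ.d.unop, ξ.i.unop, ξ.confl⟩
  exact ⟨f.op, m.op, congr(($h₂).op), congr(($h₁).op)⟩

theorem HasCouniversalExtension.op {X Y : C} (h : HasCouniversalExtension S X Y) :
    HasUniversalExtension S.op (op Y) (op X) := by
  obtain ⟨K, Q, i, d, hc, hK, H⟩ := h
  refine ⟨Opposite.op K, Opposite.op Q, d.op, i.op, hc.op,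
    hK.op.mono fun Z hZ => congr(Opposite.op $hZ), fun ξ => ?_⟩
  obtain ⟨f, m, h₁, h₂⟩ := H ⟨ξ.mid.unop, ξ.d.unop, ξ.i.unop, ξ.confl⟩
  exact ⟨f.op, m.op, congr(($h₂).op), congr(($h₁).op)⟩

/-- If `Y` has no self-extensions, the middle term of a universal extension by `Y` has no
extensions by `Y` at all. -/
theorem HasUniversalExtension.exists_extVanishes {X Y : C} (h : HasUniversalExtension S X Y)
    (hY : ExtVanishes S Y Y) : ∃ (K Q : C) (i : K ⟶ Q) (d : Q ⟶ X), S.Confl i d ∧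
      ExtClosure S (fun Z => Z = Y) K ∧ ExtVanishes S Q Y := by
  obtain ⟨K, Q, i, d, hc, hK, H⟩ := h
  refine ⟨K, Q, i, d, hc, hK, ?_⟩
  have hKY : ExtVanishes S K Y := hK.extVanishes_left fun Z hZ => hZ ▸ hY
  rintro ⟨M, j, p, hM⟩
  obtain ⟨N, n, p', j', hp, hN, hj, hn⟩ := hM.comp_deflation hc
  -- the extension splits over `K`; dividing out the image of a splitting gives an extension of `X`
  obtain ⟨s, hs⟩ := hKY.exists_section hN
  obtain ⟨ρ, hρ⟩ := hN.exists_retraction_of_section hs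
  obtain ⟨M', m₁, j₁, d₁, hpo, hc₁, hd₁⟩ := hn.exists_pushout ρ
  obtain ⟨f, m, h₁, h₂⟩ := H ⟨M', j₁, d₁, hc₁⟩
  have hj₁ : j ≫ m₁ = j₁ := by rw [← hj, Category.assoc, hpo.w, reassoc_of% hρ]
  obtain ⟨t, -, ht⟩ := hM.pullback_lift hc₁ hj₁ hd₁ m (𝟙 Q) (by simpa using h₂)
  exact ⟨t, ht⟩

namespace ExactStructure

theorem Confl.map_id_right {X Y Z : C} {i : X ⟶ Y} {d : Y ⟶ Z} (h : S.Confl i d) (D : C) :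
    S.Confl (i ≫ biprod.inl) (biprod.map d (𝟙 D)) := by
  refine S.confl_of_iso (Iso.refl _) (biprod.braiding D Y) (biprod.braiding D Z) ?_ ?_
    (h.map_id_left D)
  · ext <;> simp
  · ext <;> simp

theorem Confl.biprod_map {X Y Z X' Y' Z' : C} {i : X ⟶ Y} {d : Y ⟶ Z} {i' : X' ⟶ Y'} {d' : Y' ⟶ Z'}
    (h : S.Confl i d) (h' : S.Confl i' d') : S.Confl (biprod.map i i') (biprod.map d d') := by
  have := h.mono
  have := h'.mono
  obtain ⟨K, j, hj⟩ := S.ex1 (h.map_id_right Y') (h'.map_id_left Z)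
  have e : biprod.map d (𝟙 Y') ≫ biprod.map (𝟙 Z) d' = biprod.map d d' := by ext <;> simp
  rw [e] at hj
  refine hj.of_kernel (by ext <;> simp [h.w, h'.w]) inferInstance fun t ht => ?_
  obtain ⟨a, ha⟩ := h.lift (t ≫ biprod.fst) (by simpa using congr($ht ≫ biprod.fst))
  obtain ⟨b, hb⟩ := h'.lift (t ≫ biprod.snd) (by simpa using congr($ht ≫ biprod.snd))
  exact ⟨biprod.lift a b, by ext <;> simp [ha, hb]⟩

/-- The horseshoe lemma, for deflations. -/
theorem Confl.horseshoe {X Y Z KX QX KZ QZ : C} {i : X ⟶ Y} {d : Y ⟶ Z} (h : S.Confl i d)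
    {kX : KX ⟶ QX} {dX : QX ⟶ X} (hX : S.Confl kX dX) {kZ : KZ ⟶ QZ} {dZ : QZ ⟶ Z}
    (hZ : S.Confl kZ dZ) (hQ : ExtVanishes S QZ X) :
    ∃ (K : C) (k : K ⟶ QX ⊞ QZ) (e : QX ⊞ QZ ⟶ Y), S.Confl k e := by
  obtain ⟨b, hb⟩ := hQ.lift h dZ
  have := h.mono
  have hp : IsPullback biprod.snd (biprod.desc i b) dZ d := by
    have H (s : PullbackCone dZ d) : ∃ t : s.pt ⟶ X, t ≫ i = s.snd - s.fst ≫ b :=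
      h.lift _ (by simp [hb, s.condition])
    refine ⟨⟨by ext <;> simp [hb, h.w]⟩, ⟨PullbackCone.IsLimit.mk _
      (fun s => biprod.lift (H s).choose s.fst) ?_ ?_ ?_⟩⟩
    · intro s; simp
    · intro s; simp [biprod.lift_desc, (H s).choose_spec]
    · intro s m h₁ h₂
      have := (H s).choose_spec
      ext
      · rw [← cancel_mono i]
        rw [biprod.lift_fst, this, ← h₁, ← h₂]
        simp [biprod.desc_eq]
      · simp [h₁]
  have h₁ := hZ.of_isPullback hp (i' := hp.lift kZ 0 (by simp [hZ.w])) (by simp) (by simp)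
  obtain ⟨K, k, hk⟩ := S.ex1 (hX.map_id_right QZ) h₁
  exact ⟨K, k, _, hk⟩

end ExactStructure

variable (k : Type w) [Field k] [Linear k C]

/-- The extension with components given by generators of `Ext¹(X, Y)` is universal. -/
theorem IsExtFinite.hasUniversalExtension (h : IsExtFinite k S) (X Y : C) :
    HasUniversalExtension S X Y := by
  obtain ⟨n, ξ, H⟩ := h X Y
  -- any Baer combination provides a class in `Ext¹(X, Yⁿ)` with components `ξ j`
  obtain ⟨-, ⟨⟨Q, i, d, hc⟩, hζ, -⟩⟩ := H ⟨_, _, _, S.confl_biprod Y X⟩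
  refine ⟨_, Q, i, d, hc, .of_sum_copies (P := fun Z => Z = Y) (.of rfl) n, fun η => ?_⟩
  obtain ⟨a, ⟨Q', i', d', hc'⟩, hζ', μ, hμ₁, hμ₂⟩ := H η
  choose m hm₁ hm₂ using hζ
  choose m' hm₁' hm₂' using hζ'
  dsimp only at *
  obtain ⟨W, x', e, l, hp, hW, hl⟩ := hc'.exists_pullback d
  have := hW.epi
  have := fun j => (ξ j).confl.mono
  have hδ (j) : ∃ δ : W ⟶ Y, δ ≫ (ξ j).i = e ≫ m j - x' ≫ m' j :=
    (ξ j).confl.lift _ (by simp [hm₂, hm₂', hp.w])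
  choose δ hδ using hδ
  have hlδ : l ≫ biproduct.lift δ = -𝟙 _ := by
    ext j
    rw [← cancel_mono (ξ j).i]
    simp [hδ, reassoc_of% hW.w, reassoc_of% hl, hm₁']
  obtain ⟨t, ht⟩ := hW.desc (x' + biproduct.lift δ ≫ i') (by
    rw [Preadditive.comp_add, reassoc_of% hlδ, hl]; simp)
  have htd : t ≫ d' = d := by
    rw [← cancel_epi e, reassoc_of% ht]
    simp [hp.w, hc'.w]
  obtain ⟨f, hf⟩ := η.confl.lift (i ≫ t ≫ μ) (by simp [hμ₂, htd, hc.w])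
  exact ⟨f, t ≫ μ, hf.symm, by simp [hμ₂, htd]⟩

/-- Finitely many extensions of `X` by `Y` are simultaneously pull-backs of one extension. -/
theorem exists_common_coextension {X Y : C} (n : ℕ) (ξ : Fin n → Extension S X Y) :
    ∃ (K Q : C) (i : Y ⟶ Q) (d : Q ⟶ K), S.Confl i d ∧ ExtClosure S (fun Z => Z = X) K ∧
      ∀ j, ∃ (f : X ⟶ K) (m : (ξ j).mid ⟶ Q), (ξ j).i ≫ m = i ∧ m ≫ d = (ξ j).d ≫ f := by
  induction n with
  | zero => exact ⟨0, Y, 𝟙 Y, 0, S.confl_id_zero Y (isZero_zero C) 0, .zero (isZero_zero C),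
      fun j => j.elim0⟩
  | succ n ih =>
    obtain ⟨K, Q, i, d, hc, hK, H⟩ := ih fun j => ξ j.castSucc
    obtain ⟨Q', f', i', d', hp, hc', hd'⟩ :=
      (hc.biprod_map (ξ (Fin.last n)).confl).exists_pushout (biprod.desc (𝟙 Y) (𝟙 Y))
    have h₁ : i ≫ biprod.inl ≫ f' = i' := by
      simpa using congr((biprod.inl : Y ⟶ Y ⊞ Y) ≫ $(hp.w))
    have h₂ : (ξ (Fin.last n)).i ≫ biprod.inr ≫ f' = i' := by
      simpa using congr((biprod.inr : Y ⟶ Y ⊞ Y) ≫ $(hp.w))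
    refine ⟨K ⊞ X, Q', i', d', hc', hK.biprod (.of rfl), fun j => ?_⟩
    induction j using Fin.lastCases with
    | last => exact ⟨biprod.inr, biprod.inr ≫ f', h₂, by simp [hd']⟩
    | cast j =>
      obtain ⟨f, m, hm₁, hm₂⟩ := H j
      exact ⟨f ≫ biprod.inl, m ≫ biprod.inl ≫ f', by rw [reassoc_of% hm₁, h₁],
        by simp [hd', reassoc_of% hm₂]⟩

theorem IsExtFinite.hasCouniversalExtension (h : IsExtFinite k S) (X Y : C) :
    HasCouniversalExtension S X Y := by
  obtain ⟨n, ξ, H⟩ := h X Y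
  obtain ⟨K, Q, i, d, hc, hK, H'⟩ := exists_common_coextension n ξ
  refine ⟨K, Q, i, d, hc, hK, fun η => ?_⟩
  choose f m hm₁ hm₂ using H'
  obtain ⟨a, ⟨Q', i', d', hc'⟩, hζ', μ, hμ₁, hμ₂⟩ := H η
  choose m' hm₁' hm₂' using hζ'
  dsimp only at *
  have hs : i' ≫ (∑ j, a j • m' j ≫ m j) = (biproduct.desc fun j => a j • 𝟙 Y) ≫ i := by
    ext j
    simp only [Preadditive.comp_sum, Linear.comp_smul, reassoc_of% hm₁', hm₁]
    rw [Finset.sum_eq_single j]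
    · simp
    · intro l _ hl
      simp [biproduct.ι_π_ne_assoc _ hl.symm]
    · simp
  obtain ⟨t, ht₁, ht₂⟩ := hc'.pushout_desc η.confl hμ₁ hμ₂ _ i hs
  obtain ⟨g, hg⟩ := η.confl.desc (t ≫ d) (by rw [reassoc_of% ht₂, hc.w])
  exact ⟨g, t, ht₂, hg.symm⟩

end UniversalExtensions

/-! ### Exceptional families and projective generators -/

section ExceptionalFamilies

variable {C : Type u} [Category.{v} C] [Preadditive C]

/-- The `k`-linear structure of the opposite category. -/
instance oppositeLinear (k : Type w) [Field k] [Linear k C] : Linear k Cᵒᵖ where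
  homModule _ _ :=
    { smul c f := (c • f.unop).op
      one_smul f := Quiver.Hom.unop_inj (one_smul k f.unop)
      mul_smul a b f := Quiver.Hom.unop_inj (mul_smul a b f.unop)
      smul_zero a := Quiver.Hom.unop_inj (smul_zero a)
      smul_add a f g := Quiver.Hom.unop_inj (smul_add a f.unop g.unop)
      add_smul a b f := Quiver.Hom.unop_inj (add_smul a b f.unop)
      zero_smul f := Quiver.Hom.unop_inj (zero_smul k f.unop) }
  smul_comp _ _ _ a f g := Quiver.Hom.unop_inj (Linear.comp_smul _ _ _ g.unop a f.unop)
  comp_smul _ _ _ f a g := Quiver.Hom.unop_inj (Linear.smul_comp _ _ _ a g.unop f.unop)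

theorem IsHomFinite.op {k : Type w} [Field k] [Linear k C] (h : IsHomFinite k C) :
    IsHomFinite k Cᵒᵖ := fun X Y =>
  have := h Y.unop X.unop
  Module.Finite.of_surjective
    ({ toFun := fun f => f.op, map_add' := fun _ _ => rfl, map_smul' := fun _ _ => rfl } :
      (Y.unop ⟶ X.unop) →ₗ[k] (X ⟶ Y)) fun f => ⟨f.unop, rfl⟩

theorem IsHomFinite.unop {k : Type w} [Field k] [Linear k C] (h : IsHomFinite k Cᵒᵖ) :
    IsHomFinite k C := fun X Y =>
  have := h (Opposite.op Y) (Opposite.op X)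
  Module.Finite.of_surjective
    ({ toFun := fun f => f.unop, map_add' := fun _ _ => rfl, map_smul' := fun _ _ => rfl } :
      (Opposite.op Y ⟶ Opposite.op X) →ₗ[k] (X ⟶ Y)) fun f => ⟨f.op, rfl⟩

variable [HasFiniteBiproducts C]

/-- A self-dual description of thin exact categories: a family of objects, partially ordered by
`r`, which generates the exact category under extensions, whose members have scalar endomorphisms
and no self-extensions, and where morphisms and extensions from `Ob b` to `Ob a` exist only for
`r a b`. The finiteness of `Ext¹` enters through universal extensions in both directions. -/
structure ExceptionalFamily (k : Type w) [Field k] [Linear k C] (S : ExactStructure C)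
    {ι : Type w₁} (Ob : ι → C) (r : ι → ι → Prop) : Prop where
  refl : ∀ a, r a a
  trans : ∀ a b c, r a b → r b c → r a c
  antisymm : ∀ a b, r a b → r b a → a = b
  not_isZero : ∀ a, ¬ IsZero (Ob a)
  hom : ∀ a b (f : Ob b ⟶ Ob a), f ≠ 0 → r a b
  ext : ∀ a b, ¬ ExtVanishes S (Ob b) (Ob a) → r a b ∧ a ≠ b
  endo : ∀ a (f : Ob a ⟶ Ob a), ∃ c : k, f = c • 𝟙 (Ob a)
  gen : ∀ X, ExtClosure S (fun Y => ∃ a, Y = Ob a) X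
  homFinite : IsHomFinite k C
  universal : ∀ X Y, HasUniversalExtension S X Y
  couniversal : ∀ X Y, HasCouniversalExtension S X Y

variable {k : Type w} [Field k] [Linear k C] {S : ExactStructure C}

/-- The axioms of an exceptional family are self-dual, up to reversing the order. -/
theorem ExceptionalFamily.op {ι : Type w₁} {Ob : ι → C} {r : ι → ι → Prop}
    (D : ExceptionalFamily k S Ob r) :
    ExceptionalFamily k S.op (fun a => Opposite.op (Ob a)) (fun a b => r b a) where
  refl := D.refl
  trans a b c h h' := D.trans _ _ _ h' h
  antisymm a b h h' := D.antisymm _ _ h' h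
  not_isZero a h := D.not_isZero a h.unop
  hom a b f hf := D.hom b a f.unop fun h => hf (Quiver.Hom.unop_inj h)
  ext a b h :=
    have := D.ext b a fun h' => h h'.op
    ⟨this.1, this.2.symm⟩
  endo a f := by
    obtain ⟨c, hc⟩ := D.endo a f.unop
    exact ⟨c, Quiver.Hom.unop_inj hc⟩
  gen X := (D.gen X.unop).op.mono fun Y ⟨a, ha⟩ => ⟨a, congr(Opposite.op $ha)⟩
  homFinite := D.homFinite.op
  universal X Y := (D.couniversal Y.unop X.unop).op
  couniversal X Y := (D.universal Y.unop X.unop).op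

section Projectives

variable {ι : Type w₁} {Ob : ι → C} {r : ι → ι → Prop}

/-- Each `Ob j` is the target of a deflation from a projective object of the exact category, with
kernel filtered by the `Ob l` with `l` strictly smaller than `j`. It arises by universal extensions
by the `Ob a`, in an order in which a new `Ob a` does not create extensions by the previous ones. -/
theorem ExceptionalFamily.exists_projective [Finite ι] (D : ExceptionalFamily k S Ob r) (j : ι) :
    ∃ (K Q : C) (i : K ⟶ Q) (d : Q ⟶ Ob j), S.Confl i d ∧
      ExtClosure S (fun Y => ∃ l, r l j ∧ l ≠ j ∧ Y = Ob l) K ∧ ∀ X, ExtVanishes S Q X := by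
  classical
  cases nonempty_fintype ι
  let : PartialOrder ι :=
    { le := r, le_refl := D.refl, le_trans := D.trans, le_antisymm := D.antisymm }
  suffices H : ∀ s : Finset ι, ∃ (K Q : C) (i : K ⟶ Q) (d : Q ⟶ Ob j), S.Confl i d ∧
      ExtClosure S (fun Y => ∃ l, r l j ∧ l ≠ j ∧ Y = Ob l) K ∧
      ∀ a ∈ s, ExtVanishes S Q (Ob a) by
    obtain ⟨K, Q, i, d, hc, hK, hQ⟩ := H Finset.univ
    exact ⟨K, Q, i, d, hc, hK, fun X => (D.gen X).extVanishes_right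
      fun Z ⟨a, ha⟩ => ha ▸ hQ a (Finset.mem_univ a)⟩
  intro s
  induction s using Finset.strongInduction with
  | H s ih =>
  obtain rfl | hs := s.eq_empty_or_nonempty
  · exact ⟨0, Ob j, 0, 𝟙 _, S.ex0 (isZero_zero C) 0, .zero (isZero_zero C), by simp⟩
  obtain ⟨a, ha⟩ := s.exists_minimal hs
  obtain ⟨K, Q, i, d, hc, hK, hQ⟩ := ih (s.erase a) (Finset.erase_ssubset ha.1)
  by_cases hQa : ExtVanishes S Q (Ob a)
  · refine ⟨K, Q, i, d, hc, hK, fun l hl => ?_⟩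
    obtain rfl | hla := eq_or_ne l a
    · exact hQa
    · exact hQ l (Finset.mem_erase.2 ⟨hla, hl⟩)
  obtain ⟨l, hl, hla⟩ : ∃ l, r l j ∧ ¬ ExtVanishes S (Ob l) (Ob a) := by
    by_contra! H
    have hQ' : ExtClosure S (fun Y => ∃ l, r l j ∧ Y = Ob l) Q :=
      .ext hc (hK.mono fun Y ⟨l, h, _, h'⟩ => ⟨l, h, h'⟩) (.of ⟨j, D.refl j, rfl⟩)
    exact hQa (hQ'.extVanishes_left fun Z ⟨l, h, h'⟩ => h' ▸ H l h)
  obtain ⟨hal, hal'⟩ := D.ext a l hla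
  obtain ⟨K', Q', i', d', hc', hK', hQ'⟩ := (D.universal Q (Ob a)).exists_extVanishes
    (by_contra fun h => (D.ext a a h).2 rfl)
  obtain ⟨N, n, p', j', -, hN, -, hn⟩ := hc'.comp_deflation hc
  refine ⟨N, Q', n, _, hn, .ext hN (hK'.bind fun Y hY => .of ⟨a, D.trans _ _ _ hal hl, ?_, hY⟩) hK,
    fun b hb => ?_⟩
  · rintro rfl
    exact hal' (D.antisymm _ _ hal hl)
  obtain rfl | hba := eq_or_ne b a
  · exact hQ'
  refine .of_confl_left hc' (hK'.extVanishes_left fun Z hZ => ?_)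
    (hQ b (Finset.mem_erase.2 ⟨hba, hb⟩))
  subst hZ
  by_contra hba'
  exact hba (D.antisymm _ _ (D.ext b a hba').1 (ha.2 hb (D.ext b a hba').1))

end Projectives

section Summands

/-- `Q` is a direct summand of a finite power of `P`, expressed by finitely many pairs of
morphisms whose composites sum up to the identity. -/
def IsSummandOfPower (P Q : C) : Prop :=
  ∃ (J : Type) (_ : Fintype J) (a : J → (Q ⟶ P)) (b : J → (P ⟶ Q)), ∑ j, a j ≫ b j = 𝟙 Q

theorem IsSummandOfPower.biprod {P Q Q' : C} (h : IsSummandOfPower P Q)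
    (h' : IsSummandOfPower P Q') : IsSummandOfPower P (Q ⊞ Q') := by
  obtain ⟨J, _, a, b, hab⟩ := h
  obtain ⟨J', _, a', b', hab'⟩ := h'
  refine ⟨J ⊕ J', inferInstance, Sum.elim (fun j => biprod.fst ≫ a j) (fun j => biprod.snd ≫ a' j),
    Sum.elim (fun j => b j ≫ biprod.inl) (fun j => b' j ≫ biprod.inr), ?_⟩
  have h₁ : ∑ j, (biprod.fst ≫ a j) ≫ b j ≫ biprod.inl =
      (biprod.fst ≫ (∑ j, a j ≫ b j) ≫ biprod.inl : Q ⊞ Q' ⟶ Q ⊞ Q') := by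
    simp [Preadditive.comp_sum, Preadditive.sum_comp]
  have h₂ : ∑ j, (biprod.snd ≫ a' j) ≫ b' j ≫ biprod.inr =
      (biprod.snd ≫ (∑ j, a' j ≫ b' j) ≫ biprod.inr : Q ⊞ Q' ⟶ Q ⊞ Q') := by
    simp [Preadditive.comp_sum, Preadditive.sum_comp]
  rw [Fintype.sum_sum_type]
  simp only [Sum.elim_inl, Sum.elim_inr, h₁, h₂, hab, hab']
  ext <;> simp

variable {ι : Type w₁} {Ob : ι → C} {r : ι → ι → Prop}

/-- The exact category has a projective generator `P`: each object is the target of a deflation from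
a summand of a power of `P`. For the members of the family the kernel is controlled. -/
theorem ExceptionalFamily.exists_generator [Finite ι] (D : ExceptionalFamily k S Ob r) :
    ∃ P : C, (∀ X, ExtVanishes S P X) ∧ (∀ X, ∃ (K Q : C) (i : K ⟶ Q) (d : Q ⟶ X), S.Confl i d ∧
      (∀ Y, ExtVanishes S Q Y) ∧ IsSummandOfPower P Q) ∧
      ∀ j, ∃ (K Q : C) (i : K ⟶ Q) (d : Q ⟶ Ob j), S.Confl i d ∧
      ExtClosure S (fun Y => ∃ l, r l j ∧ l ≠ j ∧ Y = Ob l) K ∧ (∀ X, ExtVanishes S Q X) ∧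
      IsSummandOfPower P Q := by
  classical
  cases nonempty_fintype ι
  choose K Q i d hc hK hQ using D.exists_projective
  have hs (j) : IsSummandOfPower (⨁ Q) (Q j) :=
    ⟨Unit, inferInstance, fun _ => biproduct.ι Q j, fun _ => biproduct.π Q j, by simp⟩
  refine ⟨⨁ Q, fun X => ?_, fun X => ?_, fun j => ⟨K j, Q j, i j, d j, hc j, hK j, hQ j, hs j⟩⟩
  · rintro ⟨M, j, p, hM⟩
    choose t ht using fun l => (hQ l X).lift hM (biproduct.ι Q l)
    exact ⟨biproduct.desc t, biproduct.hom_ext' _ _ fun l => by simp [ht]⟩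
  · have := D.gen X
    induction this with
    | of h =>
      obtain ⟨a, rfl⟩ := h
      exact ⟨_, _, _, _, hc a, hQ a, hs a⟩
    | @zero X h =>
      exact ⟨0, X, 0, 𝟙 X, S.ex0 (isZero_zero C) 0, fun Y => .of_isZero_left h,
        Empty, inferInstance, fun x => x.elim, fun x => x.elim, h.eq_of_src _ _⟩
    | ext h _ _ h₁ h₂ =>
      obtain ⟨K₁, Q₁, i₁, d₁, hc₁, hQ₁, hs₁⟩ := h₁
      obtain ⟨K₂, Q₂, i₂, d₂, hc₂, hQ₂, hs₂⟩ := h₂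
      obtain ⟨K, l, e, hl⟩ := h.horseshoe hc₁ hc₂ (hQ₂ _)
      exact ⟨K, _, l, e, hl, fun Y => .of_confl_left (S.confl_biprod Q₁ Q₂) (hQ₁ Y) (hQ₂ Y),
        hs₁.biprod hs₂⟩

end Summands

end ExceptionalFamilies

/-! ### Thin exact categories and irreducible objects -/

section ThinCategories

variable {C : Type u} [Category.{v} C] [Preadditive C] [HasFiniteBiproducts C]
  {k : Type w} [Field k] [Linear k C] {S : ExactStructure C}

/-- A full subcategory equivalent to finite-dimensional vector spaces consists of the direct sums
of copies of one object `U` with scalar endomorphisms, and nonzero morphisms to `U` split. -/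
theorem exists_unit_of_equivalence {P : ObjectProperty C}
    (e : P.FullSubcategory ≌ FGModuleCat.{w} k) (he : e.functor.Linear k) :
    ∃ U : C, P U ∧ ¬ IsZero U ∧ (∀ f : U ⟶ U, ∃ c : k, f = c • 𝟙 U) ∧
      (∀ X, P X → ∃ n : ℕ, Nonempty (X ≅ ⨁ fun _ : Fin n => U)) ∧
      ∀ X, P X → ∀ f : X ⟶ U, f ≠ 0 → ∃ s : U ⟶ X, s ≫ f = 𝟙 U := by
  have : e.inverse.Additive := Functor.additive_of_preserves_binary_products _
  have : e.symm.functor.Additive := ‹e.inverse.Additive›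
  have : e.functor.Additive := e.symm.inverse_additive
  let I : FGModuleCat.{w} k := FGModuleCat.of k k
  let U := e.inverse.obj I
  let c : e.functor.obj U ≅ I := e.counitIso.app I
  -- nonzero linear forms split
  have hsec : ∀ (X : P.FullSubcategory) (f : X ⟶ U), f ≠ 0 → ∃ s : U ⟶ X, s ≫ f = 𝟙 U := by
    intro X f hf
    let φ : e.functor.obj X ⟶ I := e.functor.map f ≫ c.hom
    have hφ : φ ≠ 0 := fun h => hf (e.functor.map_injective (by
      rw [← cancel_mono c.hom, Functor.map_zero, zero_comp]; exact h))
    obtain ⟨x, hx⟩ : ∃ x, φ.hom.hom x ≠ 0 := by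
      by_contra! H
      exact hφ (FGModuleCat.hom_ext (LinearMap.ext H))
    let y : e.functor.obj X := (φ.hom.hom x : k)⁻¹ • x
    let s : I ⟶ e.functor.obj X := FGModuleCat.ofHom (LinearMap.toSpanSingleton k _ y)
    have hs : s ≫ φ = 𝟙 I := by
      apply FGModuleCat.hom_ext
      refine LinearMap.ext_ring ?_
      change φ.hom.hom ((1 : k) • y) = (1 : k)
      rw [one_smul, map_smul]
      exact inv_mul_cancel₀ hx
    refine ⟨e.functor.preimage (c.hom ≫ s), e.functor.map_injective ?_⟩
    rw [Functor.map_comp, Functor.map_preimage, e.functor.map_id, ← cancel_mono c.hom]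
    simp only [Category.assoc, Category.id_comp]
    change c.hom ≫ s ≫ φ = _
    rw [hs, Category.comp_id]
  have hU : ¬ IsZero U := by
    intro h
    have h1 : IsZero I := (e.functor.map_isZero h).of_iso c.symm
    have h2 : (1 : k) = 0 := congr(($(h1.eq_of_src (𝟙 I) 0)).hom.hom (1 : k))
    exact one_ne_zero h2
  refine ⟨U.obj, U.property, ?_, ?_, ?_, ?_⟩
  · intro h
    exact hU ((IsZero.iff_id_eq_zero _).2 (P.hom_ext (h.eq_of_src _ _)))
  · intro f
    let φ : I ⟶ I := c.inv ≫ e.functor.map (ObjectProperty.homMk f : U ⟶ U) ≫ c.hom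
    let t : k := φ.hom.hom (1 : k)
    have hφ : φ = t • 𝟙 I := by
      apply FGModuleCat.hom_ext
      refine LinearMap.ext_ring ?_
      change t = t • (1 : k)
      simp
    refine ⟨t, ?_⟩
    have : (ObjectProperty.homMk f : U ⟶ U) = t • 𝟙 U := by
      apply e.functor.map_injective
      rw [Functor.map_smul, e.functor.map_id, ← cancel_mono c.hom, ← cancel_epi c.inv]
      change φ = _
      simp [hφ]
    exact congr(($this).hom)
  · intro X hX
    let X' : P.FullSubcategory := ⟨X, hX⟩
    let V := e.functor.obj X'
    let B := Module.finBasis k V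
    let n := Module.finrank k V
    let a (j : Fin n) : X' ⟶ U := e.functor.preimage
      ((FGModuleCat.ofHom (B.coord j) : V ⟶ I) ≫ c.inv)
    let b (j : Fin n) : U ⟶ X' := e.functor.preimage
      (c.hom ≫ (FGModuleCat.ofHom (LinearMap.toSpanSingleton k V (B j)) : I ⟶ V))
    have hba (i j : Fin n) : b i ≫ a j = if i = j then 𝟙 U else 0 := by
      apply e.functor.map_injective
      simp only [a, b, Functor.map_comp, Functor.map_preimage]
      rw [← cancel_mono c.hom, ← cancel_epi c.inv]
      simp only [Category.assoc, Iso.inv_hom_id_assoc, Iso.inv_hom_id, Category.comp_id]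
      apply FGModuleCat.hom_ext
      refine LinearMap.ext_ring ?_
      change B.coord j ((1 : k) • B i) = _
      rw [one_smul]
      split_ifs with h
      · subst h; simp
      · simp [h]
    have hab : ∑ j, a j ≫ b j = 𝟙 X' := by
      apply e.functor.map_injective
      simp only [Functor.map_sum, a, b, Functor.map_comp, Functor.map_preimage, Category.assoc,
        Iso.inv_hom_id_assoc]
      apply FGModuleCat.hom_ext
      let ψ : (V ⟶ V) →+ (V →ₗ[k] V) := ⟨⟨fun f => f.hom.hom, rfl⟩, fun _ _ => rfl⟩
      change ψ (∑ j, (FGModuleCat.ofHom (B.coord j) : V ⟶ I) ≫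
        (FGModuleCat.ofHom (LinearMap.toSpanSingleton k V (B j)) : I ⟶ V)) =
          ψ (e.functor.map (𝟙 X'))
      rw [map_sum, e.functor.map_id]
      refine LinearMap.ext fun x => ?_
      rw [LinearMap.sum_apply]
      exact B.sum_repr x
    refine ⟨n, ⟨⟨biproduct.lift fun j => (a j).hom, biproduct.desc fun j => (b j).hom, ?_, ?_⟩⟩⟩
    · rw [biproduct.lift_desc]
      have := congr(P.ι.map $hab)
      rw [Functor.map_sum] at this
      exact this
    · ext i j
      have := congr(($(hba j i)).hom)
      by_cases h : j = i
      · subst h; simpa using this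
      · simpa [h, biproduct.ι_π_ne] using this
  · intro X hX f hf
    obtain ⟨s, hs⟩ := hsec ⟨X, hX⟩ (ObjectProperty.homMk f) fun h => hf congr(($h).hom)
    exact ⟨s.hom, congr(($hs).hom)⟩

/-- Right perpendicular subcategories are closed under extensions. -/
theorem RightPerp.of_confl {T : ObjectProperty C} {X Y Z : C} {i : X ⟶ Y} {d : Y ⟶ Z}
    (hc : S.Confl i d) (hX : RightPerp S T X) (hZ : RightPerp S T Z) : RightPerp S T Y := by
  refine fun W hW => ⟨fun f => ?_, .of_confl_right hc (hX W hW).2 (hZ W hW).2⟩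
  obtain ⟨g, rfl⟩ := hc.lift f ((hZ W hW).1 _)
  rw [(hX W hW).1 g, zero_comp]

/-- A thin exact category is generated by an exceptional family, indexed by the layers of its
filtration. -/
theorem IsThin.exists_exceptionalFamily (hS : IsThin S k) :
    ∃ (n : ℕ) (Ob : Fin n → C), ExceptionalFamily k S Ob (· ≤ ·) := by
  obtain ⟨n, T, hT, hmono, hT0, hTn, hV⟩ := hS.exists_filtration
  choose e he using hV
  choose U hU hU0 hUend hUsum hUsplit using fun i => exists_unit_of_equivalence (e i) (he i)
  have hlt (a b : Fin n) (h : b < a) :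
      (∀ f : U b ⟶ U a, f = 0) ∧ ExtVanishes S (U b) (U a) :=
    (hU a).1 (U b) (hmono (show b.succ ≤ a.castSucc from h) _ (hU b).2)
  have hgen : ∀ (i : Fin (n + 1)) (X : C), T i X → ExtClosure S (fun Y => ∃ a, Y = U a) X := by
    intro i
    induction i using Fin.induction with
    | zero => exact fun X hX => .zero ((hT0 X).1 hX)
    | succ i ih =>
      intro X hX
      obtain ⟨Y, F, f, g, hY, hF, hc⟩ := (hT i.castSucc).torsion X
      have hF' : T i.succ F := by
        obtain ⟨Y', F', f', g', hY', hF', hc'⟩ := (hT i.succ).torsion F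
        have := hc.epi
        have := hc'.epi
        have hz : g' = 0 := by
          rw [← cancel_epi g, comp_zero]
          exact (hF' X hX).1 _
        exact (hT i.succ).fullyExact.ext hc' hY'
          ((hT i.succ).fullyExact.zero ((IsZero.iff_id_eq_zero _).2 (by
            rw [← cancel_epi g', hz, zero_comp, zero_comp])))
      obtain ⟨m, ⟨e⟩⟩ := hUsum i F ⟨hF, hF'⟩
      exact .ext hc (ih Y hY) ((ExtClosure.of_sum_copies (.of ⟨i, rfl⟩) m).of_iso e.symm)
  refine ⟨n, U, le_refl, fun a b c => le_trans, fun a b => le_antisymm, hU0, ?_, ?_, hUend,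
    fun X => hgen _ X (hTn X), hS.homFinite, hS.extFinite.hasUniversalExtension k,
    hS.extFinite.hasCouniversalExtension k⟩
  · intro a b f hf
    by_contra hab
    exact hf ((hlt a b (not_le.1 hab)).1 f)
  · intro a b hab
    refine ⟨by_contra fun h => hab (hlt a b (not_le.1 h)).2, ?_⟩
    rintro rfl
    refine hab ?_
    rintro ⟨M, i, d, hM⟩
    refine hUsplit a M ⟨.of_confl hM (hU a).1 (hU a).1,
      (hT a.succ).fullyExact.ext hM (hU a).2 (hU a).2⟩ d ?_
    rintro rfl
    have := hM.epi
    exact hU0 a ((IsZero.iff_id_eq_zero _).2 (by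
      rw [← cancel_epi (0 : M ⟶ U a), zero_comp, zero_comp]))

end ThinCategories

section Irreducible

variable {C : Type u} [Category.{v} C] [Preadditive C] [HasFiniteBiproducts C]
  {k : Type w} [Field k] [Linear k C] {S : ExactStructure C}
  {ι : Type w₁} {Ob : ι → C} {r : ι → ι → Prop}

theorem ExtClosure.exists_deflation {P : ObjectProperty C} {X : C} (h : ExtClosure S P X)
    (hX : ¬ IsZero X) : ∃ Y, P Y ∧ ∃ d : X ⟶ Y, S.Deflation d := by
  induction h with
  | @of X h => exact ⟨X, h, 𝟙 X, 0, 0, S.ex0 (isZero_zero C) 0⟩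
  | zero h => exact (hX h).elim
  | @ext X Y Z f g hc _ _ h₁ h₂ =>
    by_cases hZ : IsZero Z
    · have : IsIso f := by
        have := hc.mono
        obtain ⟨s, hs⟩ := hc.lift (𝟙 Y) (hZ.eq_of_tgt _ _)
        exact ⟨s, by rw [← cancel_mono f, Category.assoc, hs]; simp, hs⟩
      obtain ⟨W, hW, d, K, i, hd⟩ := h₁ fun h => hX (h.of_iso (asIso f).symm)
      exact ⟨W, hW, _, S.ex1 (S.confl_zero_iso (isZero_zero C) (asIso f).symm 0) hd⟩
    · obtain ⟨W, hW, d, K, i, hd⟩ := h₂ hZ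
      exact ⟨W, hW, _, S.ex1 hc hd⟩

theorem ExtClosure.exists_inflation {P : ObjectProperty C} {X : C} (h : ExtClosure S P X)
    (hX : ¬ IsZero X) : ∃ Y, P Y ∧ ∃ i : Y ⟶ X, S.Inflation i := by
  obtain ⟨Y, hY, d, K, i, hd⟩ := h.op.exists_deflation fun h => hX h.unop
  exact ⟨Y.unop, hY, d.unop, K.unop, i.unop, hd⟩

theorem ExceptionalFamily.isIrreducible [Finite ι] (D : ExceptionalFamily k S Ob r) (a : ι) :
    IsIrreducible S (Ob a) := by
  refine ⟨D.not_isZero a, ?_⟩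
  rintro Y f ⟨Z, g, hc⟩
  by_cases hZ : IsZero Z
  · right
    have := hc.mono
    obtain ⟨s, hs⟩ := hc.lift (𝟙 _) (hZ.eq_of_tgt _ _)
    exact ⟨s, by rw [← cancel_mono f, Category.assoc, hs]; simp, hs⟩
  left
  obtain ⟨W, ⟨b, rfl⟩, d, K, i, hd⟩ := (D.gen Z).exists_deflation hZ
  obtain ⟨K', j, hgd⟩ := S.ex1 hc hd
  have hgd0 : g ≫ d ≠ 0 := by
    intro h
    have := hgd.epi
    exact D.not_isZero b ((IsZero.iff_id_eq_zero _).2 (by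
      rw [← cancel_epi (g ≫ d), h, zero_comp, zero_comp]))
  -- lifting the projective object over `Ob b` to `Ob a` shows that `a = b`
  obtain ⟨L, Q, l, q, hq, hL, hQ⟩ := D.exists_projective b
  obtain ⟨t, ht⟩ := (hQ _).lift hgd q
  have hrab : r a b := by
    by_contra hab
    have hQ' : ExtClosure S (fun Y => ∃ l, r l b ∧ Y = Ob l) Q :=
      .ext hq (hL.mono fun Y ⟨l, h, _, h'⟩ => ⟨l, h, h'⟩) (.of ⟨b, D.refl b, rfl⟩)
    have ht0 : t = 0 := hQ'.hom_eq_zero (fun Z ⟨l, h, hZ⟩ f => by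
      subst hZ
      by_contra hf
      exact hab (D.trans _ _ _ (D.hom _ _ f hf) h)) t
    have := hq.epi
    rw [ht0, zero_comp] at ht
    exact D.not_isZero b ((IsZero.iff_id_eq_zero _).2 (by
      rw [← cancel_epi q, ← ht, zero_comp, zero_comp]))
  obtain rfl := D.antisymm _ _ hrab (D.hom _ _ _ hgd0)
  obtain ⟨c, hc'⟩ := D.endo a (g ≫ d)
  have hc0 : c ≠ 0 := by
    rintro rfl
    exact hgd0 (by rw [hc', zero_smul])
  have h0 : f ≫ g ≫ d = 0 := by rw [reassoc_of% hc.w, zero_comp]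
  rw [hc', Linear.comp_smul, Category.comp_id] at h0
  exact (smul_eq_zero.1 h0).resolve_left hc0

/-- Each irreducible object is isomorphic to a member of the family. -/
theorem ExceptionalFamily.exists_iso (D : ExceptionalFamily k S Ob r) {X : C}
    (hX : IsIrreducible S X) : ∃ a, Nonempty (X ≅ Ob a) := by
  obtain ⟨Y, ⟨a, rfl⟩, i, hi⟩ := (D.gen X).exists_inflation hX.1
  obtain rfl | h := hX.2 i hi
  · obtain ⟨Z, d, hc⟩ := hi
    have := hc.mono
    exact (D.not_isZero a ((IsZero.iff_id_eq_zero _).2 (by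
      rw [← cancel_mono (0 : Ob a ⟶ X), comp_zero, comp_zero]))).elim
  · exact ⟨a, ⟨(asIso i).symm⟩⟩

theorem Irr.isIrreducible (l : Irr S) : IsIrreducible S l.obj := (Quotient.out l).property

theorem Irr.eq_of_iso {l m : Irr S} (e : l.obj ≅ m.obj) : l = m := by
  rw [← Quotient.out_eq l, ← Quotient.out_eq m]
  exact Quotient.sound ⟨(IsIrreducible S).isoMk e⟩

theorem Irr.exists_iso {X : C} (hX : IsIrreducible S X) : ∃ l : Irr S, Nonempty (X ≅ l.obj) := by
  obtain ⟨e⟩ := Quotient.mk_out (s := isIsomorphicSetoid (IsIrreducible S).FullSubcategory) ⟨X, hX⟩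
  exact ⟨_, ⟨((IsIrreducible S).ι.mapIso e).symm⟩⟩

/-- The irreducible objects of an exact category that is generated by an exceptional family form
an exceptional family themselves, with respect to the canonical order. -/
theorem ExceptionalFamily.irr [Finite ι] (D : ExceptionalFamily k S Ob r) :
    Finite (Irr S) ∧ ExceptionalFamily k S (fun l : Irr S => l.obj) (Irr.le S) := by
  choose σ hσ using fun l : Irr S => D.exists_iso l.isIrreducible
  let e (l : Irr S) : l.obj ≅ Ob (σ l) := (hσ l).some
  have hinj : Function.Injective σ := fun l m h =>
    Irr.eq_of_iso (e l ≪≫ eqToIso (congrArg Ob h) ≪≫ (e m).symm)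
  have hhom (l m : Irr S) (f : m.obj ⟶ l.obj) (hf : f ≠ 0) : r (σ l) (σ m) := by
    refine D.hom _ _ ((e m).inv ≫ f ≫ (e l).hom) fun h => hf ?_
    rw [← cancel_mono (e l).hom, ← cancel_epi (e m).inv, h]
    simp
  have hext (l m : Irr S) (h : ¬ ExtVanishes S m.obj l.obj) : r (σ l) (σ m) ∧ σ l ≠ σ m :=
    D.ext _ _ fun h' => h ((h'.of_iso_left (e m).symm).of_iso_right (e l).symm)
  have hstep (l m : Irr S) :
      ¬ RightPerp S (fun X => X = m.obj) l.obj ↔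
        (∃ f : m.obj ⟶ l.obj, f ≠ 0) ∨ ¬ ExtVanishes S m.obj l.obj := by
    simp only [RightPerp, forall_eq]
    grind
  have hle (l m : Irr S) (h : Irr.le S l m) : r (σ l) (σ m) := by
    induction h with
    | refl => exact D.refl _
    | tail _ h ih =>
      refine D.trans _ _ _ ih ?_
      obtain ⟨f, hf⟩ | h := (hstep _ _).1 h
      · exact hhom _ _ f hf
      · exact (hext _ _ h).1
  refine ⟨Finite.of_injective σ hinj, fun _ => .refl, fun _ _ _ => Relation.ReflTransGen.trans,
    fun l m h h' => hinj (D.antisymm _ _ (hle _ _ h) (hle _ _ h')), fun l => l.isIrreducible.1,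
    fun l m f hf => .single ((hstep _ _).2 (.inl ⟨f, hf⟩)),
    fun l m h => ⟨.single ((hstep _ _).2 (.inr h)), fun h' => (hext l m h).2 (h' ▸ rfl)⟩,
    fun l f => ?_, fun X => (D.gen X).bind ?_, D.homFinite, D.universal, D.couniversal⟩
  · obtain ⟨c, hc⟩ := D.endo _ ((e l).inv ≫ f ≫ (e l).hom)
    refine ⟨c, ?_⟩
    rw [← cancel_mono (e l).hom, ← cancel_epi (e l).inv, hc]
    simp
  · rintro _ ⟨a, rfl⟩
    obtain ⟨l, ⟨e'⟩⟩ := Irr.exists_iso (D.isIrreducible a)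
    exact (ExtClosure.of ⟨l, rfl⟩).of_iso e'.symm

end Irreducible

/-! ### Realizations and pointwise left Kan extensions -/

section AbelianExact

variable {A : Type u'} [Category.{v'} A] [Abelian A]

theorem abelianExact_kernel {X Y : A} (f : X ⟶ Y) [Epi f] :
    (abelianExact A).Confl (kernel.ι f) f :=
  ⟨kernel.condition f, ShortComplex.ShortExact.mk' (ShortComplex.exact_kernel f)
    (by dsimp; infer_instance) (by dsimp; infer_instance)⟩

theorem abelianExact_cokernel {X Y : A} (f : X ⟶ Y) [Mono f] :
    (abelianExact A).Confl f (cokernel.π f) :=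
  ⟨cokernel.condition f, ShortComplex.ShortExact.mk' (ShortComplex.exact_cokernel f)
    (by dsimp; infer_instance) (by dsimp; infer_instance)⟩

theorem abelianExact_confl_op {X Y Z : A} {f : X ⟶ Y} {g : Y ⟶ Z}
    (h : (abelianExact A).Confl f g) : (abelianExact Aᵒᵖ).Confl g.op f.op := by
  obtain ⟨w, h⟩ := h
  exact ⟨by rw [← op_comp, w, op_zero], h.op⟩

theorem abelianExact_confl_unop {X Y Z : Aᵒᵖ} {f : X ⟶ Y} {g : Y ⟶ Z}
    (h : (abelianExact Aᵒᵖ).Confl f g) : (abelianExact A).Confl g.unop f.unop := by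
  obtain ⟨w, h⟩ := h
  exact ⟨by rw [← unop_comp, w, unop_zero], h.unop⟩

variable {C : Type u} [Category.{v} C] [Preadditive C] {S : ExactStructure C}

theorem IsRightExact.epi_map {F : C ⥤ A} (hF : IsRightExact S (abelianExact A) F) {X Y Z : C}
    {i : X ⟶ Y} {d : Y ⟶ Z} (h : S.Confl i d) : Epi (F.map d) := by
  obtain ⟨X', d', i', h₁, -, -⟩ := hF.exact h
  exact h₁.epi

theorem IsRightExact.desc {F : C ⥤ A} (hF : IsRightExact S (abelianExact A) F) {X Y Z : C}
    {i : X ⟶ Y} {d : Y ⟶ Z} (h : S.Confl i d) {W : A} (t : F.obj Y ⟶ W) (ht : F.map i ≫ t = 0) :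
    ∃ s, F.map d ≫ s = t := by
  obtain ⟨X', d', i', h₁, ⟨_, _, h₂⟩, h₃⟩ := hF.exact h
  have := h₂.epi
  exact h₁.desc t (by rw [← cancel_epi d', ← Category.assoc, ← h₃, ht, comp_zero])

/-- For functors to abelian categories right exactness says that conflations become cokernels. -/
theorem IsRightExact.mk' {F : C ⥤ A} (hadd : F.Additive)
    (hepi : ∀ {X Y Z : C} {i : X ⟶ Y} {d : Y ⟶ Z}, S.Confl i d → Epi (F.map d))
    (hdesc : ∀ {X Y Z : C} {i : X ⟶ Y} {d : Y ⟶ Z}, S.Confl i d →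
      ∀ {W : A} (t : F.obj Y ⟶ W), F.map i ≫ t = 0 → ∃ s, F.map d ≫ s = t) :
    IsRightExact S (abelianExact A) F where
  additive := hadd
  exact {X Y Z i d} h := by
    have := hepi h
    have hw : F.map i ≫ F.map d = 0 := by rw [← F.map_comp, h.w, F.map_zero]
    obtain ⟨s, hs⟩ := hdesc h (cokernel.π (F.map i)) (cokernel.condition _)
    have hex : (ShortComplex.mk _ _ hw).Exact := by
      rw [ShortComplex.exact_iff_kernel_ι_comp_cokernel_π_zero]
      change kernel.ι (F.map d) ≫ cokernel.π (F.map i) = 0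
      rw [← hs, kernel.condition_assoc, zero_comp]
    have : Epi (kernel.lift (F.map d) (F.map i) hw) := hex.epi_kernelLift
    exact ⟨_, kernel.lift _ _ hw, kernel.ι _, abelianExact_kernel _,
      ⟨_, _, abelianExact_kernel _⟩, by simp⟩

end AbelianExact

section RightEnvelope

variable {C : Type u} [Category.{v} C] [Preadditive C]
variable {A : Type u'} [Category.{v'} A] [Abelian A]
variable {B : Type u''} [Category.{v''} B] [Abelian B]

/-- A fully faithful exact functor `F` from an exact category to an abelian category, such that
the objects `F Q` that are projective suffice to cover all objects: each object of the exact
category is covered by some `Q` via a deflation, and each object of the abelian category is covered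
by some `F Q`. The abelian category is moreover required to have enough injectives. -/
structure IsRealization (S : ExactStructure C) (F : C ⥤ A) : Prop where
  additive : F.Additive
  full : F.Full
  faithful : F.Faithful
  exact : ∀ {X Y Z : C} {i : X ⟶ Y} {d : Y ⟶ Z}, S.Confl i d →
    (abelianExact A).Confl (F.map i) (F.map d)
  enough : ∀ X : C, ∃ (K Q : C) (i : K ⟶ Q) (d : Q ⟶ X), S.Confl i d ∧ Projective (F.obj Q)
  covers : ∀ M : A, ∃ (Q : C) (p : F.obj Q ⟶ M), Projective (F.obj Q) ∧ Epi p
  enoughInjectives : EnoughInjectives A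

/-- A presentation `F Q₁ ⟶ F Q₀ ⟶ M ⟶ 0` of an object of the abelian category, whose first
morphism is the image of a morphism `a` of the exact category. -/
structure IsPresentation (F : C ⥤ A) {M : A} {Q₁ Q₀ : C} (a : Q₁ ⟶ Q₀) (p : F.obj Q₀ ⟶ M) :
    Prop where
  epi : Epi p
  cover : ∃ q : F.obj Q₁ ⟶ kernel p, Epi q ∧ q ≫ kernel.ι p = F.map a

variable {S : ExactStructure C} {F : C ⥤ A}

theorem IsPresentation.w {M : A} {Q₁ Q₀ : C} {a : Q₁ ⟶ Q₀} {p : F.obj Q₀ ⟶ M}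
    (h : IsPresentation F a p) : F.map a ≫ p = 0 := by
  obtain ⟨q, -, hq⟩ := h.cover
  rw [← hq, Category.assoc, kernel.condition, comp_zero]

theorem IsRealization.exists_isPresentation (hF : IsRealization S F) {M : A} {Q₀ : C}
    (p : F.obj Q₀ ⟶ M) [Epi p] :
    ∃ (Q₁ : C) (a : Q₁ ⟶ Q₀), IsPresentation F a p := by
  have := hF.full
  obtain ⟨Q₁, q, -, hq⟩ := hF.covers (kernel p)
  exact ⟨Q₁, F.preimage (q ≫ kernel.ι p), inferInstance, q, hq, by simp⟩

variable {M : A} {Q₁ Q₀ : C} {a : Q₁ ⟶ Q₀} {p : F.obj Q₀ ⟶ M}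

section

variable {G : C ⥤ B}

/-- Right exact functors see that `F Q₁` covers the kernel of `p`: what vanishes on `G Q₁` vanishes
on `G Y` for each `Y ⟶ Q₀` that `p` annihilates. -/
theorem IsPresentation.map_comp_eq_zero (hF : IsRealization S F) (hp : IsPresentation F a p)
    (hG : IsRightExact S (abelianExact B) G) {W : B} {h : G.obj Q₀ ⟶ W} (hh : G.map a ≫ h = 0)
    {Y : C} (b : Y ⟶ Q₀) (hb : F.map b ≫ p = 0) : G.map b ≫ h = 0 := by
  have := hF.full
  have := hF.faithful
  have := hG.additive
  obtain ⟨K, Q, i, d, hc, hQ⟩ := hF.enough Y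
  obtain ⟨q, hq, hqa⟩ := hp.cover
  have := hG.epi_map hc
  let t : F.obj Q ⟶ F.obj Q₁ := Projective.factorThru
    (F.map d ≫ kernel.lift p (F.map b) hb) q
  have ht : F.preimage t ≫ a = d ≫ b := F.map_injective (by
    simp [t, ← hqa, Projective.factorThru_comp_assoc])
  rw [← cancel_epi (G.map d), ← G.map_comp_assoc, ← ht]
  simp [hh]

/-- A morphism `h` from `G Q₀` that vanishes on `G Q₁` induces a compatible family of morphisms
`G X ⟶ W`, indexed by the morphisms `F X ⟶ M`. -/
theorem IsPresentation.exists_leg (hF : IsRealization S F) (hp : IsPresentation F a p)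
    (hG : IsRightExact S (abelianExact B) G) {W : B} {h : G.obj Q₀ ⟶ W} (hh : G.map a ≫ h = 0)
    {X : C} (φ : F.obj X ⟶ M) : ∃ c : G.obj X ⟶ W, ∀ (Y : C) (u : Y ⟶ X) (b : Y ⟶ Q₀),
      F.map u ≫ φ = F.map b ≫ p → G.map u ≫ c = G.map b ≫ h := by
  have := hF.full
  have := hF.faithful
  have := hF.additive
  have := hG.additive
  have := hp.epi
  obtain ⟨K, Q, i, d, hc, hQ⟩ := hF.enough X
  let b₀ : Q ⟶ Q₀ := F.preimage (Projective.factorThru (F.map d ≫ φ) p)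
  have hb₀ : F.map b₀ ≫ p = F.map d ≫ φ := by simp [b₀]
  obtain ⟨c, hc'⟩ := hG.desc hc (G.map b₀ ≫ h) (by
    rw [← G.map_comp_assoc]
    refine hp.map_comp_eq_zero hF hG hh _ ?_
    rw [F.map_comp, Category.assoc, hb₀, ← F.map_comp_assoc, hc.w, F.map_zero, zero_comp])
  refine ⟨c, fun Y u b hub => ?_⟩
  obtain ⟨K', Q', i', d', hd', hQ'⟩ := hF.enough Y
  have := hG.epi_map hd'
  have := (hF.exact hc).epi
  let t : Q' ⟶ Q := F.preimage (Projective.factorThru (F.map (d' ≫ u)) (F.map d))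
  have ht : t ≫ d = d' ≫ u := F.map_injective (by simp [t])
  have h0 := hp.map_comp_eq_zero hF hG hh (t ≫ b₀ - d' ≫ b) (by
    simp only [F.map_sub, F.map_comp, Preadditive.sub_comp, Category.assoc, hb₀, ← hub]
    rw [← F.map_comp_assoc, ht, F.map_comp_assoc, sub_self])
  rw [G.map_sub, Preadditive.sub_comp, sub_eq_zero] at h0
  rw [← cancel_epi (G.map d'), ← G.map_comp_assoc, ← ht, G.map_comp_assoc, hc',
    ← G.map_comp_assoc, h0, G.map_comp_assoc]

theorem exists_cover_eq (hF : IsRealization S F) (hp : IsPresentation F a p) {X : C}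
    (φ : F.obj X ⟶ M) : ∃ (K Q : C) (i : K ⟶ Q) (d : Q ⟶ X) (b : Q ⟶ Q₀), S.Confl i d ∧
      F.map d ≫ φ = F.map b ≫ p := by
  have := hF.full
  have := hp.epi
  obtain ⟨K, Q, i, d, hc, hQ⟩ := hF.enough X
  exact ⟨K, Q, i, d, F.preimage (Projective.factorThru (F.map d ≫ φ) p), hc, by simp⟩

/-- The leg at `φ : F X ⟶ M` of a cocone in the formula for the left Kan extension along `F`. -/
def coconeLeg (s : Cocone (CostructuredArrow.proj F M ⋙ G)) {X : C} (φ : F.obj X ⟶ M) :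
    G.obj X ⟶ s.pt :=
  s.ι.app (CostructuredArrow.mk φ)

theorem map_comp_coconeLeg (s : Cocone (CostructuredArrow.proj F M ⋙ G)) {X Y : C} (u : Y ⟶ X)
    (φ : F.obj X ⟶ M) : G.map u ≫ coconeLeg s φ = coconeLeg s (F.map u ≫ φ) :=
  s.w (CostructuredArrow.homMk u : CostructuredArrow.mk (F.map u ≫ φ) ⟶ CostructuredArrow.mk φ)

theorem map_comp_coconeLeg_eq (s : Cocone (CostructuredArrow.proj F M ⋙ G)) {X Y Z : C}
    (u : Y ⟶ X) (φ : F.obj X ⟶ M) (b : Y ⟶ Z) (ψ : F.obj Z ⟶ M)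
    (h : F.map u ≫ φ = F.map b ≫ ψ) :
    G.map u ≫ coconeLeg s φ = G.map b ≫ coconeLeg s ψ := by
  rw [map_comp_coconeLeg, map_comp_coconeLeg, h]

theorem map_comp_coconeLeg_eq_zero [F.Additive] [G.Additive]
    (s : Cocone (CostructuredArrow.proj F M ⋙ G)) {X Y : C} (u : Y ⟶ X) (φ : F.obj X ⟶ M)
    (h : F.map u ≫ φ = 0) : G.map u ≫ coconeLeg s φ = 0 := by
  rw [map_comp_coconeLeg_eq s u φ 0 φ (by rw [h, F.map_zero, zero_comp]), G.map_zero, zero_comp]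

/-- The values of the left Kan extension of `G` along `F` are cokernels of `G Q₁ ⟶ G Q₀`. -/
theorem isColimit_of_isPresentation (hF : IsRealization S F) (hp : IsPresentation F a p)
    (hG : IsRightExact S (abelianExact B) G) (c : Cocone (CostructuredArrow.proj F M ⋙ G))
    (hepi : Epi (coconeLeg c p))
    (hdesc : ∀ {W : B} (h : G.obj Q₀ ⟶ W), G.map a ≫ h = 0 →
      ∃ h' : c.pt ⟶ W, coconeLeg c p ≫ h' = h) :
    Nonempty (IsColimit c) := by
  have := hF.additive
  have := hG.additive
  choose t ht using fun s : Cocone (CostructuredArrow.proj F M ⋙ G) =>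
    hdesc (coconeLeg s p) (map_comp_coconeLeg_eq_zero s a p hp.w)
  have key (s : Cocone (CostructuredArrow.proj F M ⋙ G)) {X : C} (φ : F.obj X ⟶ M) :
      coconeLeg c φ ≫ t s = coconeLeg s φ := by
    obtain ⟨K, Q, i, d, b, hc, hb⟩ := exists_cover_eq hF hp φ
    have := hG.epi_map hc
    rw [← cancel_epi (G.map d), ← Category.assoc, map_comp_coconeLeg_eq c d φ b p hb,
      map_comp_coconeLeg_eq s d φ b p hb, Category.assoc, ht]
  refine ⟨⟨t, fun s j => ?_, fun s m hm => ?_⟩⟩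
  · exact key s j.hom
  · rw [← cancel_epi (coconeLeg c p), ht]
    exact hm _

/-- The cocone with vertex `W` attached to a morphism `h` from `G Q₀` that vanishes on `G Q₁`. -/
theorem IsPresentation.exists_cocone (hF : IsRealization S F) (hp : IsPresentation F a p)
    (hG : IsRightExact S (abelianExact B) G) {W : B} {h : G.obj Q₀ ⟶ W} (hh : G.map a ≫ h = 0) :
    ∃ ι : CostructuredArrow.proj F M ⋙ G ⟶ (Functor.const _).obj W,
      coconeLeg ⟨W, ι⟩ p = h := by
  choose c hc using fun X (φ : F.obj X ⟶ M) => hp.exists_leg hF hG hh φ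
  have key {X X' : C} (φ : F.obj X ⟶ M) (φ' : F.obj X' ⟶ M) (f : X ⟶ X')
      (hf : F.map f ≫ φ' = φ) : G.map f ≫ c X' φ' = c X φ := by
    obtain ⟨K, Q, i, d, b, hd, hb⟩ := exists_cover_eq hF hp φ
    have := hG.epi_map hd
    have h₁ := hc _ φ _ d b hb
    have h₂ := hc _ φ' _ (d ≫ f) b (by rw [F.map_comp, Category.assoc, hf, hb])
    rw [← cancel_epi (G.map d), h₁, ← h₂, G.map_comp, Category.assoc]
  refine ⟨⟨fun j => c j.left j.hom, fun j j' f => ?_⟩, ?_⟩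
  · exact (key j.hom j'.hom f.left (CostructuredArrow.w f)).trans (Category.comp_id _).symm
  · have := hc _ p _ (𝟙 Q₀) (𝟙 Q₀) rfl
    rw [G.map_id, Category.id_comp, Category.id_comp] at this
    exact this

theorem IsRealization.hasPointwiseLeftKanExtension (hF : IsRealization S F)
    (hG : IsRightExact S (abelianExact B) G) : F.HasPointwiseLeftKanExtension G := by
  intro M
  obtain ⟨Q₀, p, hQ₀, hp⟩ := hF.covers M
  obtain ⟨Q₁, a, ha⟩ := hF.exists_isPresentation p
  obtain ⟨ι, hι⟩ := ha.exists_cocone hF hG (cokernel.condition (G.map a))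
  obtain ⟨hc⟩ := isColimit_of_isPresentation hF ha hG ⟨_, ι⟩
    (by rw [hι]; exact inferInstanceAs (Epi (cokernel.π _)))
    (fun h hh => ⟨cokernel.desc _ h hh, by rw [hι]; exact cokernel.π_desc _ _ _⟩)
  exact ⟨⟨_, hc⟩⟩

/-- The leg of a colimit cocone at the presenting morphism `p : F Q₀ ⟶ M` is a cokernel of
`G Q₁ ⟶ G Q₀`. -/
theorem IsPresentation.epi_coconeLeg (hF : IsRealization S F) (hp : IsPresentation F a p)
    (hG : IsRightExact S (abelianExact B) G) {c : Cocone (CostructuredArrow.proj F M ⋙ G)}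
    (hc : IsColimit c) : Epi (coconeLeg c p) := by
  refine ⟨fun {W} g h hgh => hc.hom_ext fun j => ?_⟩
  obtain ⟨K, Q, i, d, b, hd, hb⟩ := exists_cover_eq hF hp j.hom
  have := hG.epi_map hd
  change coconeLeg c j.hom ≫ g = coconeLeg c j.hom ≫ h
  rw [← cancel_epi (G.map d), ← Category.assoc, ← Category.assoc,
    map_comp_coconeLeg_eq c d _ b p hb, Category.assoc, hgh, Category.assoc]

theorem IsPresentation.exists_desc (hF : IsRealization S F) (hp : IsPresentation F a p)
    (hG : IsRightExact S (abelianExact B) G) {c : Cocone (CostructuredArrow.proj F M ⋙ G)}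
    (hc : IsColimit c) {W : B} {h : G.obj Q₀ ⟶ W} (hh : G.map a ≫ h = 0) :
    ∃ h' : c.pt ⟶ W, coconeLeg c p ≫ h' = h := by
  obtain ⟨ι, hι⟩ := hp.exists_cocone hF hG hh
  exact ⟨hc.desc ⟨W, ι⟩, (hc.fac ⟨W, ι⟩ _).trans hι⟩

end

end RightEnvelope

/-! ### Realizations are right abelian envelopes -/

section Envelope

variable {C : Type u} [Category.{v} C] [Preadditive C]
variable {A : Type u'} [Category.{v'} A] [Abelian A]
variable {B : Type u''} [Category.{v''} B] [Abelian B]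
variable {S : ExactStructure C} {F : C ⥤ A}

theorem IsPresentation.exists_desc_of_isRightExact {G : A ⥤ B}
    (hG : IsRightExact (abelianExact A) (abelianExact B) G)
    {M : A} {Q₁ Q₀ : C} {a : Q₁ ⟶ Q₀} {p : F.obj Q₀ ⟶ M} (hp : IsPresentation F a p)
    {W : B} {h : G.obj (F.obj Q₀) ⟶ W} (hh : G.map (F.map a) ≫ h = 0) :
    ∃ h' : G.obj M ⟶ W, G.map p ≫ h' = h := by
  have := hp.epi
  obtain ⟨q, hq, hqa⟩ := hp.cover
  have := hG.epi_map (abelianExact_kernel q)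
  refine hG.desc (abelianExact_kernel p) h ?_
  rw [← cancel_epi (G.map q), ← G.map_comp_assoc, hqa, hh, comp_zero]

theorem IsRightExact.epi_map_of_epi {G : A ⥤ B}
    (hG : IsRightExact (abelianExact A) (abelianExact B) G) {X Y : A} (f : X ⟶ Y) [Epi f] :
    Epi (G.map f) :=
  hG.epi_map (abelianExact_kernel f)

/-- A functor whose restriction along `F` is right exact, and which turns presentations into
cokernels, is right exact. -/
theorem IsRealization.isRightExact (hF : IsRealization S F) {H : A ⥤ B}
    (hFH : IsRightExact S (abelianExact B) (F ⋙ H))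
    (hepi : ∀ {M : A} {Q₁ Q₀ : C} {a : Q₁ ⟶ Q₀} {p : F.obj Q₀ ⟶ M}, IsPresentation F a p →
      Epi (H.map p))
    (hdesc : ∀ {M : A} {Q₁ Q₀ : C} {a : Q₁ ⟶ Q₀} {p : F.obj Q₀ ⟶ M}, IsPresentation F a p →
      ∀ {W : B} (h : H.obj (F.obj Q₀) ⟶ W), H.map (F.map a) ≫ h = 0 → ∃ h', H.map p ≫ h' = h) :
    IsRightExact (abelianExact A) (abelianExact B) H := by
  have := hF.full
  have := hF.additive
  have := hFH.additive
  have hepi' {M : A} {Q : C} (p : F.obj Q ⟶ M) (_ : Projective (F.obj Q)) (_ : Epi p) :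
      Epi (H.map p) := by
    obtain ⟨Q₁, a, ha⟩ := hF.exists_isPresentation p
    exact hepi ha
  refine .mk' ⟨fun {M N f g} => ?_⟩ (fun {M' M M'' i d} h => ?_) (fun {M' M M'' i d} h W t ht => ?_)
  · obtain ⟨Q, p, hQ, hp⟩ := hF.covers M
    obtain ⟨Q', p', hQ', hp'⟩ := hF.covers N
    have := hepi' p hQ hp
    have lift (f : M ⟶ N) : ∃ u : Q ⟶ Q', p ≫ f = F.map u ≫ p' :=
      ⟨F.preimage (Projective.factorThru (p ≫ f) p'), by simp⟩
    obtain ⟨u, hu⟩ := lift f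
    obtain ⟨v, hv⟩ := lift g
    have huv : H.map (F.map (u + v)) = H.map (F.map u) + H.map (F.map v) := (F ⋙ H).map_add
    rw [← cancel_epi (H.map p), ← H.map_comp, Preadditive.comp_add, Preadditive.comp_add,
      ← H.map_comp, ← H.map_comp, hu, hv, ← Preadditive.add_comp, ← F.map_add, H.map_comp, huv,
      Preadditive.add_comp, H.map_comp, H.map_comp]
  · obtain ⟨Q, p, hQ, hp⟩ := hF.covers M''
    have := h.epi
    have := hepi' p hQ hp
    rw [← Projective.factorThru_comp p d, H.map_comp] at this
    exact epi_of_epi (H.map (Projective.factorThru p d)) _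
  · obtain ⟨Q, p, hQ, hp⟩ := hF.covers M
    have := h.epi
    have := hepi' p hQ hp
    obtain ⟨Q₁, a, ha⟩ := hF.exists_isPresentation (p ≫ d)
    obtain ⟨c, hc⟩ := h.lift (F.map a ≫ p) (by rw [Category.assoc, ha.w])
    obtain ⟨s, hs⟩ := hdesc ha (H.map p ≫ t) (by
      rw [← H.map_comp_assoc, ← hc, H.map_comp_assoc, ht, comp_zero])
    refine ⟨s, ?_⟩
    rw [← cancel_epi (H.map p), ← hs, H.map_comp, Category.assoc]

theorem IsRealization.rightExact (hF : IsRealization S F) : IsRightExact S (abelianExact A) F := by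
  refine .mk' hF.additive (fun h => (hF.exact h).epi) (fun h _ t ht => ?_)
  exact (hF.exact h).desc t ht

/-- Every right exact functor on the exact category extends along a realization. -/
theorem IsRealization.exists_extension (hF : IsRealization S F) {G : C ⥤ B}
    (hG : IsRightExact S (abelianExact B) G) :
    ∃ H : A ⥤ B, IsRightExact (abelianExact A) (abelianExact B) H ∧ Nonempty (F ⋙ H ≅ G) := by
  have := hF.full
  have := hF.faithful
  have := hF.hasPointwiseLeftKanExtension hG
  let H := F.pointwiseLeftKanExtension G
  let α : G ⟶ F ⋙ H := F.pointwiseLeftKanExtensionUnit G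
  have hα := F.pointwiseLeftKanExtensionIsPointwiseLeftKanExtension G
  have : IsIso α := hα.isIso_hom
  have hFH : IsRightExact S (abelianExact B) (F ⋙ H) := by
    have := hG.additive
    refine .mk' (Functor.additive_of_iso (asIso α)) (fun {X Y Z i d} h => ?_)
      (fun {X Y Z i d} h W t ht => ?_)
    · have h₁ := hG.epi_map h
      have h₂ := α.naturality d
      have : Epi (α.app Y ≫ (F ⋙ H).map d) := by rw [← h₂]; infer_instance
      exact epi_of_epi (α.app Y) _
    · obtain ⟨s, hs⟩ := hG.desc h (α.app Y ≫ t) (by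
        rw [α.naturality_assoc, ht, comp_zero])
      refine ⟨inv (α.app Z) ≫ s, ?_⟩
      rw [← cancel_epi (α.app Y), ← α.naturality_assoc, IsIso.hom_inv_id_assoc, hs]
  refine ⟨H, hF.isRightExact hFH (fun {M Q₁ Q₀ a p} hp => ?_)
    (fun {M Q₁ Q₀ a p} hp W h hh => ?_), ⟨(asIso α).symm⟩⟩
  · have : Epi ((α.app Q₀ : G.obj Q₀ ⟶ H.obj (F.obj Q₀)) ≫ H.map p) :=
      hp.epi_coconeLeg hF hG (hα M)
    exact epi_of_epi (α.app Q₀ : G.obj Q₀ ⟶ H.obj (F.obj Q₀)) _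
  · obtain ⟨h', hh'⟩ : ∃ h' : H.obj M ⟶ W, ((α.app Q₀ : G.obj Q₀ ⟶ H.obj (F.obj Q₀)) ≫
        H.map p) ≫ h' = α.app Q₀ ≫ h := hp.exists_desc hF hG (hα M) (by
      rw [α.naturality_assoc]
      exact (congrArg (α.app Q₁ ≫ ·) hh).trans comp_zero)
    rw [Category.assoc] at hh'
    exact ⟨h', (cancel_epi (α.app Q₀)).1 hh'⟩

/-- Natural transformations from a right exact functor are determined on the image of a
realization. -/
theorem IsRealization.hom_ext (hF : IsRealization S F) {G₁ G₂ : A ⥤ B}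
    (hG₁ : IsRightExact (abelianExact A) (abelianExact B) G₁) {γ γ' : G₁ ⟶ G₂}
    (h : ∀ X, γ.app (F.obj X) = γ'.app (F.obj X)) : γ = γ' := by
  ext M
  obtain ⟨Q, p, -, hp⟩ := hF.covers M
  have := hG₁.epi_map_of_epi p
  rw [← cancel_epi (G₁.map p), γ.naturality, γ'.naturality, h]

/-- A right exact functor is the left Kan extension of its restriction along a realization, so
natural transformations of the restrictions extend. -/
theorem IsRealization.exists_hom (hF : IsRealization S F) {G₁ G₂ : A ⥤ B}
    (hG₁ : IsRightExact (abelianExact A) (abelianExact B) G₁) (β : F ⋙ G₁ ⟶ F ⋙ G₂) :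
    ∃ γ : G₁ ⟶ G₂, Functor.whiskerLeft F γ = β := by
  have hG := hF.rightExact.comp hG₁
  have key (M : A) :
      Nonempty (IsColimit ((Functor.LeftExtension.mk G₁ (𝟙 (F ⋙ G₁))).coconeAt M)) := by
    obtain ⟨Q₀, p, hQ₀, hp⟩ := hF.covers M
    obtain ⟨Q₁, a, ha⟩ := hF.exists_isPresentation p
    have hleg : coconeLeg ((Functor.LeftExtension.mk G₁ (𝟙 (F ⋙ G₁))).coconeAt M) p = G₁.map p :=
      Category.id_comp _
    refine isColimit_of_isPresentation hF ha hG _ ?_ (fun h hh => ?_)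
    · rw [hleg]
      exact hG₁.epi_map_of_epi p
    · rw [hleg]
      exact ha.exists_desc_of_isRightExact hG₁ hh
  have hp : (Functor.LeftExtension.mk G₁ (𝟙 (F ⋙ G₁))).IsPointwiseLeftKanExtension :=
    fun M => (key M).some
  have : G₁.IsLeftKanExtension (𝟙 (F ⋙ G₁)) := ⟨⟨hp.isUniversal⟩⟩
  refine ⟨G₁.descOfIsLeftKanExtension (𝟙 (F ⋙ G₁)) G₂ β, ?_⟩
  have := G₁.descOfIsLeftKanExtension_fac (𝟙 (F ⋙ G₁)) G₂ β
  rwa [Category.id_comp] at this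

/-- A realization of an exact category is its right abelian envelope. -/
theorem IsRealization.isRightAbelianEnvelope (hF : IsRealization S F) :
    IsRightAbelianEnvelope.{w₁, w₂} S F where
  rightExact := hF.rightExact
  isEquivalence B _ _ :=
    { faithful := ⟨fun {G₁ G₂ γ γ'} h => by
        ext1
        exact hF.hom_ext G₁.property fun X =>
          NatTrans.congr_app (congrArg InducedCategory.Hom.hom h) X⟩
      full := ⟨fun {G₁ G₂} β => by
        obtain ⟨γ, hγ⟩ := hF.exists_hom G₁.property β.hom
        exact ⟨ObjectProperty.homMk γ, by ext1; exact hγ⟩⟩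
      essSurj := ⟨fun G => by
        obtain ⟨H, hH, ⟨e⟩⟩ := hF.exists_extension G.property
        exact ⟨⟨H, hH⟩, ⟨ObjectProperty.isoMk _ e⟩⟩⟩ }

end Envelope

/-! ### Left abelian envelopes, uniqueness, and linear structures -/

section Duality

variable {C : Type u} [Category.{v} C] [Preadditive C] [HasFiniteBiproducts C]
variable {A : Type u'} [Category.{v'} A] [Abelian A]
variable {S : ExactStructure C}

/-- The exact structure of an abelian category is compatible with passing to opposites. -/
theorem abelianExact_op : (abelianExact A).op = abelianExact Aᵒᵖ := by
  have h : @ExactStructure.Confl _ _ _ (abelianExact A).op =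
      @ExactStructure.Confl _ _ _ (abelianExact Aᵒᵖ) := by
    funext X Y Z f g
    exact propext ⟨abelianExact_confl_op, abelianExact_confl_unop⟩
  generalize (abelianExact A).op = S at h
  generalize abelianExact Aᵒᵖ = T at h
  cases S
  cases T
  cases h
  rfl

theorem IsLeftExact.op {F : C ⥤ A} (hF : IsLeftExact S (abelianExact A) F) :
    IsRightExact S.op (abelianExact Aᵒᵖ) F.op where
  additive := by
    have := hF.additive
    infer_instance
  exact h := by
    obtain ⟨Z', d', i', h₁, ⟨W, q, h₂⟩, h₃⟩ := hF.exact (S.op_confl_iff.1 h)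
    exact ⟨_, i'.op, d'.op, abelianExact_confl_op h₁, ⟨_, _, abelianExact_confl_op h₂⟩,
      congr(($h₃).op)⟩

theorem IsLeftExact.of_op {F : C ⥤ A} (hF : IsRightExact S.op (abelianExact Aᵒᵖ) F.op) :
    IsLeftExact S (abelianExact A) F where
  additive := ⟨fun {X Y f g} => by
    have := hF.additive
    exact congr(($(F.op.map_add (f := f.op) (g := g.op))).unop)⟩
  exact h := by
    obtain ⟨Z', d', i', h₁, ⟨W, q, h₂⟩, h₃⟩ := hF.exact h.op
    exact ⟨_, i'.unop, d'.unop, abelianExact_confl_unop h₁, ⟨_, _, abelianExact_confl_unop h₂⟩,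
      congr(($h₃).unop)⟩

theorem IsLeftExact.abelian_op {B : Type u''} [Category.{v''} B] [Abelian B] {G : A ⥤ B}
    (hG : IsLeftExact (abelianExact A) (abelianExact B) G) :
    IsRightExact (abelianExact Aᵒᵖ) (abelianExact Bᵒᵖ) G.op := by
  rw [← abelianExact_op (A := A)]
  exact IsLeftExact.op hG

theorem IsLeftExact.abelian_unop {B : Type u''} [Category.{v''} B] [Abelian B] {G : Aᵒᵖ ⥤ Bᵒᵖ}
    (hG : IsRightExact (abelianExact Aᵒᵖ) (abelianExact Bᵒᵖ) G) :
    IsLeftExact (abelianExact A) (abelianExact B) G.unop := by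
  rw [← abelianExact_op (A := A)] at hG
  exact .of_op hG

/-- If the opposite of `F` is a realization, then `F` is a left abelian envelope. -/
theorem IsRealization.isLeftAbelianEnvelope {F : C ⥤ A} (hF : IsRealization S.op F.op) :
    IsLeftAbelianEnvelope.{w₁, w₂} S F where
  leftExact := .of_op hF.rightExact
  isEquivalence B _ _ :=
    { faithful := ⟨fun {G₁ G₂ γ γ'} h => by
        ext1
        have : NatTrans.op γ.hom = NatTrans.op γ'.hom :=
          hF.hom_ext (IsLeftExact.abelian_op G₂.property) fun X =>
            congr(($(NatTrans.congr_app (congrArg InducedCategory.Hom.hom h) X.unop)).op)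
        exact congrArg NatTrans.removeOp this⟩
      full := ⟨fun {G₁ G₂} β => by
        obtain ⟨γ, hγ⟩ := IsRealization.exists_hom (G₁ := G₂.obj.op) (G₂ := G₁.obj.op) hF
          (IsLeftExact.abelian_op G₂.property) (NatTrans.op β.hom)
        exact ⟨ObjectProperty.homMk (NatTrans.removeOp γ), by
          ext1
          ext X
          exact congr(($(NatTrans.congr_app hγ (Opposite.op X))).unop)⟩⟩
      essSurj := ⟨fun G => by
        obtain ⟨H, hH, ⟨e⟩⟩ := hF.exists_extension G.property.op
        exact ⟨⟨H.unop, .abelian_unop hH⟩, ⟨ObjectProperty.isoMk _ (NatIso.unop e).symm⟩⟩⟩ }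

end Duality

section Uniqueness

variable {C : Type u} [Category.{v} C] [Preadditive C] {S : ExactStructure C}
variable {A : Type u'} [Category.{v'} A] [Abelian A] {F : C ⥤ A}

theorem IsRightExact.id [HasZeroObject C] : IsRightExact S S (𝟭 C) where
  additive := inferInstance
  exact {X _ _ i _} h := ⟨X, 𝟙 X, i, h, ⟨_, _, S.ex0 (isZero_zero _) 0⟩, (Category.id_comp _).symm⟩

theorem IsLeftExact.id [HasZeroObject C] : IsLeftExact S S (𝟭 C) where
  additive := inferInstance
  exact {_ _ Z _ d} h := ⟨Z, d, 𝟙 Z, h, ⟨_, _, S.confl_id_zero _ (isZero_zero _) 0⟩,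
    (Category.comp_id _).symm⟩

/-- Right abelian envelopes are unique up to equivalence. -/
theorem IsRightAbelianEnvelope.exists_equivalence {A A' : Type w₁} [Category.{w₂} A] [Abelian A]
    [Category.{w₂} A'] [Abelian A'] {F : C ⥤ A} {F' : C ⥤ A'}
    (hF : IsRightAbelianEnvelope.{w₁, w₂} S F) (hF' : IsRightAbelianEnvelope.{w₁, w₂} S F') :
    ∃ H : A ⥤ A', H.IsEquivalence ∧ Nonempty (F ⋙ H ≅ F') := by
  have h₁ := hF.isEquivalence A'
  have h₂ := hF'.isEquivalence A
  have h₃ := hF.isEquivalence A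
  have h₄ := hF'.isEquivalence A'
  obtain ⟨H, ⟨e⟩⟩ := h₁.essSurj.mem_essImage ⟨F', hF'.rightExact⟩
  obtain ⟨H', ⟨e'⟩⟩ := h₂.essSurj.mem_essImage ⟨F, hF.rightExact⟩
  have e : F ⋙ H.obj ≅ F' := (ObjectProperty.ι _).mapIso e
  have e' : F' ⋙ H'.obj ≅ F := (ObjectProperty.ι _).mapIso e'
  let i : H.obj ⋙ H'.obj ≅ 𝟭 A := (ObjectProperty.ι _).mapIso
    ((rexPrecomp hF.rightExact A).preimageIso (X := ⟨_, H.property.comp H'.property⟩)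
      (Y := ⟨𝟭 A, .id⟩) (ObjectProperty.isoMk _ (Functor.isoWhiskerRight e H'.obj ≪≫ e')))
  let i' : H'.obj ⋙ H.obj ≅ 𝟭 A' := (ObjectProperty.ι _).mapIso
    ((rexPrecomp hF'.rightExact A').preimageIso (X := ⟨_, H'.property.comp H.property⟩)
      (Y := ⟨𝟭 A', .id⟩) (ObjectProperty.isoMk _ (Functor.isoWhiskerRight e' H.obj ≪≫ e)))
  exact ⟨H.obj, (CategoryTheory.Equivalence.mk H.obj H'.obj i.symm i').isEquivalence_functor, ⟨e⟩⟩

/-- Left abelian envelopes are unique up to equivalence. -/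
theorem IsLeftAbelianEnvelope.exists_equivalence {A A' : Type w₁} [Category.{w₂} A] [Abelian A]
    [Category.{w₂} A'] [Abelian A'] {F : C ⥤ A} {F' : C ⥤ A'}
    (hF : IsLeftAbelianEnvelope.{w₁, w₂} S F) (hF' : IsLeftAbelianEnvelope.{w₁, w₂} S F') :
    ∃ H : A ⥤ A', H.IsEquivalence ∧ Nonempty (F ⋙ H ≅ F') := by
  have h₁ := hF.isEquivalence A'
  have h₂ := hF'.isEquivalence A
  have h₃ := hF.isEquivalence A
  have h₄ := hF'.isEquivalence A'
  obtain ⟨H, ⟨e⟩⟩ := h₁.essSurj.mem_essImage ⟨F', hF'.leftExact⟩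
  obtain ⟨H', ⟨e'⟩⟩ := h₂.essSurj.mem_essImage ⟨F, hF.leftExact⟩
  have e : F ⋙ H.obj ≅ F' := (ObjectProperty.ι _).mapIso e
  have e' : F' ⋙ H'.obj ≅ F := (ObjectProperty.ι _).mapIso e'
  let i : H.obj ⋙ H'.obj ≅ 𝟭 A := (ObjectProperty.ι _).mapIso
    ((lexPrecomp hF.leftExact A).preimageIso (X := ⟨_, H.property.comp H'.property⟩)
      (Y := ⟨𝟭 A, .id⟩) (ObjectProperty.isoMk _ (Functor.isoWhiskerRight e H'.obj ≪≫ e')))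
  let i' : H'.obj ⋙ H.obj ≅ 𝟭 A' := (ObjectProperty.ι _).mapIso
    ((lexPrecomp hF'.leftExact A').preimageIso (X := ⟨_, H'.property.comp H.property⟩)
      (Y := ⟨𝟭 A', .id⟩) (ObjectProperty.isoMk _ (Functor.isoWhiskerRight e' H.obj ≪≫ e)))
  exact ⟨H.obj, (CategoryTheory.Equivalence.mk H.obj H'.obj i.symm i').isEquivalence_functor, ⟨e⟩⟩

/-- Realizations can be transported along equivalences of abelian categories. -/
theorem IsRealization.of_isEquivalence (hF : IsRealization S F) {A' : Type u''}
    [Category.{v''} A'] [Abelian A'] (H : A ⥤ A') [H.IsEquivalence] {F' : C ⥤ A'}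
    (e : F ⋙ H ≅ F') : IsRealization S F' := by
  have := hF.additive
  have := hF.full
  have := hF.faithful
  have : H.Additive := Functor.additive_of_preserves_binary_products H
  have hproj (Q : C) (hQ : Projective (F.obj Q)) : Projective (F'.obj Q) :=
    Projective.of_iso (e.app Q) ((H.asEquivalence.map_projective_iff _).2 hQ)
  refine ⟨Functor.additive_of_iso e, .of_iso e, .of_iso e, fun {X Y Z i d} h => ?_, fun X => ?_,
    fun M => ?_, ?_⟩
  · obtain ⟨w, h⟩ := hF.exact h
    have h' := h.map_of_exact H
    exact (abelianExact A').confl_of_iso (e.app X) (e.app Y) (e.app Z) (e.hom.naturality i)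
      (e.hom.naturality d) ⟨_, h'⟩
  · obtain ⟨K, Q, i, d, h, hQ⟩ := hF.enough X
    exact ⟨K, Q, i, d, h, hproj Q hQ⟩
  · obtain ⟨Q, p, hQ, hp⟩ := hF.covers (H.objPreimage M)
    exact ⟨Q, e.inv.app Q ≫ H.map p ≫ (H.objObjPreimageIso M).hom, hproj Q hQ, inferInstance⟩
  · have := hF.enoughInjectives
    exact EnoughInjectives.of_equivalence H.inv

/-- If the endomorphisms of `F` are those of the identity functor of `A`, then the linear structure
on the source of `F` extends to `A`: scalars act on `F`, hence on the identity functor of `A`. -/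
theorem exists_linear [F.Additive] (k : Type w) [Field k] [Linear k C]
    (h : ∀ β : F ⟶ F, ∃ γ : 𝟭 A ⟶ 𝟭 A, ∀ X, γ.app (F.obj X) = β.app X)
    (h' : ∀ γ γ' : 𝟭 A ⟶ 𝟭 A, (∀ X, γ.app (F.obj X) = γ'.app (F.obj X)) → γ = γ') :
    ∃ _ : Linear k A, F.Linear k := by
  choose γ hγ using fun c : k => h
    { app := fun X => F.map (c • 𝟙 X)
      naturality := fun X Y f => by
        rw [← F.map_comp, ← F.map_comp, Linear.comp_smul, Linear.smul_comp, Category.comp_id,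
          Category.id_comp] }
  let φ : k →+* CatCenter A :=
    { toFun := γ
      map_one' := h' _ _ fun X => by rw [hγ]; simp [End.one_def]
      map_mul' := fun a b => h' _ _ fun X => by
        rw [hγ]
        change _ = (γ b).app (F.obj X) ≫ (γ a).app (F.obj X)
        rw [hγ, hγ, ← F.map_comp, Linear.comp_smul, Category.comp_id, smul_smul]
      map_zero' := h' _ _ fun X => by rw [hγ]; simp
      map_add' := fun a b => h' _ _ fun X => by
        rw [hγ]
        change _ = (γ a).app (F.obj X) + (γ b).app (F.obj X)
        rw [hγ, hγ, ← F.map_add, ← add_smul] }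
  let _ : Linear k A := Linear.ofRingMorphism φ
  refine ⟨inferInstance, ⟨fun {X Y} f c => ?_⟩⟩
  change F.map (c • f) = (γ c).app (F.obj X) ≫ F.map f
  rw [hγ, ← F.map_comp, Linear.smul_comp, Category.id_comp]

theorem IsRightAbelianEnvelope.exists_linear (hF : IsRightAbelianEnvelope.{u', v'} S F)
    (k : Type w) [Field k] [Linear k C] : ∃ _ : Linear k A, F.Linear k := by
  have := hF.rightExact.additive
  have := hF.isEquivalence A
  let I : Rex (abelianExact A) (abelianExact A) := ⟨𝟭 A, .id⟩
  refine ThinEnvelope.exists_linear k (fun β => ?_) (fun γ γ' h => ?_)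
  · let β' : (rexPrecomp hF.rightExact A).obj I ⟶ (rexPrecomp hF.rightExact A).obj I :=
      ObjectProperty.homMk β
    exact ⟨((rexPrecomp hF.rightExact A).preimage β').hom, fun X => NatTrans.congr_app
      (congrArg InducedCategory.Hom.hom ((rexPrecomp hF.rightExact A).map_preimage β')) X⟩
  · have : (ObjectProperty.homMk γ : I ⟶ I) = ObjectProperty.homMk γ' :=
      (rexPrecomp hF.rightExact A).map_injective (by
        ext1
        ext X
        exact h X)
    exact congrArg InducedCategory.Hom.hom this

theorem IsLeftAbelianEnvelope.exists_linear (hF : IsLeftAbelianEnvelope.{u', v'} S F)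
    (k : Type w) [Field k] [Linear k C] : ∃ _ : Linear k A, F.Linear k := by
  have := hF.leftExact.additive
  have := hF.isEquivalence A
  let I : Lex (abelianExact A) (abelianExact A) := ⟨𝟭 A, .id⟩
  refine ThinEnvelope.exists_linear k (fun β => ?_) (fun γ γ' h => ?_)
  · let β' : (lexPrecomp hF.leftExact A).obj I ⟶ (lexPrecomp hF.leftExact A).obj I :=
      ObjectProperty.homMk β
    exact ⟨((lexPrecomp hF.leftExact A).preimage β').hom, fun X => NatTrans.congr_app
      (congrArg InducedCategory.Hom.hom ((lexPrecomp hF.leftExact A).map_preimage β')) X⟩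
  · have : (ObjectProperty.homMk γ : I ⟶ I) = ObjectProperty.homMk γ' :=
      (lexPrecomp hF.leftExact A).map_injective (by
        ext1
        ext X
        exact h X)
    exact congrArg InducedCategory.Hom.hom this

end Uniqueness

/-! ### The realization by modules over an endomorphism algebra -/

section Coinduced

/-- The module coinduced from a vector space `M` to a `k`-algebra `R`. -/
def Coinduced (k : Type w) [Field k] (R : Type v) [Ring R] [Algebra k R] (M : Type v')
    [AddCommGroup M] [Module k M] : Type (max v v') := R →ₗ[k] M

variable (k : Type w) [Field k] (R : Type v) [Ring R] [Algebra k R] (M : Type v')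
  [AddCommGroup M] [Module k M]

noncomputable instance : AddCommGroup (Coinduced k R M) :=
  inferInstanceAs (AddCommGroup (R →ₗ[k] M))

noncomputable instance : Module k (Coinduced k R M) :=
  inferInstanceAs (Module k (R →ₗ[k] M))

instance [Module.Finite k R] [Module.Finite k M] : Module.Finite k (Coinduced k R M) :=
  inferInstanceAs (Module.Finite k (R →ₗ[k] M))

/-- The algebra acts on the coinduced module through multiplication from the right on itself. -/
noncomputable instance : Module R (Coinduced k R M) where
  smul b φ := LinearMap.comp φ (LinearMap.mulRight k b)
  one_smul φ := LinearMap.ext fun x => congrArg (DFunLike.coe (F := R →ₗ[k] M) φ) (mul_one x)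
  mul_smul b c φ := LinearMap.ext fun x =>
    congrArg (DFunLike.coe (F := R →ₗ[k] M) φ) (mul_assoc x b c).symm
  smul_zero _ := LinearMap.ext fun _ => rfl
  smul_add _ _ _ := LinearMap.ext fun _ => rfl
  add_smul b c φ := LinearMap.ext fun x =>
    (congrArg (DFunLike.coe (F := R →ₗ[k] M) φ) (mul_add x b c)).trans (LinearMap.map_add _ _ _)
  zero_smul φ := LinearMap.ext fun x =>
    (congrArg (DFunLike.coe (F := R →ₗ[k] M) φ) (mul_zero x)).trans (LinearMap.map_zero _)

instance : IsScalarTower k R (Coinduced k R M) where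
  smul_assoc c b φ := LinearMap.ext fun x =>
    (congrArg (DFunLike.coe (F := R →ₗ[k] M) φ) (mul_smul_comm c x b)).trans
      (LinearMap.map_smul _ _ _)

variable {k R M}

/-- Linear maps to a coinduced module correspond to `k`-linear maps. -/
noncomputable def Coinduced.lift {N : Type v''} [AddCommGroup N] [Module k N] [Module R N]
    [IsScalarTower k R N] (h : N →ₗ[k] M) : N →ₗ[R] Coinduced k R M where
  toFun y := LinearMap.comp h ((LinearMap.toSpanSingleton R N y).restrictScalars k)
  map_add' y z := LinearMap.ext fun x =>
    (congrArg h (smul_add x y z)).trans (LinearMap.map_add _ _ _)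
  map_smul' b y := LinearMap.ext fun x => congrArg h (smul_smul x b y)

/-- Evaluation at the unit. -/
noncomputable def Coinduced.eval : Coinduced k R M →ₗ[k] M where
  toFun φ := DFunLike.coe (F := R →ₗ[k] M) φ 1
  map_add' _ _ := rfl
  map_smul' _ _ := rfl

theorem Coinduced.eval_lift {N : Type v''} [AddCommGroup N] [Module k N] [Module R N]
    [IsScalarTower k R N] (h : N →ₗ[k] M) (y : N) :
    Coinduced.eval (Coinduced.lift (R := R) h y) = h y :=
  congrArg h (one_smul R y)

theorem Coinduced.ext {φ ψ : Coinduced k R M}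
    (h : ∀ x : R, Coinduced.eval (x • φ) = Coinduced.eval (x • ψ)) : φ = ψ :=
  LinearMap.ext fun x => by
    have := h x
    rw [← one_mul x]
    exact this

theorem Coinduced.exists_extension {Y : Type v''} {Z : Type v''} [AddCommGroup Y] [Module k Y]
    [Module R Y] [IsScalarTower k R Y] [AddCommGroup Z] [Module k Z] [Module R Z]
    [IsScalarTower k R Z] (f : Y →ₗ[R] Z) (hf : Function.Injective f)
    (g : Y →ₗ[R] Coinduced k R M) : ∃ h : Z →ₗ[R] Coinduced k R M, h.comp f = g := by
  obtain ⟨r, hr⟩ := LinearMap.exists_leftInverse_of_injective (f.restrictScalars k)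
    (LinearMap.ker_eq_bot.2 hf)
  refine ⟨lift ((eval.comp (g.restrictScalars k)).comp r), LinearMap.ext fun y => ext fun x => ?_⟩
  have hr' : r (f (x • y)) = x • y := LinearMap.congr_fun hr (x • y)
  rw [← map_smul, ← map_smul, LinearMap.comp_apply, eval_lift]
  exact congrArg (fun y => eval (g y)) hr'

theorem Coinduced.lift_id_injective [Module R M] [IsScalarTower k R M] :
    Function.Injective (lift (R := R) (LinearMap.id : M →ₗ[k] M)) := fun x y h => by
  have := congrArg eval h
  rwa [eval_lift, eval_lift] at this

theorem fgModuleCat_mono_iff [IsNoetherianRing R] {Y Z : FGModuleCat.{v'} R} (f : Y ⟶ Z) :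
    Mono f ↔ Function.Injective f.hom.hom := by
  rw [← ModuleCat.mono_iff_injective]
  exact (Functor.mono_map_iff_mono (forget₂ (FGModuleCat.{v'} R) (ModuleCat.{v'} R)) f).symm

theorem fgModuleCat_epi_iff [IsNoetherianRing R] {Y Z : FGModuleCat.{v'} R} (f : Y ⟶ Z) :
    Epi f ↔ Function.Surjective f.hom.hom := by
  rw [← ModuleCat.epi_iff_surjective]
  exact (Functor.epi_map_iff_epi (forget₂ (FGModuleCat.{v'} R) (ModuleCat.{v'} R)) f).symm

variable (k)

/-- Over a finite dimensional algebra, coinduced modules are injective, and each module embeds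
into the module coinduced from its underlying vector space. -/
theorem fgModuleCat_enoughInjectives [Module.Finite k R] [IsNoetherianRing R] :
    EnoughInjectives (FGModuleCat.{v} R) where
  presentation X := by
    let mod (Y : FGModuleCat.{v} R) : Module k Y := Module.compHom Y (algebraMap k R)
    have tower (Y : FGModuleCat.{v} R) : IsScalarTower k R Y := ⟨fun c b y => by
      rw [Algebra.smul_def, mul_smul]; rfl⟩
    have fin (Y : FGModuleCat.{v} R) : Module.Finite k Y := Module.Finite.trans R Y
    have : Module.Finite R (Coinduced k R X) := Module.Finite.of_restrictScalars_finite k R _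
    refine ⟨⟨FGModuleCat.of R (Coinduced k R X), ⟨fun {Y Z} g f hf => ?_⟩,
      FGModuleCat.ofHom (Coinduced.lift LinearMap.id), ?_⟩⟩
    · obtain ⟨h, hh⟩ := Coinduced.exists_extension (k := k) (M := X) f.hom.hom
        ((fgModuleCat_mono_iff f).1 hf) g.hom.hom
      exact ⟨FGModuleCat.ofHom h, FGModuleCat.hom_ext hh⟩
    · exact (fgModuleCat_mono_iff _).2 Coinduced.lift_id_injective

end Coinduced

section Model

variable {k : Type w} [Field k] {C : Type u} [Category.{v} C] [Preadditive C] [Linear k C]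

noncomputable instance endOpAlgebra (P : C) : Algebra k (End P)ᵐᵒᵖ := inferInstance

instance endOpTower (P X : C) : IsScalarTower k (End P)ᵐᵒᵖ (P ⟶ X) :=
  ⟨fun c b f => Linear.smul_comp _ _ _ c b.unop f⟩

theorem IsHomFinite.finite_endOp (h : IsHomFinite k C) (P : C) : Module.Finite k (End P)ᵐᵒᵖ :=
  have : Module.Finite k (End P) := h P P
  Module.Finite.equiv (MulOpposite.opLinearEquiv k)

theorem IsHomFinite.finite_hom (h : IsHomFinite k C) (P X : C) :
    Module.Finite (End P)ᵐᵒᵖ (P ⟶ X) :=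
  have := h P X
  Module.Finite.of_restrictScalars_finite k _ _

theorem IsHomFinite.isNoetherianRing (h : IsHomFinite k C) (P : C) :
    IsNoetherianRing (End P)ᵐᵒᵖ :=
  have := h.finite_endOp P
  isNoetherian_of_tower k inferInstance

/-- The functor `Hom(P, -)` to finitely generated right modules over `End P`. -/
noncomputable def homFunctor (h : IsHomFinite k C) (P : C) : C ⥤ FGModuleCat.{v} (End P)ᵐᵒᵖ :=
  ObjectProperty.lift _ (preadditiveCoyonedaObj P) fun X => h.finite_hom P X

variable (h : IsHomFinite k C) {P : C}

/-- Evaluation of a morphism out of `Hom(P, X)`. -/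
noncomputable def homFunctorEval {X : C} {N : FGModuleCat.{v} (End P)ᵐᵒᵖ}
    (φ : (homFunctor h P).obj X ⟶ N) : (P ⟶ X) →ₗ[(End P)ᵐᵒᵖ] N := φ.hom.hom

/-- The functional on the right module `Hom(P, X)` given by a morphism from `X` to `P`. -/
noncomputable def homToEnd {X : C} (f : X ⟶ P) : (P ⟶ X) →ₗ[(End P)ᵐᵒᵖ] (End P)ᵐᵒᵖ where
  toFun g := MulOpposite.op (α := End P) (g ≫ f)
  map_add' g g' := congrArg (MulOpposite.op (α := End P)) (Preadditive.add_comp _ _ _ g g' f)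
  map_smul' _ _ := congrArg (MulOpposite.op (α := End P)) (Category.assoc _ _ _)

theorem homToEnd_smul {X Y : C} (f : X ⟶ P) (g : P ⟶ X) (b : P ⟶ Y) :
    homToEnd f g • b = g ≫ f ≫ b := Category.assoc _ _ _

theorem homFunctorEval_sum {X : C} {N : FGModuleCat.{v} (End P)ᵐᵒᵖ}
    (φ : (homFunctor h P).obj X ⟶ N) {J : Type} [Fintype J] (a : J → (X ⟶ P)) (b : J → (P ⟶ X))
    (hab : ∑ j, a j ≫ b j = 𝟙 X) (g : P ⟶ X) :
    homFunctorEval h φ g = ∑ j, homToEnd (a j) g • homFunctorEval h φ (b j) := by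
  have hg : g = ∑ j, homToEnd (a j) g • b j := by
    simp only [homToEnd_smul]
    rw [← Preadditive.comp_sum, hab, Category.comp_id]
  conv_lhs => rw [hg]
  simp only [map_sum, map_smul]

/-- The morphism from `Hom(P, Q)` with prescribed values `m j`, where `a j` are morphisms from `Q`
to `P`. -/
noncomputable def homFunctorDesc {Q : C} {N : FGModuleCat.{v} (End P)ᵐᵒᵖ} {J : Type} [Fintype J]
    (a : J → (Q ⟶ P)) (m : J → N) : (homFunctor h P).obj Q ⟶ N :=
  letI := h.finite_hom P Q
  FGModuleCat.ofHom (V := (P ⟶ Q)) (W := N)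
    (∑ j, (LinearMap.toSpanSingleton _ N (m j)).comp (homToEnd (a j)))

theorem homFunctorEval_desc {Q : C} {N : FGModuleCat.{v} (End P)ᵐᵒᵖ} {J : Type} [Fintype J]
    (a : J → (Q ⟶ P)) (m : J → N) (g : P ⟶ Q) :
    homFunctorEval h (homFunctorDesc h a m) g = ∑ j, homToEnd (a j) g • m j :=
  LinearMap.sum_apply _ _ _

variable [HasFiniteBiproducts C] {S : ExactStructure C}

theorem homFunctor_faithful (enough : ∀ X, ∃ (K Q : C) (i : K ⟶ Q) (d : Q ⟶ X), S.Confl i d ∧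
    IsSummandOfPower P Q) : (homFunctor h P).Faithful where
  map_injective {X Y f f'} hf := by
    obtain ⟨K, Q, i, d, hc, J, _, a, b, hab⟩ := enough X
    have := hc.epi
    have hf' (g : P ⟶ X) : g ≫ f = g ≫ f' := congr(homFunctorEval h $hf g)
    rw [← cancel_epi d, ← Category.id_comp d, ← hab, Preadditive.sum_comp, Preadditive.sum_comp,
      Preadditive.sum_comp]
    exact Finset.sum_congr rfl fun j _ => by
      rw [Category.assoc, Category.assoc, Category.assoc, Category.assoc, ← Category.assoc (b j),
        hf', Category.assoc]

theorem homFunctor_full (hP : ∀ X, ExtVanishes S P X)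
    (enough : ∀ X, ∃ (K Q : C) (i : K ⟶ Q) (d : Q ⟶ X), S.Confl i d ∧ IsSummandOfPower P Q) :
    (homFunctor h P).Full where
  map_surjective {X Y} φ := by
    have := homFunctor_faithful h enough
    obtain ⟨K, Q, i, d, hc, J, _, a, b, hab⟩ := enough X
    -- the summand `Q` of a power of `P` detects morphisms out of `Hom(P, Q)`
    have hf : (homFunctor h P).map (∑ j, a j ≫ homFunctorEval h φ (b j ≫ d)) =
        (homFunctor h P).map d ≫ φ := by
      refine FGModuleCat.hom_ext (LinearMap.ext fun (g : P ⟶ Q) => ?_)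
      refine Eq.trans ?_ (homFunctorEval_sum h ((homFunctor h P).map d ≫ φ) a b hab g).symm
      refine (Preadditive.comp_sum _ _ _).trans (Finset.sum_congr rfl fun j _ => ?_)
      exact (homToEnd_smul (a j) g _).symm
    obtain ⟨f, hf'⟩ := hc.desc (∑ j, a j ≫ homFunctorEval h φ (b j ≫ d))
      ((homFunctor h P).map_injective (by
        rw [Functor.map_comp, hf, ← Functor.map_comp_assoc, hc.w]
        refine FGModuleCat.hom_ext (LinearMap.ext fun (g : P ⟶ K) => ?_)
        change homFunctorEval h φ (g ≫ 0) = g ≫ 0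
        rw [comp_zero, comp_zero]
        exact map_zero _))
    refine ⟨f, FGModuleCat.hom_ext (LinearMap.ext fun (g : P ⟶ X) => ?_)⟩
    obtain ⟨g', hg'⟩ := (hP K).lift hc g
    have := congr(homFunctorEval h $hf g')
    change g' ≫ _ = homFunctorEval h φ (g' ≫ d) at this
    change g ≫ f = homFunctorEval h φ g
    rw [← hg', ← this, ← hf', Category.assoc]

instance homFunctor_additive : (homFunctor h P).Additive where
  map_add {_ _ f f'} := FGModuleCat.hom_ext (LinearMap.ext fun (g : P ⟶ _) =>
    Preadditive.comp_add _ _ _ g f f')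

/-- Since `P` is projective, `Hom(P, -)` is exact. -/
theorem homFunctor_exact (hP : ∀ X, ExtVanishes S P X) {X Y Z : C} {i : X ⟶ Y} {d : Y ⟶ Z}
    (hc : S.Confl i d) :
    letI := h.isNoetherianRing P
    (abelianExact (FGModuleCat.{v} (End P)ᵐᵒᵖ)).Confl ((homFunctor h P).map i)
      ((homFunctor h P).map d) := by
  let := h.isNoetherianRing P
  have := hc.mono
  refine ⟨by rw [← Functor.map_comp, hc.w, Functor.map_zero], ?_⟩
  refine ShortExact.reflects_shortExact_of_faithful (forget₂ _ (ModuleCat.{v} (End P)ᵐᵒᵖ))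
    (ShortComplex.ShortExact.mk' ((ShortComplex.moduleCat_exact_iff _).2
      fun (g : P ⟶ Y) hg => ?_) ?_ ?_)
  · exact hc.lift g hg
  · refine (ModuleCat.mono_iff_injective _).2 ?_
    exact fun (g : P ⟶ X) (g' : P ⟶ X) hg => (cancel_mono i).1 hg
  · refine (ModuleCat.epi_iff_surjective _).2 ?_
    exact fun (g : P ⟶ Z) => (hP X).lift hc g

theorem homFunctor_projective {Q : C} (hQ : IsSummandOfPower P Q) :
    letI := h.isNoetherianRing P
    Projective ((homFunctor h P).obj Q) := by
  let := h.isNoetherianRing P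
  obtain ⟨J, _, a, b, hab⟩ := hQ
  refine ⟨fun {N M} φ e he => ?_⟩
  choose m hm using fun j => (fgModuleCat_epi_iff e).1 he (homFunctorEval h φ (b j))
  refine ⟨homFunctorDesc h a m, FGModuleCat.hom_ext (LinearMap.ext fun (g : P ⟶ Q) => ?_)⟩
  refine Eq.trans ?_ (homFunctorEval_sum h φ a b hab g).symm
  refine (congrArg e.hom.hom (homFunctorEval_desc h a m g)).trans ?_
  rw [map_sum]
  exact Finset.sum_congr rfl fun j _ => by rw [map_smul, hm]

/-- Each finitely generated module is a quotient of a free one, that is, of `Hom(P, Pⁿ)`. -/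
theorem homFunctor_covers (M : FGModuleCat.{v} (End P)ᵐᵒᵖ) :
    letI := h.isNoetherianRing P
    ∃ (Q : C) (p : (homFunctor h P).obj Q ⟶ M), IsSummandOfPower P Q ∧ Epi p := by
  let := h.isNoetherianRing P
  obtain ⟨n, m, hm⟩ := Module.Finite.exists_fin (R := (End P)ᵐᵒᵖ) (M := M)
  let Q : C := ⨁ fun _ : Fin n => P
  refine ⟨Q, homFunctorDesc h (fun j => biproduct.π _ j) m, ⟨Fin n, inferInstance,
    fun j => biproduct.π _ j, fun j => biproduct.ι (fun _ : Fin n => P) j, biproduct.total⟩,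
    (fgModuleCat_epi_iff _).2 ?_⟩
  refine LinearMap.range_eq_top.1 (top_le_iff.1 (hm ▸ Submodule.span_le.2 ?_))
  rintro _ ⟨j, rfl⟩
  refine ⟨biproduct.ι (fun _ : Fin n => P) j, (homFunctorEval_desc h _ m _).trans ?_⟩
  rw [Finset.sum_eq_single j]
  · refine (congrArg (fun x : End P => MulOpposite.op x • m j) (biproduct.ι_π_self _ j)).trans ?_
    exact one_smul _ _
  · intro j' _ hj
    refine (congrArg (fun x : End P => MulOpposite.op x • m j')
      (biproduct.ι_π_ne _ (Ne.symm hj))).trans ?_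
    exact zero_smul _ _
  · simp

theorem homFunctor_isRealization (hP : ∀ X, ExtVanishes S P X)
    (enough : ∀ X, ∃ (K Q : C) (i : K ⟶ Q) (d : Q ⟶ X), S.Confl i d ∧ IsSummandOfPower P Q) :
    letI := h.isNoetherianRing P
    IsRealization S (homFunctor h P) := by
  let := h.isNoetherianRing P
  have := h.finite_endOp P
  refine ⟨inferInstance, homFunctor_full h hP enough, homFunctor_faithful h enough,
    homFunctor_exact h hP, fun X => ?_, fun M => ?_, fgModuleCat_enoughInjectives k⟩
  · obtain ⟨K, Q, i, d, hc, hQ⟩ := enough X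
    exact ⟨K, Q, i, d, hc, homFunctor_projective h hQ⟩
  · obtain ⟨Q, p, hQ, hp⟩ := homFunctor_covers h M
    exact ⟨Q, p, homFunctor_projective h hQ, hp⟩

attribute [local instance] uliftCategory

/-- Each exact category with a projective generator has a realization, in an abelian category
with objects and morphisms in arbitrary sufficiently large universes. -/
theorem exists_isRealization (h : IsHomFinite k C) (hP : ∀ X, ExtVanishes S P X)
    (enough : ∀ X, ∃ (K Q : C) (i : K ⟶ Q) (d : Q ⟶ X), S.Confl i d ∧ IsSummandOfPower P Q) :
    ∃ (A : Type (max v w₁)) (_ : Category.{max v w₂} A) (_ : Abelian A) (F : C ⥤ A),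
      IsRealization S F := by
  let := h.isNoetherianRing P
  let A := ULiftHom.{w₂} (ULift.{w₁} (FGModuleRepr (End P)ᵐᵒᵖ))
  let e : FGModuleCat.{v} (End P)ᵐᵒᵖ ≌ A :=
    (FGModuleRepr.embed.{v} (End P)ᵐᵒᵖ).asEquivalence.symm.trans
      (ULiftHomULiftCategory.equiv.{w₂, w₁} (FGModuleRepr (End P)ᵐᵒᵖ))
  let : Preadditive A := .ofFullyFaithful e.fullyFaithfulInverse
  have : HasFiniteProducts A :=
    ⟨fun n => Adjunction.hasLimitsOfShape_of_equivalence e.inverse⟩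
  let : Abelian A := abelianOfEquivalence e.inverse
  exact ⟨A, inferInstance, inferInstance, _,
    (homFunctor_isRealization h hP enough).of_isEquivalence e.functor (Iso.refl _)⟩

end Model

/-! ### Length functions, projective covers, simple factors -/

theorem exists_forall_le {α : Type*} (p : α → Prop) (m : α → ℕ) (h : ∃ x, p x) :
    ∃ x, p x ∧ ∀ y, p y → m x ≤ m y := by
  obtain ⟨x, hx, hx'⟩ := exists_minimalFor_of_wellFoundedLT p m h
  exact ⟨x, hx, fun y hy => (le_total (m x) (m y)).elim id fun h => hx' hy h⟩

theorem isZero_of_isIso_zero {C : Type u} [Category.{v} C] [HasZeroMorphisms C] {X Y : C}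
    {f : X ⟶ Y} (h : f = 0) (hf : IsIso f) : IsZero Y := by
  subst h
  rw [IsZero.iff_id_eq_zero, ← IsIso.inv_hom_id (0 : X ⟶ Y), comp_zero]

section Length

variable {A : Type u} [Category.{v} A] [Abelian A]

/-- An additive function on the objects of an abelian category which detects zero objects. -/
structure IsLength (d : A → ℕ) : Prop where
  additive : ∀ {X Y Z : A} {f : X ⟶ Y} {g : Y ⟶ Z}, (abelianExact A).Confl f g → d Y = d X + d Z
  isZero : ∀ {X : A}, d X = 0 → IsZero X

namespace IsLength

variable {d : A → ℕ} (hd : IsLength d)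

include hd

theorem op : IsLength fun X : Aᵒᵖ => d X.unop where
  additive h := by rw [hd.additive (abelianExact_confl_unop h), add_comm]
  isZero h := (hd.isZero h).op

theorem le_of_mono {X Y : A} (f : X ⟶ Y) [Mono f] : d X ≤ d Y := by
  rw [hd.additive (abelianExact_cokernel f)]
  exact Nat.le_add_right _ _

theorem le_of_epi {X Y : A} (f : X ⟶ Y) [Epi f] : d Y ≤ d X := by
  rw [hd.additive (abelianExact_kernel f)]
  exact Nat.le_add_left _ _

theorem isIso_of_mono {X Y : A} (f : X ⟶ Y) [Mono f] (h : d Y ≤ d X) : IsIso f := by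
  have := hd.additive (abelianExact_cokernel f)
  have h0 := hd.isZero (X := cokernel f) (by omega)
  have : Epi f := Preadditive.epi_of_cokernel_zero (h0.eq_of_tgt _ _)
  exact isIso_of_mono_of_epi f

theorem isIso_of_epi {X Y : A} (f : X ⟶ Y) [Epi f] (h : d X ≤ d Y) : IsIso f := by
  have := hd.additive (abelianExact_kernel f)
  have h0 := hd.isZero (X := kernel f) (by omega)
  have : Mono f := Preadditive.mono_of_kernel_zero (h0.eq_of_src _ _)
  exact isIso_of_mono_of_epi f

/-- A nonzero quotient of minimal length is simple. -/
theorem exists_simple_quotient {X : A} (hX : ¬ IsZero X) :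
    ∃ (U Z : A) (i : U ⟶ X) (p : X ⟶ Z), (abelianExact A).Confl i p ∧ Simple Z := by
  obtain ⟨⟨Z, p⟩, ⟨hp, hZ⟩, hmin⟩ := exists_forall_le
    (fun Z : (Z : A) × (X ⟶ Z) => Epi Z.2 ∧ ¬ IsZero Z.1) (fun Z => d Z.1)
    ⟨⟨X, 𝟙 X⟩, by dsimp; infer_instance, hX⟩
  dsimp only at hp hZ hmin
  refine ⟨_, Z, _, p, abelianExact_kernel p,
    ⟨fun {Y} f _ => ⟨fun hf h0 => hZ (isZero_of_isIso_zero h0 hf), fun hf => ?_⟩⟩⟩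
  by_cases h : IsZero (cokernel f)
  · have : Epi f := Preadditive.epi_of_cokernel_zero (h.eq_of_tgt _ _)
    exact isIso_of_mono_of_epi f
  · have h₁ := hmin ⟨_, p ≫ cokernel.π f⟩ ⟨epi_comp _ _, h⟩
    have h₂ := hd.additive (abelianExact_cokernel f)
    exact absurd ((hd.isZero (X := Y) (by dsimp only at h₁; omega)).eq_of_src _ _) hf

/-- A nonzero subobject of minimal length is simple. -/
theorem exists_simple_subobject {X : A} (hX : ¬ IsZero X) :
    ∃ (Z : A) (i : Z ⟶ X), Mono i ∧ Simple Z := by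
  obtain ⟨⟨Z, p⟩, ⟨hp, hZ⟩, hmin⟩ := exists_forall_le
    (fun Z : (Z : A) × (Z ⟶ X) => Mono Z.2 ∧ ¬ IsZero Z.1) (fun Z => d Z.1)
    ⟨⟨X, 𝟙 X⟩, by dsimp; infer_instance, hX⟩
  dsimp only at hp hZ hmin
  refine ⟨Z, p, hp, ⟨fun {Y} f _ => ⟨fun hf h0 => hZ (isZero_of_isIso_zero h0 hf), fun hf => ?_⟩⟩⟩
  exact hd.isIso_of_mono f (hmin ⟨Y, f ≫ p⟩ ⟨mono_comp _ _, fun h => hf (h.eq_of_src _ _)⟩)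

/-- Existence of injective hulls: an injective object containing `X` of minimal length is an
essential extension of `X`. -/
theorem exists_injectiveHull {X J₀ : A} (i : X ⟶ J₀) [Injective J₀] [Mono i] :
    ∃ (J : A) (f : X ⟶ J), Injective J ∧ Mono f ∧
      ∀ {Y : A} (g : J ⟶ Y), Mono (f ≫ g) → Mono g := by
  obtain ⟨⟨J, f⟩, ⟨hJ, hf⟩, hmin⟩ := exists_forall_le
    (fun J : (J : A) × (X ⟶ J) => Injective J.1 ∧ Mono J.2) (fun J => d J.1)
    ⟨⟨J₀, i⟩, inferInstance, inferInstance⟩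
  dsimp only at hJ hf hmin
  -- An endomorphism of minimal rank that fixes `X` splits: its image is a retract of `J`.
  obtain ⟨⟨Z, e, m⟩, hem, hZmin⟩ := exists_forall_le
    (fun Z : (Z : A) × (J ⟶ Z) × (Z ⟶ J) => f ≫ Z.2.1 ≫ Z.2.2 = f) (fun Z => d Z.1)
    ⟨⟨J, 𝟙 J, 𝟙 J⟩, by simp⟩
  dsimp only at hem hZmin
  have : IsIso (m ≫ e) := by
    have h₁ := hZmin ⟨Abelian.image (m ≫ e), e ≫ Abelian.factorThruImage (m ≫ e),
      Abelian.image.ι (m ≫ e) ≫ m⟩ (by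
        have := Abelian.image.fac (m ≫ e)
        simp only [Category.assoc, reassoc_of% this, reassoc_of% hem, hem])
    have := hd.isIso_of_mono (Abelian.image.ι (m ≫ e)) h₁
    have : Epi (m ≫ e) := by
      rw [← Abelian.image.fac (m ≫ e)]
      exact epi_comp _ _
    exact hd.isIso_of_epi _ le_rfl
  have hZ : Injective Z := ⟨fun {U V} t i _ => ⟨Injective.factorThru (t ≫ m) i ≫ e ≫ inv (m ≫ e), by
    rw [← Category.assoc, Injective.comp_factorThru, Category.assoc, ← Category.assoc m,
      IsIso.hom_inv_id, Category.comp_id]⟩⟩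
  have hJZ : d J ≤ d Z := hmin ⟨Z, f ≫ e⟩ ⟨hZ, by
    have : Mono ((f ≫ e) ≫ m) := by rwa [Category.assoc, hem]
    exact mono_of_mono (f ≫ e) m⟩
  refine ⟨J, f, hJ, hf, fun {Y} g hg => ?_⟩
  have h₁ := hZmin ⟨Abelian.image g, Abelian.factorThruImage g,
    Abelian.image.ι g ≫ Injective.factorThru f (f ≫ g)⟩ (by
      have := Abelian.image.fac g
      have h := Injective.comp_factorThru f (f ≫ g)
      rw [Category.assoc] at h
      simp only [reassoc_of% this, h])
  have : IsIso (Abelian.factorThruImage g) := hd.isIso_of_epi _ (hJZ.trans h₁)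
  rw [← Abelian.image.fac g]
  exact mono_comp _ _

/-- Existence of projective covers. -/
theorem exists_projectiveCover {X P₀ : A} (p : P₀ ⟶ X) [Projective P₀] [Epi p] :
    ∃ (P : A) (f : P ⟶ X), Projective P ∧ Epi f ∧
      ∀ {Y : A} (g : Y ⟶ P), Epi (g ≫ f) → Epi g := by
  obtain ⟨J, f, hJ, hf, H⟩ := hd.op.exists_injectiveHull p.op
  refine ⟨J.unop, f.unop, inferInstance, inferInstance, fun {Y} g hg => ?_⟩
  have : Mono (f ≫ g.op) := by
    have : Mono (g ≫ f.unop).op := inferInstance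
    exact this
  have := H g.op this
  exact inferInstanceAs (Epi g.op.unop)

end IsLength

end Length

section Covers

variable {A : Type u} [Category.{v} A] [Abelian A] {ι : Type w₁}

/-- All simple factors of `X` are isomorphic to `L m` with `s m`. -/
abbrev Fac (L : ι → A) (s : ι → Prop) : ObjectProperty A :=
  HasFiltration (abelianExact A) fun Y => ∃ m, s m ∧ Nonempty (Y ≅ L m)

/-- The family `L` enumerates the simple objects of an abelian category of finite length, and the
morphisms `c i : C i ⟶ L i` are projective covers. -/
structure IsCoverSystem (L C : ι → A) (c : ∀ i, C i ⟶ L i) : Prop where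
  exists_length : ∃ d : A → ℕ, IsLength d
  simple : ∀ i, Simple (L i)
  eq_of_iso : ∀ i j, Nonempty (L i ≅ L j) → i = j
  exists_iso : ∀ X : A, Simple X → ∃ i, Nonempty (X ≅ L i)
  projective : ∀ i, Projective (C i)
  epi : ∀ i, Epi (c i)
  superfluous : ∀ i {Y : A} (g : Y ⟶ C i), Epi (g ≫ c i) → Epi g

namespace IsCoverSystem

variable {L C : ι → A} {c : ∀ i, C i ⟶ L i} (hC : IsCoverSystem L C c)

include hC

theorem simple_hom_eq_zero {i m : ι} (h : m ≠ i) (f : L i ⟶ L m) : f = 0 := by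
  by_contra hf
  have := hC.simple i
  have := hC.simple m
  have := isIso_of_hom_simple hf
  exact h (hC.eq_of_iso _ _ ⟨(asIso f).symm⟩)

theorem exists_factor {i m : ι} (f : C i ⟶ L m) : ∃ a, c i ≫ a = f := by
  by_cases hf : f = 0
  · exact ⟨0, by rw [hf, comp_zero]⟩
  have := hC.simple i
  have := hC.simple m
  have := hC.epi i
  have := epi_of_nonzero_to_simple hf
  by_cases hk : kernel.ι f ≫ c i = 0
  · obtain ⟨s, hs⟩ := (abelianExact_kernel f).desc (c i) hk
    have hs0 : s ≠ 0 := fun h0 => Simple.not_isZero (L i) ((IsZero.iff_id_eq_zero _).2 (by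
      rw [← cancel_epi (c i), ← hs, h0, comp_zero, zero_comp, comp_zero]))
    have := isIso_of_hom_simple hs0
    exact ⟨inv s, by rw [← hs, Category.assoc, IsIso.hom_inv_id, Category.comp_id]⟩
  · have := epi_of_nonzero_to_simple hk
    have := hC.superfluous i _ this
    exact absurd (by rw [← cancel_epi (kernel.ι f), kernel.condition, comp_zero]) hf

theorem hom_eq_zero {i m : ι} (h : m ≠ i) (f : C i ⟶ L m) : f = 0 := by
  obtain ⟨a, rfl⟩ := hC.exists_factor f
  rw [hC.simple_hom_eq_zero h a, comp_zero]

/-- The projective cover of a simple object that is not a simple factor of `X` has no nonzero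
morphisms to `X`. -/
theorem hom_eq_zero_of_fac {s : ι → Prop} {X : A} (hX : Fac L s X) {i : ι} (hi : ¬ s i)
    (f : C i ⟶ X) : f = 0 := by
  have := hC.projective i
  induction hX with
  | zero h => exact h.eq_of_tgt _ _
  | step h _ hZ ih =>
    obtain ⟨m, hm, ⟨e⟩⟩ := hZ
    obtain ⟨t, ht⟩ := h.lift f (by
      rw [← cancel_mono e.hom, zero_comp]
      exact hC.hom_eq_zero (by rintro rfl; exact hi hm) _)
    rw [← ht, ih t, zero_comp]

/-- Objects have simple factors as prescribed if the projective covers of the other simple objects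
have no nonzero morphisms to them. -/
theorem fac {s : ι → Prop} {X : A} (h : ∀ i, ¬ s i → ∀ f : C i ⟶ X, f = 0) : Fac L s X := by
  obtain ⟨d, hd⟩ := hC.exists_length
  induction hn : d X using Nat.strong_induction_on generalizing X with
  | _ n ih =>
  by_cases hX : IsZero X
  · exact .zero hX
  obtain ⟨U, Z, i, p, hc, hZ⟩ := hd.exists_simple_quotient hX
  have := hc.mono
  have := hc.epi
  obtain ⟨m, ⟨e⟩⟩ := hC.exists_iso Z hZ
  have hdZ : d Z ≠ 0 := fun h => Simple.not_isZero Z (hd.isZero h)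
  refine .step hc (ih (d U) ?_ (fun i' hi' f => ?_) rfl) ⟨m, by_contra fun hm => ?_, ⟨e⟩⟩
  · have := hd.additive hc
    omega
  · rw [← cancel_mono i, h _ hi' (f ≫ i), zero_comp]
  · have := hC.projective m
    have := hC.epi m
    have h₁ := h m hm (Projective.factorThru (c m ≫ e.inv) p)
    have h₂ := Projective.factorThru_comp (c m ≫ e.inv) p
    rw [h₁, zero_comp] at h₂
    have := hC.simple m
    exact Simple.not_isZero (L m) ((IsZero.iff_id_eq_zero _).2 (by
      rw [← cancel_epi (c m), ← cancel_mono e.inv, Category.assoc, Category.id_comp, ← h₂]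
      simp))

theorem isZero {X : A} (h : ∀ i (f : C i ⟶ X), f = 0) : IsZero X := by
  by_contra hX
  obtain ⟨d, hd⟩ := hC.exists_length
  obtain ⟨U, Z, i, p, hc, hZ⟩ := hd.exists_simple_quotient hX
  have := hc.epi
  cases hC.fac (s := fun _ => False) fun i _ => h i with
  | zero h => exact hX h
  | step _ _ h => exact h.choose_spec.1

theorem fac_of_epi {s : ι → Prop} {X Y : A} (hX : Fac L s X) (f : X ⟶ Y) [Epi f] : Fac L s Y :=
  hC.fac fun i hi g => by
    have := hC.projective i
    rw [← Projective.factorThru_comp g f,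
      hC.hom_eq_zero_of_fac hX hi (Projective.factorThru g f), zero_comp]

theorem fac_of_confl {s : ι → Prop} {X Y Z : A} {f : X ⟶ Y} {g : Y ⟶ Z}
    (h : (abelianExact A).Confl f g) (hX : Fac L s X) (hZ : Fac L s Z) : Fac L s Y :=
  hC.fac fun i hi t => by
    obtain ⟨t', ht'⟩ := h.lift t (hC.hom_eq_zero_of_fac hZ hi _)
    rw [← ht', hC.hom_eq_zero_of_fac hX hi t', zero_comp]

theorem fac_simple {s : ι → Prop} {i : ι} (hi : s i) : Fac L s (L i) :=
  .step ((abelianExact A).ex0 (isZero_zero A) 0) (.zero (isZero_zero A)) ⟨i, hi, ⟨Iso.refl _⟩⟩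

theorem fac_mono {s s' : ι → Prop} (h : ∀ i, s i → s' i) {X : A} (hX : Fac L s X) : Fac L s' X :=
  hC.fac fun _ hi => hC.hom_eq_zero_of_fac hX fun h' => hi (h _ h')

end IsCoverSystem

/-- An object without nonzero morphisms to `L m`, for all `m` with `s m`, has no nonzero morphisms
to objects with simple factors of this form. -/
theorem Fac.hom_eq_zero {L : ι → A} {s : ι → Prop} {X Y : A} (hX : Fac L s X)
    (h : ∀ m, s m → ∀ f : Y ⟶ L m, f = 0) (f : Y ⟶ X) : f = 0 := by
  induction hX with
  | zero h => exact h.eq_of_tgt _ _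
  | step hc _ hZ ih =>
    obtain ⟨m, hm, ⟨e⟩⟩ := hZ
    obtain ⟨t, ht⟩ := hc.lift f (by
      rw [← cancel_mono e.hom, zero_comp]
      exact h m hm _)
    rw [← ht, ih t, zero_comp]

theorem Fac.hom_eq_zero' {L : ι → A} {s : ι → Prop} {X Y : A} (hX : Fac L s X)
    (h : ∀ m, s m → ∀ f : L m ⟶ Y, f = 0) (f : X ⟶ Y) : f = 0 := by
  induction hX with
  | zero h => exact h.eq_of_src _ _
  | step hc _ hZ ih =>
    obtain ⟨m, hm, ⟨e⟩⟩ := hZ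
    obtain ⟨t, ht⟩ := hc.desc f (ih _)
    rw [← ht, ← Category.id_comp t, ← e.hom_inv_id, Category.assoc, h m hm (e.inv ≫ t), comp_zero,
      comp_zero]

theorem Fac.extVanishes {L : ι → A} {s : ι → Prop} {X Y : A} (hX : Fac L s X)
    (h : ∀ m, s m → ExtVanishes (abelianExact A) (L m) Y) :
    ExtVanishes (abelianExact A) X Y := by
  induction hX with
  | zero h => exact .of_isZero_left h
  | step hc _ hZ ih =>
    obtain ⟨m, hm, ⟨e⟩⟩ := hZ
    exact .of_confl_left hc ih ((h m hm).of_iso_left e.symm)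

end Covers

/-! ### Standard objects -/

section StandardData

/-- Objects `Δ i` of an abelian category, indexed by its simple objects `L i`, which are part of a
highest weight structure: `Δ i` has the unique simple quotient `L i`, its other simple factors are
smaller, and it is covered by a projective object such that the kernel is filtered by larger
standard objects. In addition each `L i` embeds into an injective object. -/
structure StandardData (A : Type u) [Category.{v} A] [Abelian A] {ι : Type w₁}
    (le : ι → ι → Prop) (L Δ : ι → A) : Prop where
  refl : ∀ i, le i i
  trans : ∀ i j m, le i j → le j m → le i m
  antisymm : ∀ i j, le i j → le j i → i = j
  exists_length : ∃ d : A → ℕ, IsLength d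
  simple : ∀ i, Simple (L i)
  eq_of_iso : ∀ i j, Nonempty (L i ≅ L j) → i = j
  exists_iso : ∀ X : A, Simple X → ∃ i, Nonempty (X ≅ L i)
  top : ∀ i, ∃ (R : A) (u : R ⟶ Δ i) (t : Δ i ⟶ L i), (abelianExact A).Confl u t ∧
    Fac L (fun m => le m i ∧ m ≠ i) R
  hom_eq_zero : ∀ i m, m ≠ i → ∀ f : Δ i ⟶ L m, f = 0
  exists_projective : ∀ i, ∃ (K P : A) (u : K ⟶ P) (p : P ⟶ Δ i), (abelianExact A).Confl u p ∧
    Projective P ∧ ExtClosure (abelianExact A) (fun Y => ∃ l, le i l ∧ l ≠ i ∧ Y = Δ l) K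
  exists_injective : ∀ i, ∃ (J : A) (f : L i ⟶ J), Injective J ∧ Mono f

namespace StandardData

variable {A : Type u} [Category.{v} A] [Abelian A] {ι : Type w₁}
  {le : ι → ι → Prop} {L Δ : ι → A} (D : StandardData A le L Δ)

include D

theorem exists_isCoverSystem : ∃ (C : ι → A) (c : ∀ i, C i ⟶ L i), IsCoverSystem L C c := by
  obtain ⟨d, hd⟩ := D.exists_length
  have (i : ι) : ∃ (P : A) (f : P ⟶ L i), Projective P ∧ Epi f ∧
      ∀ {Y : A} (g : Y ⟶ P), Epi (g ≫ f) → Epi g := by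
    obtain ⟨R, u, t, ht, -⟩ := D.top i
    obtain ⟨K, P, u', p, hp, hP, -⟩ := D.exists_projective i
    have := ht.epi
    have := hp.epi
    exact hd.exists_projectiveCover (p ≫ t)
  choose C c hproj hepi hsup using this
  exact ⟨C, c, D.exists_length, D.simple, D.eq_of_iso, D.exists_iso, hproj, hepi, hsup⟩

/-- `Ext¹(Δ i, X) = 0` if no simple factor of `X` is strictly larger than `L i`. -/
theorem extVanishes {s : ι → Prop} {i : ι} (hs : ∀ m, s m → le i m → m = i) {X : A}
    (hX : Fac L s X) : ExtVanishes (abelianExact A) (Δ i) X := by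
  obtain ⟨K, P, u, p, hp, hP, hK⟩ := D.exists_projective i
  rintro ⟨M, j, q, hM⟩
  have := hM.epi
  have := hp.epi
  obtain ⟨s, hs⟩ := hp.desc (Projective.factorThru p q) (by
    obtain ⟨t, ht⟩ := hM.lift (u ≫ Projective.factorThru p q) (by
      rw [Category.assoc, Projective.factorThru_comp, hp.w])
    rw [← ht, hK.hom_eq_zero (fun Z hZ f => ?_) t, zero_comp]
    obtain ⟨l, h₁, h₂, rfl⟩ := hZ
    exact hX.hom_eq_zero (fun m hm => D.hom_eq_zero l m fun h => h₂ (h ▸ hs m hm (h ▸ h₁))) f)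
  exact ⟨s, by rw [← cancel_epi p, reassoc_of% hs, Projective.factorThru_comp, Category.comp_id]⟩

theorem fac (i : ι) {C : ι → A} {c : ∀ i, C i ⟶ L i} (hC : IsCoverSystem L C c) :
    Fac L (fun m => le m i) (Δ i) := by
  obtain ⟨R, u, t, ht, hR⟩ := D.top i
  exact hC.fac_of_confl ht (hC.fac_mono (fun _ h => h.1) hR) (hC.fac_simple (D.refl i))

/-- The epimorphism from `Δ i` to its simple quotient is superfluous. -/
theorem epi_of_epi_comp (i : ι) {C : ι → A} {c : ∀ i, C i ⟶ L i} (hC : IsCoverSystem L C c)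
    {t : Δ i ⟶ L i} (ht : t ≠ 0) {X : A} (q : X ⟶ Δ i) (hq : Epi (q ≫ t)) : Epi q := by
  obtain ⟨d, hd⟩ := D.exists_length
  have := D.simple i
  by_contra h
  have h0 : ¬ IsZero (cokernel q) := fun h' =>
    h (Preadditive.epi_of_cokernel_zero (h'.eq_of_tgt _ _))
  obtain ⟨U, Z, j, p, hc, hZ⟩ := hd.exists_simple_quotient h0
  obtain ⟨m, ⟨e⟩⟩ := D.exists_iso Z hZ
  have := hc.epi
  obtain ⟨R, u, t', ht', hR⟩ := D.top i
  have hdesc (f : Δ i ⟶ L i) : ∃ a, t' ≫ a = f := ht'.desc f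
    (hR.hom_eq_zero' (fun m hm => hC.simple_hom_eq_zero hm.2.symm) (u ≫ f))
  by_cases hm : m = i
  · subst hm
    obtain ⟨a, ha⟩ := hdesc t
    obtain ⟨b, hb⟩ := hdesc (cokernel.π q ≫ p ≫ e.hom)
    have ha0 : a ≠ 0 := fun h => ht (by rw [← ha, h, comp_zero])
    have := isIso_of_hom_simple ha0
    have hb0 : b = 0 := by
      have h₁ : (q ≫ t) ≫ inv a ≫ b = 0 := by
        rw [← ha]
        simp [hb]
      have h₂ : inv a ≫ b = 0 := by rw [← cancel_epi (q ≫ t), h₁, comp_zero]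
      rw [← cancel_epi (inv a), h₂, comp_zero]
    have : cokernel.π q ≫ p ≫ e.hom = 0 := by rw [← hb, hb0, comp_zero]
    have : IsZero (L m) := (IsZero.iff_id_eq_zero _).2 (by
      rw [← cancel_epi (cokernel.π q ≫ p ≫ e.hom), this, comp_zero, zero_comp])
    exact Simple.not_isZero _ this
  · have h₁ := D.hom_eq_zero i m hm (cokernel.π q ≫ p ≫ e.hom)
    have : IsZero (L m) := (IsZero.iff_id_eq_zero _).2 (by
      rw [← cancel_epi (cokernel.π q ≫ p ≫ e.hom), h₁, comp_zero, zero_comp])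
    have := D.simple m
    exact Simple.not_isZero (L m) ‹_›

/-- `Δ i` is the standard object attached to `L i`. -/
theorem isStandard (i : ι) : IsStandard le L i (Δ i) := by
  obtain ⟨C, c, hC⟩ := D.exists_isCoverSystem
  obtain ⟨R, u, t, ht, hR⟩ := D.top i
  obtain ⟨K, P, v, p, hp, hP, hK⟩ := D.exists_projective i
  have := ht.epi
  have := hp.epi
  have := hC.projective i
  have := hC.epi i
  have := D.simple i
  have ht0 : t ≠ 0 := fun h => Simple.not_isZero (L i) ((IsZero.iff_id_eq_zero _).2 (by
    rw [← cancel_epi t, h, zero_comp, zero_comp]))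
  have hq : Projective.factorThru (c i) t ≫ t = c i := Projective.factorThru_comp _ _
  have : Epi (Projective.factorThru (c i) t) :=
    D.epi_of_epi_comp i hC ht0 _ (by rw [hq]; infer_instance)
  refine ⟨C i, Projective.factorThru (c i) t, ⟨hC.projective i, c i, hC.epi i, hC.superfluous i⟩,
    this, D.fac i hC, fun {Q} r hr hQ => ?_⟩
  let π : P ⟶ C i := Projective.factorThru p (Projective.factorThru (c i) t)
  have hπ : π ≫ Projective.factorThru (c i) t = p := Projective.factorThru_comp _ _
  have : Epi π := hC.superfluous i π (by rw [← hq, reassoc_of% hπ]; infer_instance)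
  obtain ⟨s, hs⟩ := hp.desc (π ≫ r) (hK.hom_eq_zero (fun Z hZ f => by
    obtain ⟨l, h₁, h₂, rfl⟩ := hZ
    exact Fac.hom_eq_zero hQ (fun m hm => D.hom_eq_zero l m fun h =>
      h₂ (D.antisymm _ _ (h ▸ hm) h₁)) f) _)
  exact ⟨s, by rw [← cancel_epi π, reassoc_of% hπ, hs]⟩

end StandardData

end StandardData

/-! ### Costandard objects -/

section Costandard

theorem simple_op {A : Type u} [Category.{v} A] [Abelian A] (X : A) [Simple X] :
    Simple (Opposite.op X) where
  mono_isIso_iff_nonzero {Y} f _ := by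
    refine ⟨fun hf h0 => Simple.not_isZero X (isZero_of_isIso_zero h0 hf).unop, fun hf => ?_⟩
    have := isIso_of_epi_of_nonzero (f := f.unop) fun h => hf (Quiver.Hom.unop_inj h)
    exact inferInstanceAs (IsIso f.unop.op)

theorem simple_unop {A : Type u} [Category.{v} A] [Abelian A] (X : Aᵒᵖ) [Simple X] :
    Simple X.unop where
  mono_isIso_iff_nonzero {Y} f _ := by
    refine ⟨fun hf h0 => Simple.not_isZero X (isZero_of_isIso_zero h0 hf).op, fun hf => ?_⟩
    have := isIso_of_epi_of_nonzero (f := f.op) fun h => hf (Quiver.Hom.op_inj h)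
    exact inferInstanceAs (IsIso f.op.unop)

/-- The morphism `n : N ⟶ I` is the largest subobject of `I` all of whose simple factors are of the
form `L m` with `m ≼ i`, and `g` is the factorization through `n` of a morphism `f` from `L i`. When
`f` is an injective hull, `N` is the costandard object. -/
structure IsLargestSub {A : Type u} [Category.{v} A] [Abelian A] {ι : Type w₁}
    (le : ι → ι → Prop) (L : ι → A) (i : ι) {N I : A} (n : N ⟶ I) (g : L i ⟶ N) (f : L i ⟶ I) :
    Prop where
  mono : Mono n
  fac : Fac L (fun m => le m i) N
  lift : ∀ {M : A} (m : M ⟶ I), Fac L (fun m => le m i) M → ∃ s, s ≫ n = m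
  w : g ≫ n = f

namespace StandardData

variable {A : Type u} [Category.{v} A] [Abelian A] {ι : Type w₁}
  {le : ι → ι → Prop} {L Δ : ι → A} (D : StandardData A le L Δ)
  {C : ι → A} {c : ∀ i, C i ⟶ L i} (hC : IsCoverSystem L C c)
  {I : ι → A} {f : ∀ i, L i ⟶ I i}
  (hI : IsCoverSystem (fun i => Opposite.op (L i)) (fun i => Opposite.op (I i)) fun i => (f i).op)

include D in
/-- Injective hulls of the simple objects. -/
theorem exists_hulls : ∃ (I : ι → A) (f : ∀ i, L i ⟶ I i), IsCoverSystem
    (fun i => Opposite.op (L i)) (fun i => Opposite.op (I i)) fun i => (f i).op := by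
  obtain ⟨d, hd⟩ := D.exists_length
  have (i : ι) : ∃ (J : A) (f : L i ⟶ J), Injective J ∧ Mono f ∧
      ∀ {Y : A} (g : J ⟶ Y), Mono (f ≫ g) → Mono g := by
    obtain ⟨J, f, hJ, hf⟩ := D.exists_injective i
    exact hd.exists_injectiveHull f
  choose I f hI hf hess using this
  refine ⟨I, f, ⟨_, hd.op⟩, fun i => ?_, fun i j h => ?_, fun X hX => ?_, inferInstance,
    inferInstance, fun i Y g hg => ?_⟩
  · have := D.simple i
    exact simple_op _
  · exact D.eq_of_iso _ _ (h.map fun e => e.unop.symm)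
  · obtain ⟨i, ⟨e⟩⟩ := D.exists_iso X.unop (simple_unop X)
    exact ⟨i, ⟨e.symm.op⟩⟩
  · have : Mono (f i ≫ g.unop) := inferInstanceAs (Mono (g ≫ (f i).op).unop)
    have := hess i g.unop this
    exact inferInstanceAs (Epi g.unop.op)

section

include hI

theorem injective (i : ι) : Injective (I i) :=
  Injective.injective_iff_projective_op.2 (hI.projective i)

theorem hom_hull_eq_zero {i m : ι} (h : m ≠ i) (a : L m ⟶ I i) : a = 0 :=
  congr(($(hI.hom_eq_zero h a.op)).unop)

theorem exists_factor_hull {i : ι} (a : L i ⟶ I i) : ∃ b, b ≫ f i = a := by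
  obtain ⟨b, hb⟩ := hI.exists_factor a.op
  exact ⟨b.unop, congr(($hb).unop)⟩

/-- `L i` is an essential subobject of its injective hull. -/
theorem mono_of_mono_hull {i : ι} {Y : A} (g : I i ⟶ Y) (h : Mono (f i ≫ g)) : Mono g := by
  have : Epi (g.op ≫ (f i).op) := inferInstanceAs (Epi (f i ≫ g).op)
  have := hI.superfluous i g.op this
  exact inferInstanceAs (Mono g.op.unop)

include D hC in
/-- The subobject of maximal length with simple factors as prescribed is the largest one. -/
theorem exists_isLargestSub (i : ι) :
    ∃ (N : A) (n : N ⟶ I i) (g : L i ⟶ N), IsLargestSub le L i n g (f i) := by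
  obtain ⟨d, hd⟩ := D.exists_length
  obtain ⟨⟨N, n⟩, ⟨hn, hN⟩, hmin⟩ := exists_forall_le
    (fun N : (N : A) × (N ⟶ I i) => Mono N.2 ∧ Fac L (fun m => le m i) N.1)
    (fun N => d (I i) - d N.1) ⟨⟨0, 0⟩, by dsimp; infer_instance, .zero (isZero_zero A)⟩
  dsimp only at hn hN hmin
  have lift {M : A} (m : M ⟶ I i) (hM : Fac L (fun m => le m i) M) : ∃ s, s ≫ n = m := by
    let b := biprod.desc n m
    have hb : Abelian.factorThruImage b ≫ Abelian.image.ι b = b := Abelian.image.fac b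
    have h₁ := hmin ⟨Abelian.image b, Abelian.image.ι b⟩ ⟨inferInstance,
      hC.fac_of_epi (hC.fac_of_confl ((abelianExact A).confl_biprod N M) hN hM)
        (Abelian.factorThruImage b)⟩
    dsimp only at h₁
    have h₂ := hd.le_of_mono n
    have h₃ := hd.le_of_mono (Abelian.image.ι b)
    have hl : (biprod.inl ≫ Abelian.factorThruImage b) ≫ Abelian.image.ι b = n := by
      rw [Category.assoc, hb, biprod.inl_desc]
    have : Mono ((biprod.inl ≫ Abelian.factorThruImage b) ≫ Abelian.image.ι b) := by rwa [hl]
    have := mono_of_mono (biprod.inl ≫ Abelian.factorThruImage b) (Abelian.image.ι b)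
    have := hd.isIso_of_mono (biprod.inl ≫ Abelian.factorThruImage b) (by omega)
    refine ⟨biprod.inr ≫ Abelian.factorThruImage b ≫
      inv (biprod.inl ≫ Abelian.factorThruImage b), ?_⟩
    rw [← hl, Category.assoc, Category.assoc, IsIso.inv_hom_id_assoc, hb, biprod.inr_desc]
  obtain ⟨g, hg⟩ := lift (f i) (hC.fac_simple (D.refl i))
  exact ⟨N, n, g, hn, hN, lift, hg⟩

variable {N : ι → A} {n : ∀ i, N i ⟶ I i} {g : ∀ i, L i ⟶ N i}
  (hN : ∀ i, IsLargestSub le L i (n i) (g i) (f i))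

include hN

/-- The socle of the costandard object contains only `L i`. -/
theorem hom_costandard_eq_zero {i m : ι} (h : m ≠ i) (a : L m ⟶ N i) : a = 0 := by
  have := (hN i).mono
  rw [← cancel_mono (n i), hom_hull_eq_zero hI h (a ≫ n i), zero_comp]

theorem mono_socle (i : ι) : Mono (g i) := by
  have : Mono (g i ≫ n i) := by
    rw [(hN i).w]
    have := hI.epi i
    exact inferInstanceAs (Mono (f i).op.unop)
  exact mono_of_mono _ (n i)

/-- `L i` is an essential subobject of the costandard object. -/
theorem mono_of_mono_socle {i : ι} {Y : A} (h : N i ⟶ Y) (hh : Mono (g i ≫ h)) : Mono h := by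
  have := (hN i).mono
  have h₁ : Mono (f i ≫ cokernel.π (kernel.ι h ≫ n i)) := by
    refine Preadditive.mono_of_cancel_zero _ fun {W} x hx => ?_
    obtain ⟨y, hy⟩ := (abelianExact_cokernel (kernel.ι h ≫ n i)).lift (x ≫ f i)
      (by rw [Category.assoc, hx])
    rw [← cancel_mono (g i ≫ h), zero_comp]
    rw [← (hN i).w, ← Category.assoc, ← Category.assoc, cancel_mono] at hy
    rw [← Category.assoc, ← hy, Category.assoc, kernel.condition, comp_zero]
  have := mono_of_mono_hull hI _ h₁
  refine Preadditive.mono_of_kernel_zero ?_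
  rw [← cancel_mono (n i), ← cancel_mono (cokernel.π (kernel.ι h ≫ n i)), zero_comp, zero_comp,
    cokernel.condition]

include D hC

/-- The simple object `L i` occurs only once as a simple factor of the costandard object. -/
theorem fac_cokernel (i : ι) : Fac L (fun m => le m i ∧ m ≠ i) (cokernel (g i)) := by
  have := mono_socle hI hN i
  have := (hN i).mono
  have hfac : Fac L (fun m => le m i) (cokernel (g i)) :=
    hC.fac_of_epi (hN i).fac (cokernel.π (g i))
  obtain ⟨R, u, t, ht, hR⟩ := D.top i
  obtain ⟨K, P, v, p, hp, hP, hK⟩ := D.exists_projective i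
  have := ht.epi
  have := hp.epi
  have h₁ (φ : Δ i ⟶ cokernel (g i)) : φ = 0 := by
    obtain ⟨ψ, hψ⟩ := (D.extVanishes (s := (· = i)) (fun _ h _ => h) (hC.fac_simple rfl)).lift
      (abelianExact_cokernel (g i)) φ
    obtain ⟨a, ha⟩ := ht.desc ψ (hR.hom_eq_zero' (fun m hm =>
      hom_costandard_eq_zero hI hN hm.2) _)
    obtain ⟨b, hb⟩ := exists_factor_hull hI (a ≫ n i)
    have hab : b ≫ g i = a := by
      rw [← cancel_mono (n i), Category.assoc, (hN i).w, hb]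
    rw [← hψ, ← ha, ← hab, Category.assoc, Category.assoc, cokernel.condition, comp_zero, comp_zero]
  refine hC.fac fun l hl φ => ?_
  by_cases h : le l i
  · obtain rfl : l = i := by
      by_contra h'
      exact hl ⟨h, h'⟩
    have := hC.projective l
    have := hC.epi l
    let π : P ⟶ C l := Projective.factorThru (p ≫ t) (c l)
    have : Epi π := hC.superfluous l π (by rw [Projective.factorThru_comp]; infer_instance)
    obtain ⟨s, hs⟩ := hp.desc (π ≫ φ) (hK.hom_eq_zero (fun Z hZ a => by
      obtain ⟨m, h₁, h₂, rfl⟩ := hZ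
      exact hfac.hom_eq_zero (fun j hj => D.hom_eq_zero m j fun h =>
        h₂ (D.antisymm _ _ (h ▸ hj) h₁)) a) _)
    rw [← cancel_epi π, ← hs, h₁ s, comp_zero, comp_zero]
  · exact hC.hom_eq_zero_of_fac hfac h φ

/-- `Ext¹(Δ l, N i) = 0`. If `l ≼ i`, extensions split because `N i` is the largest subobject of an
injective object with small simple factors; otherwise by the corresponding property of `Δ l`. -/
theorem extVanishes_costandard (l i : ι) : ExtVanishes (abelianExact A) (Δ l) (N i) := by
  have := injective hI i
  have := (hN i).mono
  by_cases h : le l i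
  · rintro ⟨M, j, q, hM⟩
    have := hM.mono
    obtain ⟨s, hs⟩ := (hN i).lift (Injective.factorThru (n i) j) (hC.fac_of_confl hM (hN i).fac
      (hC.fac_mono (fun m hm => D.trans _ _ _ hm h) (D.fac l hC)))
    exact hM.exists_section_of_retraction (r := s) (by
      rw [← cancel_mono (n i), Category.assoc, hs, Injective.comp_factorThru, Category.id_comp])
  · exact D.extVanishes (fun m hm hlm => absurd (D.trans _ _ _ hlm hm) h) (hN i).fac

/-- A form of the vanishing of second extensions of costandard by standard objects. -/
theorem extVanishes_of_confl {i : ι} {X Z : A} {a : N i ⟶ X} {b : X ⟶ Z}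
    (hc : (abelianExact A).Confl a b) (hX : ∀ l, ExtVanishes (abelianExact A) (Δ l) X) (l : ι) :
    ExtVanishes (abelianExact A) (Δ l) Z := by
  obtain ⟨K, P, v, p, hp, hP, hK⟩ := D.exists_projective l
  have := hp.epi
  rintro ⟨M, j, q, hM⟩
  have := hM.epi
  obtain ⟨x, hx⟩ := hM.lift (v ≫ Projective.factorThru p q) (by
    rw [Category.assoc, Projective.factorThru_comp, hp.w])
  have hKN : ExtVanishes (abelianExact A) K (N i) := hK.extVanishes_left fun Y hY => by
    obtain ⟨m, -, -, rfl⟩ := hY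
    exact D.extVanishes_costandard hC hI hN m i
  obtain ⟨y, hy⟩ := hKN.lift hc x
  obtain ⟨z, hz⟩ := (hX l).extend hp y
  obtain ⟨s, hs⟩ := hp.desc (Projective.factorThru p q - z ≫ b ≫ j) (by
    rw [Preadditive.comp_sub, ← hx, ← hy, reassoc_of% hz, Category.assoc, sub_self])
  refine ⟨s, ?_⟩
  rw [← cancel_epi p, reassoc_of% hs, Preadditive.sub_comp, Projective.factorThru_comp,
    Category.assoc, Category.assoc, hM.w, comp_zero, comp_zero, sub_zero, Category.comp_id]

/-- An object `X` with `Ext¹(Δ l, X) = 0` for all `l` is filtered by costandard objects `N l`, where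
moreover `Hom(Δ l, X) ≠ 0`. If `j` is minimal such that `L j` embeds into `X`, then the embedding
extends to an embedding of `N j`, and the quotient inherits the vanishing. -/
theorem extClosure_of_extVanishes [Finite ι] {X : A}
    (hX : ∀ l, ExtVanishes (abelianExact A) (Δ l) X) :
    ExtClosure (abelianExact A) (fun Y => ∃ l, (∃ a : Δ l ⟶ X, a ≠ 0) ∧ Y = N l) X := by
  obtain ⟨d, hd⟩ := D.exists_length
  induction hdX : d X using Nat.strong_induction_on generalizing X with
  | _ k ih =>
  by_cases hX0 : IsZero X
  · exact .zero hX0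
  have hne : ∃ j, ∃ a : L j ⟶ X, a ≠ 0 := by
    obtain ⟨Z, a, ha, hZ⟩ := hd.exists_simple_subobject hX0
    obtain ⟨j, ⟨e⟩⟩ := D.exists_iso Z hZ
    refine ⟨j, e.inv ≫ a, fun h => Simple.not_isZero Z ((IsZero.iff_id_eq_zero _).2 ?_)⟩
    rw [← cancel_mono a, ← cancel_epi e.inv, Category.id_comp, h]
    simp
  -- Choose a minimal `j` such that `L j` embeds into `X`.
  have hwf : WellFounded fun i j => le i j ∧ i ≠ j :=
    haveI : IsTrans ι fun i j => le i j ∧ i ≠ j := ⟨fun i j m h h' =>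
      ⟨D.trans _ _ _ h.1 h'.1, fun h'' => h.2 (D.antisymm _ _ h.1 (h'' ▸ h'.1))⟩⟩
    haveI : Std.Irrefl fun i j => le i j ∧ i ≠ j := ⟨fun i h => h.2 rfl⟩
    Finite.wellFounded_of_trans_of_irrefl _
  obtain ⟨j, ⟨a, ha⟩, hj⟩ := hwf.has_min {j | ∃ a : L j ⟶ X, a ≠ 0} hne
  have hmin (m : ι) (h : le m j) (h' : m ≠ j) (b : L m ⟶ X) : b = 0 := by
    by_contra hb
    exact hj m ⟨b, hb⟩ ⟨h, h'⟩
  have hL (m : ι) (h : le m j) (h' : m ≠ j) : ExtVanishes (abelianExact A) (L m) X := by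
    obtain ⟨R, u, t, ht, hR⟩ := D.top m
    have := ht.epi
    rintro ⟨M, i, q, hM⟩
    obtain ⟨x, hx⟩ := (hX m).lift hM t
    obtain ⟨y, hy⟩ := hM.lift (u ≫ x) (by rw [Category.assoc, hx, ht.w])
    obtain ⟨s, hs⟩ := ht.desc x (by
      rw [← hy, hR.hom_eq_zero' (fun l hl => hmin l (D.trans _ _ _ hl.1 h) fun h'' =>
        hl.2 (D.antisymm _ _ hl.1 (h'' ▸ h))) y, zero_comp])
    exact ⟨s, by rw [← cancel_epi t, reassoc_of% hs, hx, Category.comp_id]⟩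
  have := mono_socle hI hN j
  have := D.simple j
  obtain ⟨b, hb⟩ := ((D.fac_cokernel hC hI hN j).extVanishes fun m hm => hL m hm.1 hm.2).extend
    (abelianExact_cokernel (g j)) a
  have : Mono a := mono_of_nonzero_from_simple ha
  have : Mono b := mono_of_mono_socle hI hN b (by rwa [hb])
  have hc := abelianExact_cokernel b
  have hZ := D.extVanishes_of_confl hC hI hN hc hX
  have hdj : d (N j) ≠ 0 := fun h => ha (by
    rw [← hb, (hd.isZero h).eq_of_src b 0, comp_zero])
  obtain ⟨R, u, t, ht, -⟩ := D.top j
  have := ht.epi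
  refine .ext hc (.of ⟨j, ⟨t ≫ a, fun h => ha ?_⟩, rfl⟩) ((ih _ ?_ hZ rfl).mono fun Y hY => ?_)
  · rw [← cancel_epi t, h, comp_zero]
  · have := hd.additive hc
    omega
  · obtain ⟨l, ⟨x, hx⟩, rfl⟩ := hY
    obtain ⟨y, hy⟩ := (D.extVanishes_costandard hC hI hN l j).lift hc x
    exact ⟨l, ⟨y, fun h => hx (by rw [← hy, h, zero_comp])⟩, rfl⟩

end

theorem extVanishes_of_injective {X J : A} [Injective J] : ExtVanishes (abelianExact A) X J := by
  rintro ⟨M, j, q, hM⟩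
  have := hM.mono
  exact hM.exists_section_of_retraction (Injective.comp_factorThru (𝟙 J) j)

include D in
/-- The costandard objects form standard data of the opposite category, and injective objects
are filtered by costandard objects. -/
theorem exists_costandardData [Finite ι] : ∃ N : ι → A,
    StandardData Aᵒᵖ le (fun i => Opposite.op (L i)) (fun i => Opposite.op (N i)) ∧
    ∀ X : A, Injective X → ExtClosure (abelianExact A) (fun Y => ∃ l, Y = N l) X := by
  obtain ⟨C, c, hC⟩ := D.exists_isCoverSystem
  obtain ⟨I, f, hI⟩ := D.exists_hulls
  choose N n g hN using D.exists_isLargestSub hC hI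
  refine ⟨N, ⟨D.refl, D.trans, D.antisymm, hI.exists_length, hI.simple, hI.eq_of_iso,
    hI.exists_iso, fun i => ?_, fun i m h a => ?_, fun i => ?_, fun i => ?_⟩, fun X hX => ?_⟩
  · have := mono_socle hI hN i
    refine ⟨_, _, _, abelianExact_confl_op (abelianExact_cokernel (g i)), hI.fac fun l hl a => ?_⟩
    have h := (D.fac_cokernel hC hI hN i).hom_eq_zero' (fun m hm =>
      hom_hull_eq_zero hI (by rintro rfl; exact hl hm)) a.unop
    exact congr(($h).op)
  · exact congr(($(hom_costandard_eq_zero hI hN h a.unop)).op)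
  · have := (hN i).mono
    have hc := abelianExact_cokernel (n i)
    have := injective hI i
    have hZ := D.extVanishes_of_confl hC hI hN hc fun l => extVanishes_of_injective
    refine ⟨_, _, _, _, abelianExact_confl_op hc, inferInstance, ?_⟩
    rw [← abelianExact_op]
    refine (D.extClosure_of_extVanishes hC hI hN hZ).op.mono fun Y hY => ?_
    obtain ⟨l, ⟨x, hx⟩, hY⟩ := hY
    obtain ⟨y, hy⟩ := (D.extVanishes_costandard hC hI hN l i).lift hc x
    have hy0 : y ≠ 0 := fun h => hx (by rw [← hy, h, zero_comp])
    refine ⟨l, by_contra fun hl => hy0 ?_, ?_, congr(Opposite.op $hY)⟩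
    · exact (D.fac l hC).hom_eq_zero' (fun m hm => hom_hull_eq_zero hI
        (by rintro rfl; exact hl hm)) y
    · rintro rfl
      obtain ⟨s, hs⟩ := (hN l).lift y (D.fac l hC)
      exact hx (by rw [← hy, ← hs, Category.assoc, hc.w, comp_zero])
  · have := hC.projective i
    have := hC.epi i
    exact ⟨Opposite.op (C i), (c i).op, inferInstance, inferInstance⟩
  · exact (D.extClosure_of_extVanishes hC hI hN fun l => extVanishes_of_injective).mono
      fun Y ⟨l, _, h⟩ => ⟨l, h⟩

end StandardData

end Costandard

/-! ### Highest weight structures from standard data -/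

section Uniqueness

variable {A : Type u} [Category.{v} A] [Abelian A] {ι : Type w₁} {le : ι → ι → Prop} {L : ι → A}

theorem IsProjectiveCover.exists_epi {P P' X : A} (h : IsProjectiveCover P X)
    (h' : IsProjectiveCover P' X) : ∃ a : P ⟶ P', Epi a := by
  obtain ⟨hP, p, hp, -⟩ := h
  obtain ⟨hP', p', hp', hs⟩ := h'
  exact ⟨Projective.factorThru p p', hs _ (by rwa [Projective.factorThru_comp])⟩

theorem IsStandard.exists_epi {i : ι} {X Y : A} (h : IsStandard le L i X)
    (h' : IsStandard le L i Y) : ∃ a : X ⟶ Y, Epi a := by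
  obtain ⟨P, q, hP, hq, -, hX⟩ := h
  obtain ⟨P', q', hP', hq', hY, -⟩ := h'
  obtain ⟨a, ha⟩ := hP.exists_epi hP'
  obtain ⟨s, hs⟩ := hX (a ≫ q') (epi_comp _ _) hY
  have : Epi (q ≫ s) := by
    rw [hs]
    exact epi_comp _ _
  exact ⟨s, epi_of_epi q s⟩

/-- Standard objects are unique up to isomorphism. -/
theorem IsStandard.exists_iso {d : A → ℕ} (hd : IsLength d) {i : ι} {X Y : A}
    (h : IsStandard le L i X) (h' : IsStandard le L i Y) : Nonempty (X ≅ Y) := by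
  obtain ⟨a, ha⟩ := h.exists_epi h'
  obtain ⟨b, hb⟩ := h'.exists_epi h
  have := hd.isIso_of_epi a (hd.le_of_epi b)
  exact ⟨asIso a⟩

/-- By uniqueness of standard objects, `F(Δ)` is generated by any given choice of them. -/
theorem StandardData.standardlyFiltered_iff {Δ : ι → A} (D : StandardData A le L Δ) (X : A) :
    StandardlyFiltered le L X ↔ ExtClosure (abelianExact A) (fun Y => ∃ l, Y = Δ l) X := by
  obtain ⟨d, hd⟩ := D.exists_length
  refine ⟨fun h => h.bind fun Y ⟨l, hl⟩ => ?_, fun h => h.mono fun Y ⟨l, hl⟩ => ⟨l, ?_⟩⟩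
  · obtain ⟨e⟩ := (D.isStandard l).exists_iso hd hl
    exact .of_iso e (.of ⟨l, rfl⟩)
  · exact hl ▸ D.isStandard l

end Uniqueness

section DoubleOp

variable {A : Type u} [Category.{v} A] [Abelian A] {ι : Type w₁} {le : ι → ι → Prop}

theorem Fac.unop_unop {L : ι → Aᵒᵖᵒᵖ} {s : ι → Prop} {X : Aᵒᵖᵒᵖ} (h : Fac L s X) :
    Fac (fun i => (L i).unop.unop) s X.unop.unop := by
  induction h with
  | zero h => exact .zero h.unop.unop
  | step h _ hZ ih =>
    obtain ⟨m, hm, ⟨e⟩⟩ := hZ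
    exact .step (abelianExact_confl_unop (abelianExact_confl_unop h)) ih ⟨m, hm, ⟨e.unop.unop⟩⟩

theorem StandardData.unop_unop {L Δ : ι → Aᵒᵖᵒᵖ} (D : StandardData Aᵒᵖᵒᵖ le L Δ) :
    StandardData A le (fun i => (L i).unop.unop) (fun i => (Δ i).unop.unop) where
  refl := D.refl
  trans := D.trans
  antisymm := D.antisymm
  exists_length := by
    obtain ⟨d, hd⟩ := D.exists_length
    exact ⟨fun X => d (Opposite.op (Opposite.op X)), fun h =>
      hd.additive (abelianExact_confl_op (abelianExact_confl_op h)), fun h =>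
      (hd.isZero h).unop.unop⟩
  simple i := by
    have := D.simple i
    have := simple_unop (L i)
    exact simple_unop _
  eq_of_iso i j h := D.eq_of_iso i j (h.map fun e => e.op.op)
  exists_iso X _ := by
    have := simple_op X
    obtain ⟨i, ⟨e⟩⟩ := D.exists_iso (Opposite.op (Opposite.op X)) (simple_op _)
    exact ⟨i, ⟨e.unop.unop⟩⟩
  top i := by
    obtain ⟨R, u, t, h, hR⟩ := D.top i
    exact ⟨_, _, _, abelianExact_confl_unop (abelianExact_confl_unop h), hR.unop_unop⟩
  hom_eq_zero i m h f := congr(($(D.hom_eq_zero i m h f.op.op)).unop.unop)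
  exists_projective i := by
    obtain ⟨K, P, u, p, h, hP, hK⟩ := D.exists_projective i
    refine ⟨_, _, _, _, abelianExact_confl_unop (abelianExact_confl_unop h), inferInstance, ?_⟩
    rw [← abelianExact_op, ← abelianExact_op] at hK
    exact hK.unop.unop.mono fun Y ⟨l, h₁, h₂, h₃⟩ => ⟨l, h₁, h₂, congr(($h₃).unop.unop)⟩
  exists_injective i := by
    obtain ⟨J, f, hJ, hf⟩ := D.exists_injective i
    exact ⟨_, f.unop.unop, inferInstance, inferInstance⟩

/-- If costandard objects are known, then standard objects exist, and projective objects are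
filtered by them. -/
theorem StandardData.exists_standardData [Finite ι] {L N : ι → Aᵒᵖ}
    (D : StandardData Aᵒᵖ le L N) : ∃ Δ : ι → A,
    StandardData A le (fun i => (L i).unop) Δ ∧
    ∀ X : A, Projective X → ExtClosure (abelianExact A) (fun Y => ∃ l, Y = Δ l) X := by
  obtain ⟨Δ, hΔ, h⟩ := D.exists_costandardData
  refine ⟨fun i => (Δ i).unop, hΔ.unop_unop, fun X hX => ?_⟩
  have := h (Opposite.op X) inferInstance
  rw [← abelianExact_op] at this
  exact this.unop.mono fun Y ⟨l, hl⟩ => ⟨l, congr(($hl).unop)⟩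

end DoubleOp

section HighestWeight

variable {A : Type u} [Category.{v} A] [Abelian A] {ι : Type w₁} {le : ι → ι → Prop} {L Δ : ι → A}
  (k : Type w) [Field k] [Linear k A]

theorem HasFiltration.mono {P Q : ObjectProperty A} (h : ∀ X, P X → Q X) {X : A}
    (hX : HasFiltration (abelianExact A) P X) : HasFiltration (abelianExact A) Q X := by
  induction hX with
  | zero h => exact .zero h
  | step hc _ hZ ih => exact .step hc ih (h _ hZ)

variable {k}

/-- If there are enough projectives, each extension of `X` by `Y` is the pushout of a fixed
conflation `K ⟶ Q ⟶ X` along a morphism `K ⟶ Y`; thus generators of the vector space of these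
morphisms yield generators of `Ext¹(X, Y)`. -/
theorem isExtFinite_of_enoughProjectives (h : IsHomFinite k A)
    (hproj : ∀ X : A, ∃ (Q : A) (p : Q ⟶ X), Projective Q ∧ Epi p) :
    IsExtFinite k (abelianExact A) := by
  intro X Y
  obtain ⟨Q, p, hQ, hp⟩ := hproj X
  have hK := abelianExact_kernel p
  have := h (kernel p) Y
  obtain ⟨n, s, hs⟩ := Module.Finite.exists_fin (R := k) (M := (kernel p ⟶ Y))
  choose M f' i d hp' hc hd using fun g : kernel p ⟶ Y => hK.exists_pushout g
  refine ⟨n, fun j => ⟨M (s j), i _, d _, hc _⟩, ?_⟩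
  rintro ⟨E, i', d', hE⟩
  have := hE.epi
  obtain ⟨g, hg⟩ := hE.lift (kernel.ι p ≫ Projective.factorThru p d') (by
    rw [Category.assoc, Projective.factorThru_comp, kernel.condition])
  obtain ⟨a, ha⟩ := (Submodule.mem_span_range_iff_exists_fun k).1
    (hs ▸ Submodule.mem_top : g ∈ Submodule.span k (Set.range s))
  obtain ⟨N, fN, iN, dN, hpN, hcN, hdN⟩ := hK.exists_pushout (biproduct.lift s)
  have key {W : A} {i₁ : Y ⟶ W} {d₁ : W ⟶ X} (h₁ : (abelianExact A).Confl i₁ d₁)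
      (b : (⨁ fun _ : Fin n => Y) ⟶ Y) (f₁ : Q ⟶ W) (hf : f₁ ≫ d₁ = p)
      (h₂ : kernel.ι p ≫ f₁ = (biproduct.lift s ≫ b) ≫ i₁) :
      Extension.IsPushforward b (⟨N, iN, dN, hcN⟩ : Extension (abelianExact A) X _)
        ⟨W, i₁, d₁, h₁⟩ := by
    refine ⟨hpN.desc f₁ (b ≫ i₁) (by rw [h₂, Category.assoc]), hpN.inr_desc _ _ _,
      hpN.hom_ext ?_ ?_⟩
    · rw [hpN.inl_desc_assoc, hf, hdN]
    · rw [hpN.inr_desc_assoc, Category.assoc, h₁.w, comp_zero, hcN.w]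
  refine ⟨a, ⟨N, iN, dN, hcN⟩, fun j => key _ _ (f' (s j)) (hd _) ?_,
    key hE _ (Projective.factorThru p d') (Projective.factorThru_comp _ _) ?_⟩
  · rw [(hp' (s j)).w, biproduct.lift_π]
  · rw [← hg, ← ha, biproduct.lift_desc]
    simp [Linear.comp_smul]

theorem projective_biproduct {J : Type w₂} [Finite J] (P : J → A) [∀ j, Projective (P j)] :
    Projective (⨁ P) where
  factors f e _ := ⟨biproduct.desc fun j => Projective.factorThru (biproduct.ι P j ≫ f) e,
    biproduct.hom_ext' _ _ fun j => by simp⟩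

/-- The sum of the projective covers of the simple objects is a projective generator. -/
theorem StandardData.isDeligneFinite [Finite ι] (D : StandardData A le L Δ)
    (h : IsHomFinite k A) : IsDeligneFinite k A := by
  obtain ⟨C, c, hC⟩ := D.exists_isCoverSystem
  have := hC.projective
  have hgen (X : A) : ∃ (n : ℕ) (f : (⨁ fun _ : Fin n => ⨁ C) ⟶ X), Epi f := by
    have := h (⨁ C) X
    obtain ⟨n, s, hs⟩ := Module.Finite.exists_fin (R := k) (M := (⨁ C ⟶ X))
    refine ⟨n, biproduct.desc s, Preadditive.epi_of_cokernel_zero ?_⟩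
    refine (hC.isZero fun l φ => ?_).eq_of_tgt _ _
    let ψ := Projective.factorThru φ (cokernel.π (biproduct.desc s))
    have hψ : ψ ≫ cokernel.π (biproduct.desc s) = φ := Projective.factorThru_comp _ _
    obtain ⟨a, ha⟩ := (Submodule.mem_span_range_iff_exists_fun k).1
      (hs ▸ Submodule.mem_top : biproduct.π C l ≫ ψ ∈ Submodule.span k (Set.range s))
    have h₁ : biproduct.π C l ≫ ψ ≫ cokernel.π (biproduct.desc s) = 0 := by
      have : biproduct.π C l ≫ ψ =
          (∑ j, a j • biproduct.ι (fun _ : Fin n => ⨁ C) j) ≫ biproduct.desc s := by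
        rw [← ha, Preadditive.sum_comp]
        simp
      rw [reassoc_of% this, cokernel.condition, comp_zero]
    rw [← hψ, ← Category.id_comp (ψ ≫ _), ← biproduct.ι_π_self C l, Category.assoc, h₁, comp_zero]
  refine ⟨h, isExtFinite_of_enoughProjectives h fun X => ?_, ?_, fun X => ?_, ⨁ C,
    projective_biproduct C, hgen⟩
  · obtain ⟨n, f, hf⟩ := hgen X
    have := projective_biproduct C
    exact ⟨_, f, projective_biproduct _, hf⟩
  · refine Finite.of_surjective (fun i => ⟦⟨L i, D.simple i⟩⟧) fun q => ?_
    induction q using Quotient.inductionOn with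
    | h X =>
      obtain ⟨i, ⟨e⟩⟩ := D.exists_iso X.obj X.property
      exact ⟨i, Quotient.sound ⟨ObjectProperty.isoMk _ e.symm⟩⟩
  · refine (hC.fac (s := fun _ => True) fun i hi => absurd trivial hi).mono fun Y hY => ?_
    obtain ⟨m, -, ⟨e⟩⟩ := hY
    have := D.simple m
    exact Simple.of_iso e

/-- `Δ i` has scalar endomorphisms, because its simple quotient has, and does not occur among the
other simple factors. -/
theorem StandardData.exists_eq_smul_id [IsAlgClosed k] (D : StandardData A le L Δ)
    (h : IsHomFinite k A) (i : ι) (f : Δ i ⟶ Δ i) : ∃ a : k, f = a • 𝟙 (Δ i) := by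
  obtain ⟨C, c, hC⟩ := D.exists_isCoverSystem
  obtain ⟨R, u, t, ht, hR⟩ := D.top i
  obtain ⟨b, hb⟩ := ht.desc (f ≫ t)
    (hR.hom_eq_zero' (fun m hm => hC.simple_hom_eq_zero hm.2.symm) _)
  have := D.simple i
  have := h (L i) (L i)
  obtain ⟨a, ha⟩ := endomorphism_simple_eq_smul_id k b
  obtain ⟨x, hx⟩ := ht.lift (f - a • 𝟙 (Δ i)) (by
    rw [Preadditive.sub_comp, ← hb, ← ha, Linear.smul_comp, Category.id_comp, Linear.comp_smul,
      Category.comp_id, sub_self])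
  refine ⟨a, sub_eq_zero.1 ?_⟩
  rw [← hx, hR.hom_eq_zero (fun m hm => D.hom_eq_zero i m hm.2) x, zero_comp]

theorem StandardData.isHighestWeight [IsAlgClosed k] [Finite ι] (D : StandardData A le L Δ)
    (h : IsHomFinite k A)
    (hproj : ∀ X : A, Projective X → ExtClosure (abelianExact A) (fun Y => ∃ l, Y = Δ l) X) :
    IsHighestWeight le L k where
  deligneFinite := D.isDeligneFinite h
  partialOrder :=
    { refl := D.refl
      trans := D.trans
      antisymm := D.antisymm }
  simple := D.simple
  eq_of_iso := D.eq_of_iso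
  exists_iso := D.exists_iso
  st1 i X hX := by
    obtain ⟨d, hd⟩ := D.exists_length
    obtain ⟨C, c, hC⟩ := D.exists_isCoverSystem
    obtain ⟨e⟩ := hX.exists_iso hd (D.isStandard i)
    have h0 : ¬ IsZero X := fun h0 => by
      obtain ⟨R, u, t, ht, -⟩ := D.top i
      have := ht.epi
      have := D.simple i
      exact Simple.not_isZero (L i) ((IsZero.iff_id_eq_zero _).2 (by
        rw [← cancel_epi t, ← cancel_epi e.hom, h0.eq_of_src (e.hom ≫ t ≫ 𝟙 (L i))]))
    have hbij : Function.Bijective (Algebra.ofId k (End X)) := by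
      have : Nontrivial (End X) :=
        ⟨𝟙 X, 0, fun h1 => h0 ((IsZero.iff_id_eq_zero _).2 h1)⟩
      refine ⟨(Algebra.ofId k (End X)).toRingHom.injective, fun f => ?_⟩
      obtain ⟨a, ha⟩ := D.exists_eq_smul_id h i (e.inv ≫ f ≫ e.hom)
      refine ⟨a, ?_⟩
      have h₁ : f = a • 𝟙 X := by
        rw [← cancel_mono e.hom, ← cancel_epi e.inv, ha]
        simp
      rw [h₁]
      exact Algebra.algebraMap_eq_smul_one a
    exact ⟨(AlgEquiv.ofBijective _ hbij).symm⟩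
  st2 i P hP := (D.standardlyFiltered_iff P).2 (hproj P hP.1)

end HighestWeight

/-! ### Exact and standard structures under realizations -/

section RealizationProperties

variable {C : Type u} [Category.{v} C] [Preadditive C] [HasFiniteBiproducts C]
variable {A : Type u'} [Category.{v'} A] [Abelian A]
variable {S : ExactStructure C} {F : C ⥤ A} (hF : IsRealization S F)
variable {k : Type w} [Field k] [Linear k C] [Linear k A]

include hF

/-- Morphisms in the abelian category are controlled by those between the covering objects. -/
theorem IsRealization.isHomFinite [F.Linear k] (h : IsHomFinite k C) : IsHomFinite k A := by
  intro X Y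
  have := hF.additive
  have := hF.full
  obtain ⟨Q, p, hQ, hp⟩ := hF.covers X
  obtain ⟨Q', p', hQ', hp'⟩ := hF.covers Y
  have := h Q Q'
  have h₁ : Module.Finite k (F.obj Q ⟶ F.obj Q') :=
    Module.Finite.of_surjective (F.mapLinearMap k) F.map_surjective
  have h₂ : Module.Finite k (F.obj Q ⟶ Y) :=
    Module.Finite.of_surjective (Linear.rightComp k (F.obj Q) p') fun f =>
      ⟨Projective.factorThru f p', Projective.factorThru_comp f p'⟩
  exact Module.Finite.of_injective (Linear.leftComp k Y p) fun f g hfg => (cancel_epi p).1 hfg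

/-- A realization preserves projective objects. -/
theorem IsRealization.projective {Q : C} (hQ : ∀ X, ExtVanishes S Q X) :
    Projective (F.obj Q) := by
  obtain ⟨K, Q', i, d, hc, hQ'⟩ := hF.enough Q
  obtain ⟨s, hs⟩ := (hQ K).exists_section hc
  refine ⟨fun {X Y} f e _ => ⟨F.map s ≫ Projective.factorThru (F.map d ≫ f) e, ?_⟩⟩
  rw [Category.assoc, Projective.factorThru_comp, ← F.map_comp_assoc, hs, F.map_id,
    Category.id_comp]

theorem IsRealization.extClosure {P : ObjectProperty C} {X : C} (hX : ExtClosure S P X) :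
    ExtClosure (abelianExact A) (fun Y => ∃ Z, P Z ∧ Y = F.obj Z) (F.obj X) := by
  have := hF.additive
  induction hX with
  | of h => exact .of ⟨_, h, rfl⟩
  | zero h => exact .zero (F.map_isZero h)
  | ext hc _ _ h₁ h₂ => exact .ext (hF.exact hc) h₁ h₂

/-- The essential image of a realization is closed under extensions, and the extensions come from
conflations. -/
theorem IsRealization.exists_confl {X Z : C} {M : A} {f : F.obj X ⟶ M} {g : M ⟶ F.obj Z}
    (h : (abelianExact A).Confl f g) : ∃ (Y : C) (i : X ⟶ Y) (d : Y ⟶ Z) (e : F.obj Y ≅ M),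
      S.Confl i d ∧ F.map i ≫ e.hom = f ∧ e.hom ≫ g = F.map d := by
  have := hF.full
  have := hF.faithful
  have := hF.additive
  have := h.epi
  obtain ⟨K, Q, i, d, hc, hQ⟩ := hF.enough Z
  have hc' := hF.exact hc
  obtain ⟨a, ha⟩ := h.lift (F.map i ≫ Projective.factorThru (F.map d) g) (by
    rw [Category.assoc, Projective.factorThru_comp, hc'.w])
  obtain ⟨Y, f', i', d', hp, hc₁, hd⟩ := hc.exists_pushout (F.preimage a)
  -- `M` and `F Y` are both pushouts of `F Q` along `a`
  obtain ⟨u, hu₁, hu₂⟩ := hc'.pushout_desc (hF.exact hc₁) (f := a) (m := F.map f')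
    (by rw [← F.map_comp, hp.w, F.map_comp, F.map_preimage])
    (by rw [← F.map_comp, hd]) (Projective.factorThru (F.map d) g) f ha.symm
  have hug : u ≫ g = F.map d' := by
    have hext {W : A} (x y : F.obj Y ⟶ W) (h₁ : F.map f' ≫ x = F.map f' ≫ y)
        (h₂ : F.map i' ≫ x = F.map i' ≫ y) : x = y := by
      obtain ⟨w, hw⟩ := (hF.exact hc₁).desc (x - y) (by rw [Preadditive.comp_sub, h₂, sub_self])
      have := hc'.epi
      have hw0 : w = 0 := by
        rw [← cancel_epi (F.map d), ← hd, F.map_comp, Category.assoc, hw, Preadditive.comp_sub, h₁,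
          sub_self, comp_zero]
      rw [← sub_eq_zero, ← hw, hw0, comp_zero]
    refine hext _ _ ?_ ?_
    · rw [reassoc_of% hu₁, Projective.factorThru_comp, ← F.map_comp, hd]
    · rw [reassoc_of% hu₂, h.w, (hF.exact hc₁).w]
  obtain ⟨w₁, hs₁⟩ := hF.exact hc₁
  obtain ⟨w₂, hs₂⟩ := h
  let φ : ShortComplex.mk _ _ w₁ ⟶ ShortComplex.mk _ _ w₂ :=
    { τ₁ := 𝟙 _, τ₂ := u, τ₃ := 𝟙 _, comm₁₂ := by simp [hu₂], comm₂₃ := by simp [hug] }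
  have h₁ : IsIso φ.τ₁ := inferInstanceAs (IsIso (𝟙 _))
  have h₃ : IsIso φ.τ₃ := inferInstanceAs (IsIso (𝟙 _))
  have : IsIso u := ShortComplex.isIso₂_of_shortExact_of_isIso₁₃ φ hs₁ hs₂
  exact ⟨Y, i', d', asIso u, hc₁, hu₂, hug⟩

/-- A realization reflects conflations. -/
theorem IsRealization.confl_iff {X Y Z : C} (i : X ⟶ Y) (d : Y ⟶ Z) :
    S.Confl i d ↔ (abelianExact A).Confl (F.map i) (F.map d) := by
  have := hF.full
  have := hF.faithful
  refine ⟨hF.exact, fun h => ?_⟩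
  obtain ⟨Y', i', d', e, hc, h₁, h₂⟩ := hF.exists_confl h
  refine S.confl_of_iso (Iso.refl _) (F.preimageIso e) (Iso.refl _) ?_ ?_ hc
  · exact F.map_injective (by simp [h₁])
  · exact F.map_injective (by simp [h₂])

/-- A realization identifies the exact category with the extension closure of the images of
objects that generate it. -/
theorem IsRealization.inducesExactEquivalence {P : ObjectProperty C} {Q : ObjectProperty A}
    (hgen : ∀ X, ExtClosure S P X)
    (hQ : ∀ X, Q X ↔ ExtClosure (abelianExact A) (fun Y => ∃ Z, P Z ∧ Y = F.obj Z) X) :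
    InducesExactEquivalence S F Q where
  mem X := (hQ _).2 (hF.extClosure (hgen X))
  confl_iff := hF.confl_iff
  isEquivalence := by
    have := hF.full
    have := hF.faithful
    have := hF.additive
    refine ⟨inferInstance, inferInstance, ⟨fun ⟨X, hX⟩ => ?_⟩⟩
    suffices ∃ Y, Nonempty (F.obj Y ≅ X) by
      obtain ⟨Y, ⟨e⟩⟩ := this
      exact ⟨Y, ⟨ObjectProperty.isoMk _ e⟩⟩
    rw [hQ] at hX
    induction hX with
    | of h =>
      obtain ⟨Z, -, rfl⟩ := h
      exact ⟨Z, ⟨Iso.refl _⟩⟩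
    | zero h =>
      exact ⟨0, ⟨(F.map_isZero (isZero_zero C)).iso h⟩⟩
    | ext hc _ _ h₁ h₂ =>
      obtain ⟨Y₁, ⟨e₁⟩⟩ := h₁
      obtain ⟨Y₂, ⟨e₂⟩⟩ := h₂
      obtain ⟨Y, -, -, e, -⟩ := hF.exists_confl ((hc.precomp_iso e₁).postcomp_iso e₂.symm)
      exact ⟨Y, ⟨e⟩⟩

end RealizationProperties

section Standard

variable {C : Type u} [Category.{v} C] [Preadditive C] [HasFiniteBiproducts C]
variable {A : Type u'} [Category.{v'} A] [Abelian A]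
variable {S : ExactStructure C} {F : C ⥤ A}
variable {k : Type w} [Field k] [Linear k C] {ι : Type w₁} [Finite ι] {Ob : ι → C}
  {r : ι → ι → Prop}

theorem eq_zero_of_isSummandOfPower [F.Additive] {P Q : C} (h : IsSummandOfPower P Q) {X : A}
    (hP : ∀ f : F.obj P ⟶ X, f = 0) (f : F.obj Q ⟶ X) : f = 0 := by
  obtain ⟨J, _, a, b, hab⟩ := h
  rw [← Category.id_comp f, ← F.map_id, ← hab, F.map_sum, Preadditive.sum_comp]
  exact Finset.sum_eq_zero fun j _ => by
    rw [F.map_comp, Category.assoc, hP (F.map (b j) ≫ f), comp_zero]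

/-- In a `Hom`-finite abelian category, the dimensions of the spaces of morphisms from a projective
object that detects zero objects form a length function. -/
theorem isLength_finrank [Linear k A] (h : IsHomFinite k A) (P : A) [Projective P]
    (hP : ∀ X : A, (∀ f : P ⟶ X, f = 0) → IsZero X) :
    IsLength fun X : A => Module.finrank k (P ⟶ X) where
  isZero {X} hX := by
    have := h P X
    have := Module.finrank_zero_iff.1 hX
    exact hP X fun f => Subsingleton.elim _ _
  additive {X Y Z f g} hc := by
    have := h P X
    have := h P Y
    have := h P Z
    have := hc.mono
    have := hc.epi
    have h₁ := LinearMap.finrank_range_add_finrank_ker (Linear.rightComp k P g)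
    have h₂ : LinearMap.range (Linear.rightComp k P g) = ⊤ := LinearMap.range_eq_top.2 fun x =>
      ⟨Projective.factorThru x g, Projective.factorThru_comp x g⟩
    have h₃ : LinearMap.ker (Linear.rightComp k P g) =
        LinearMap.range (Linear.rightComp k P f) := by
      ext x
      refine ⟨fun hx => hc.lift x hx, ?_⟩
      rintro ⟨y, rfl⟩
      change (y ≫ f) ≫ g = 0
      rw [Category.assoc, hc.w, comp_zero]
    have h₄ := LinearMap.finrank_range_of_inj (f := Linear.rightComp k P f)
      fun x y hxy => (cancel_mono f).1 hxy
    rw [h₃, h₂, h₄, finrank_top] at h₁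
    omega

/-- Under a realization, the members of an exceptional family become standard objects. The order is
reversed: the projective object over `Ob i` is filtered by the `Ob l` with `l` smaller than `i`.
The simple object `L i` is a simple quotient of `F (Ob i)`, and it is the only one, since the
projective object over `Ob i` has no nonzero morphisms to the kernel. -/
theorem ExceptionalFamily.exists_standardData (D : ExceptionalFamily k S Ob r)
    (hF : IsRealization S F) [Linear k A] [F.Linear k] : ∃ L : ι → A,
      StandardData A (fun l m => r m l) L fun i => F.obj (Ob i) := by
  have := hF.additive
  have := hF.full
  have := hF.faithful
  have := hF.enoughInjectives
  obtain ⟨P, hP, -, hPj⟩ := D.exists_generator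
  choose K Q v d hc hK hQ hsum using hPj
  have hproj (j : ι) : Projective (F.obj (Q j)) := hF.projective (hQ j)
  have hepi (j : ι) : Epi (F.map (d j)) := (hF.exact (hc j)).epi
  have : Projective (F.obj P) := hF.projective hP
  -- Nonzero morphisms between the objects `F (Ob i)`, and from `F (Q i)`.
  have hle {l i : ι} (f : F.obj (Ob l) ⟶ F.obj (Ob i)) (hf : f ≠ 0) : r i l :=
    D.hom i l (F.preimage f) fun h => hf (by rw [← F.map_preimage f, h, F.map_zero])
  have hQ0 (i : ι) {X : A} (h : ∀ m, r m i → ∀ f : F.obj (Ob m) ⟶ X, f = 0)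
      (f : F.obj (Q i) ⟶ X) : f = 0 := by
    have : ExtClosure S (fun Y => ∃ m, r m i ∧ Y = Ob m) (Q i) :=
      .ext (hc i) ((hK i).mono fun Y ⟨l, h₁, _, h₂⟩ => ⟨l, h₁, h₂⟩) (.of ⟨i, D.refl i, rfl⟩)
    refine (hF.extClosure this).hom_eq_zero (fun Y hY => ?_) f
    obtain ⟨_, ⟨m, hm, rfl⟩, rfl⟩ := hY
    exact h m hm
  have hzero {X : A} (h : ∀ i, ∀ f : F.obj (Ob i) ⟶ X, f = 0) : IsZero X := by
    obtain ⟨Q', p, -, hp⟩ := hF.covers X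
    have hp0 : p = 0 := (hF.extClosure (D.gen Q')).hom_eq_zero (fun Y hY => by
      obtain ⟨_, ⟨m, rfl⟩, rfl⟩ := hY
      exact h m) p
    rw [IsZero.iff_id_eq_zero, ← cancel_epi p, hp0, zero_comp, zero_comp]
  have hd := isLength_finrank (hF.isHomFinite D.homFinite) (F.obj P) fun X hX => hzero fun i f => by
    rw [← cancel_epi (F.map (d i)), eq_zero_of_isSummandOfPower (hsum i) hX (F.map (d i) ≫ f),
      comp_zero]
  -- The simple quotients.
  have hne (i : ι) : ¬ IsZero (F.obj (Ob i)) := fun h => D.not_isZero i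
    ((IsZero.iff_id_eq_zero _).2 (F.map_injective (h.eq_of_src _ _)))
  choose U L u t ht hL using fun i => hd.exists_simple_quotient (hne i)
  have hept (i : ι) : Epi (t i) := (ht i).epi
  have ht0 (i : ι) : t i ≠ 0 := fun h => Simple.not_isZero (L i)
    ((IsZero.iff_id_eq_zero _).2 (by rw [← cancel_epi (t i), h, zero_comp, zero_comp]))
  have hU {i m : ι} (hm : r m i) (f : F.obj (Ob m) ⟶ U i) : f = 0 := by
    have := (ht i).mono
    by_contra hf
    have hf' : f ≫ u i ≠ 0 := fun h => hf (by rw [← cancel_mono (u i), h, zero_comp])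
    obtain rfl := D.antisymm m i hm (hle _ hf')
    obtain ⟨a, ha⟩ := D.endo m (F.preimage (f ≫ u m))
    have ha' : f ≫ u m = a • 𝟙 _ := by
      rw [← F.map_preimage (f ≫ u m), ha, F.map_smul, F.map_id]
    have ha0 : a ≠ 0 := fun h => hf' (by rw [ha', h, zero_smul])
    refine ht0 m ?_
    have h₁ : (f ≫ u m) ≫ t m = 0 := by rw [Category.assoc, (ht m).w, comp_zero]
    rw [ha', Linear.smul_comp, Category.id_comp] at h₁
    exact (smul_eq_zero.1 h₁).resolve_left ha0
  have hsup (i : ι) {X : A} (h : X ⟶ F.obj (Ob i)) (hh : h ≫ t i ≠ 0) : Epi h := by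
    have := epi_of_nonzero_to_simple hh
    let s := Projective.factorThru (F.map (d i) ≫ t i) (h ≫ t i)
    have hs : s ≫ h ≫ t i = F.map (d i) ≫ t i := Projective.factorThru_comp _ _
    obtain ⟨x, hx⟩ := (ht i).lift (s ≫ h - F.map (d i)) (by
      rw [Preadditive.sub_comp, Category.assoc, hs, sub_self])
    rw [hQ0 i (fun m hm => hU hm) x, zero_comp, eq_comm, sub_eq_zero] at hx
    have : Epi (s ≫ h) := by rw [hx]; exact hepi i
    exact epi_of_epi s h
  have hhom (i m : ι) (him : m ≠ i) (f : F.obj (Ob i) ⟶ L m) : f = 0 := by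
    by_contra hf
    have hfe := epi_of_nonzero_to_simple hf
    have key {a b : ι} {Y : A} (x : F.obj (Q a) ⟶ Y) (y : F.obj (Ob b) ⟶ Y) [Epi y] (hx : x ≠ 0) :
        r b a := by
      by_contra hba
      refine hx ?_
      rw [← Projective.factorThru_comp x y, hQ0 a (fun l hl g => by_contra fun hg =>
        hba (D.trans _ _ _ (hle g hg) hl)) (Projective.factorThru x y), zero_comp]
    refine him (D.antisymm _ _ (key (F.map (d i) ≫ f) (t m) fun h => hf ?_)
      (key (F.map (d m) ≫ t m) f fun h => ht0 m ?_))
    · rw [← cancel_epi (F.map (d i)), h, comp_zero]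
    · rw [← cancel_epi (F.map (d m)), h, comp_zero]
  have heq (i j : ι) (h : Nonempty (L i ≅ L j)) : i = j := by
    obtain ⟨e⟩ := h
    by_contra hij
    refine ht0 i ?_
    rw [← cancel_mono e.hom, hhom i j (Ne.symm hij) (t i ≫ e.hom), zero_comp]
  have hex (X : A) (hX : Simple X) : ∃ i, Nonempty (X ≅ L i) := by
    obtain ⟨i, f, hf⟩ : ∃ i, ∃ f : F.obj (Ob i) ⟶ X, f ≠ 0 := by
      by_contra! h
      exact Simple.not_isZero X (hzero h)
    have := epi_of_nonzero_to_simple hf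
    by_cases hk : kernel.ι f ≫ t i = 0
    · obtain ⟨s, hs⟩ := (abelianExact_kernel f).desc (t i) hk
      have hs0 : s ≠ 0 := fun h => ht0 i (by rw [← hs, h, comp_zero])
      have := isIso_of_hom_simple hs0
      exact ⟨i, ⟨asIso s⟩⟩
    · have := hsup i _ hk
      exact absurd (by rw [← cancel_epi (kernel.ι f), kernel.condition, comp_zero]) hf
  have hcov (i : ι) : ∃ (P : A) (f : P ⟶ L i), Projective P ∧ Epi f ∧
      ∀ {Y : A} (g : Y ⟶ P), Epi (g ≫ f) → Epi g :=
    hd.exists_projectiveCover (F.map (d i) ≫ t i)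
  choose B c hB hce hcs using hcov
  have hC : IsCoverSystem L B c := ⟨⟨_, hd⟩, hL, heq, hex, hB, hce, hcs⟩
  refine ⟨L, D.refl, fun a b c h h' => D.trans _ _ _ h' h, fun a b h h' => D.antisymm _ _ h' h,
    ⟨_, hd⟩, hL, heq, hex, fun i => ⟨U i, u i, t i, ht i, hC.fac fun l hl φ => ?_⟩, hhom,
    fun i => ⟨_, _, _, _, hF.exact (hc i), hproj i, ?_⟩, fun i =>
    ⟨_, Injective.ι (L i), inferInstance, inferInstance⟩⟩
  · let π : F.obj (Q l) ⟶ B l := Projective.factorThru (F.map (d l) ≫ t l) (c l)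
    have : Epi π := hcs l π (by rw [Projective.factorThru_comp]; infer_instance)
    have hmono := (ht i).mono
    rw [← cancel_epi π, comp_zero]
    refine hQ0 l (fun m hm f => ?_) _
    by_contra hf
    have h₁ : r i m := hle (f ≫ u i) fun h => hf (by rw [← cancel_mono (u i), h, zero_comp])
    have h₂ : r i l := D.trans _ _ _ h₁ hm
    obtain rfl : l = i := by
      by_contra h
      exact hl ⟨h₂, h⟩
    exact hf (hU hm f)
  · refine (hF.extClosure (hK i)).mono fun Y hY => ?_
    obtain ⟨_, ⟨l, h₁, h₂, rfl⟩, rfl⟩ := hY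
    exact ⟨l, h₁, h₂, rfl⟩

end Standard

/-! ### Envelopes as highest weight categories -/

section HighestWeightEnvelopes

variable {k : Type w} [Field k] {C : Type u} [Category.{v} C] [Preadditive C]
  [HasFiniteBiproducts C] [Linear k C] {S : ExactStructure C} {ι : Type u''} [Finite ι]
  {Ob : ι → C} {r : ι → ι → Prop} {A : Type u'} [Category.{v'} A] [Abelian A] {F : C ⥤ A}

theorem ExceptionalFamily.exists_isRealization (D : ExceptionalFamily k S Ob r) :
    ∃ (A : Type (max v w₁)) (_ : Category.{max v w₂} A) (_ : Abelian A) (F : C ⥤ A),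
      IsRealization S F := by
  obtain ⟨P, hP, h, -⟩ := D.exists_generator
  refine ThinEnvelope.exists_isRealization.{w₁, w₂} D.homFinite hP fun X => ?_
  obtain ⟨K, Q, i, d, hc, -, hQ⟩ := h X
  exact ⟨K, Q, i, d, hc, hQ⟩

/-- The opposite of a realization of the opposite exact category, which gives rise to the left
abelian envelope. -/
theorem ExceptionalFamily.exists_isRealization_op (D : ExceptionalFamily k S Ob r) :
    ∃ (A : Type (max v w₁)) (_ : Category.{max v w₂} A) (_ : Abelian A) (F : C ⥤ A),
      IsRealization S.op F.op := by
  obtain ⟨A, _, _, F, hF⟩ := D.op.exists_isRealization.{w₁, w₂}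
  exact ⟨Aᵒᵖ, inferInstance, inferInstance, F.rightOp,
    hF.of_isEquivalence (opOp A) (NatIso.ofComponents fun _ => Iso.refl _)⟩

theorem ExceptionalFamily.inducesExactEquivalence (D : ExceptionalFamily k S Ob r)
    (hF : IsRealization S F) {le : ι → ι → Prop} {L : ι → A}
    (hL : StandardData A le L fun i => F.obj (Ob i)) :
    InducesExactEquivalence S F (StandardlyFiltered le L) :=
  hF.inducesExactEquivalence D.gen fun X => (hL.standardlyFiltered_iff X).trans
    ⟨fun h => h.mono fun _ ⟨l, hl⟩ => ⟨_, ⟨l, rfl⟩, hl⟩,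
      fun h => h.mono fun _ ⟨_, ⟨l, h₁⟩, h₂⟩ => ⟨l, h₁ ▸ h₂⟩⟩

/-- `F(∇)` is `F(Δ)` for the opposite category. -/
theorem costandardlyFiltered_iff {le : ι → ι → Prop} {L : ι → A} (X : A) :
    CostandardlyFiltered le L X ↔
      StandardlyFiltered le (fun l => Opposite.op (L l)) (Opposite.op X) := by
  refine ⟨fun h => ?_, fun h => ?_⟩
  · have := h.op
    rw [abelianExact_op] at this
    exact this.mono fun Y hY => hY
  · unfold StandardlyFiltered at h
    rw [← abelianExact_op] at h
    exact h.unop.mono fun Y hY => hY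

theorem InducesExactEquivalence.of_op {Q : ObjectProperty Aᵒᵖ} {P : ObjectProperty A}
    (h : InducesExactEquivalence S.op F.op Q) (hPQ : ∀ X, P X ↔ Q (Opposite.op X)) :
    InducesExactEquivalence S F P where
  mem X := (hPQ _).2 (h.mem (Opposite.op X))
  confl_iff i d := (h.confl_iff d.op i.op).trans
    ⟨fun h => abelianExact_confl_unop h, fun h => abelianExact_confl_op h⟩
  isEquivalence := by
    have := h.isEquivalence
    have h₁ : F.op.Full := inferInstanceAs (Q.lift F.op h.mem ⋙ Q.ι).Full
    have h₂ : F.op.Faithful := inferInstanceAs (Q.lift F.op h.mem ⋙ Q.ι).Faithful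
    have : F.Full := ⟨fun f => ⟨(F.op.preimage f.op).unop, congr(($(F.op.map_preimage f.op)).unop)⟩⟩
    have : F.Faithful := ⟨fun {X Y f g} hfg =>
      congr(($(F.op.map_injective (a₁ := f.op) (a₂ := g.op) congr(($hfg).op))).unop)⟩
    refine ⟨inferInstance, inferInstance, ⟨fun X => ?_⟩⟩
    obtain ⟨Y, ⟨e⟩⟩ := h.isEquivalence.essSurj.mem_essImage
      ⟨Opposite.op X.obj, (hPQ _).1 X.property⟩
    exact ⟨Y.unop, ⟨ObjectProperty.isoMk _ (Q.ι.mapIso e).symm.unop⟩⟩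

/-- The target of a realization is a highest weight category with standard objects `F (Ob l)`.
Passing from standard to costandard objects twice shows that projective objects are filtered by
standard objects. -/
theorem ExceptionalFamily.exists_isHighestWeight [IsAlgClosed k] (D : ExceptionalFamily k S Ob r)
    (hF : IsRealization S F) [Linear k A] [F.Linear k] : ∃ L : ι → A,
      IsHighestWeight (fun l m => r m l) L k ∧
      (∀ l, IsStandard (fun l m => r m l) L l (F.obj (Ob l))) ∧
      InducesExactEquivalence S F (StandardlyFiltered (fun l m => r m l) L) := by
  obtain ⟨L, hL⟩ := D.exists_standardData hF
  obtain ⟨N, hN, -⟩ := hL.exists_costandardData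
  obtain ⟨Δ, hΔ, hproj⟩ := hN.exists_standardData
  exact ⟨L, hΔ.isHighestWeight (hF.isHomFinite D.homFinite) hproj, hL.isStandard,
    D.inducesExactEquivalence hF hL⟩

/-- Dually, the objects `F (Ob l)` are the standard objects of the opposite category, and its
costandard objects are the standard objects that filter the projective objects of `A`. -/
theorem ExceptionalFamily.exists_isHighestWeight_op [IsAlgClosed k]
    (D : ExceptionalFamily k S Ob r) (hF : IsRealization S.op F.op) [Linear k A] [F.Linear k] :
    ∃ L : ι → A, IsHighestWeight r L k ∧ (∀ l, IsCostandard r L l (F.obj (Ob l))) ∧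
      InducesExactEquivalence S F (CostandardlyFiltered r L) := by
  have : F.op.Linear k := ⟨fun f a => congr(($(Functor.map_smul F a f.unop)).op)⟩
  obtain ⟨L, hL⟩ := D.op.exists_standardData hF
  obtain ⟨Δ, hΔ, hproj⟩ := hL.exists_standardData
  exact ⟨fun l => (L l).unop, hΔ.isHighestWeight (hF.isHomFinite D.op.homFinite).unop hproj,
    hL.isStandard, (D.op.inducesExactEquivalence hF hL).of_op costandardlyFiltered_iff⟩

end HighestWeightEnvelopes

end ThinEnvelope

theorem mainTheorem1 (k : Type w) [Field k] [IsAlgClosed k]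
    (E : Type u) [Category.{v} E] [Preadditive E] [HasFiniteBiproducts E] [Linear k E]
    (S : ExactStructure E) (hS : IsThin S k) :
    (∃ (A : Type (max v w₁)) (_ : Category.{max v w₂} A) (_ : Abelian A) (iR : E ⥤ A),
      IsRightAbelianEnvelope.{max v w₁, max v w₂} S iR) ∧
    (∀ (A : Type (max v w₁)) [Category.{max v w₂} A] [Abelian A] (iR : E ⥤ A),
      IsRightAbelianEnvelope.{max v w₁, max v w₂} S iR →
      (∃ _ : Linear k A, iR.Linear k) ∧
      ∀ [Linear k A], iR.Linear k → ∃ L : Irr S → A,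
        IsHighestWeight (fun l m => Irr.le S m l) L k ∧
        (∀ l, IsStandard (fun l m => Irr.le S m l) L l (iR.obj l.obj)) ∧
        InducesExactEquivalence S iR (StandardlyFiltered (fun l m => Irr.le S m l) L)) ∧
    (∃ (A : Type (max v w₁)) (_ : Category.{max v w₂} A) (_ : Abelian A) (iL : E ⥤ A),
      IsLeftAbelianEnvelope.{max v w₁, max v w₂} S iL) ∧
    (∀ (A : Type (max v w₁)) [Category.{max v w₂} A] [Abelian A] (iL : E ⥤ A),
      IsLeftAbelianEnvelope.{max v w₁, max v w₂} S iL →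
      (∃ _ : Linear k A, iL.Linear k) ∧
      ∀ [Linear k A], iL.Linear k → ∃ L : Irr S → A,
        IsHighestWeight (Irr.le S) L k ∧
        (∀ l, IsCostandard (Irr.le S) L l (iL.obj l.obj)) ∧
        InducesExactEquivalence S iL (CostandardlyFiltered (Irr.le S) L)) := by
  obtain ⟨n, Ob, D₀⟩ := hS.exists_exceptionalFamily
  obtain ⟨hfin, D⟩ := D₀.irr
  obtain ⟨A₁, _, _, F₁, h₁⟩ := D.exists_isRealization.{w₁, w₂}
  obtain ⟨A₂, _, _, F₂, h₂⟩ := D.exists_isRealization_op.{w₁, w₂}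
  refine ⟨⟨A₁, _, _, F₁, h₁.isRightAbelianEnvelope⟩, fun A _ _ iR hR => ?_,
    ⟨A₂, _, _, F₂, h₂.isLeftAbelianEnvelope⟩, fun A _ _ iL hL => ?_⟩
  · refine ⟨hR.exists_linear k, fun {_} _ => ?_⟩
    obtain ⟨H, _, ⟨e⟩⟩ := IsRightAbelianEnvelope.exists_equivalence h₁.isRightAbelianEnvelope hR
    exact D.exists_isHighestWeight (h₁.of_isEquivalence H e)
  · refine ⟨hL.exists_linear k, fun {_} _ => ?_⟩
    obtain ⟨H, _, ⟨e⟩⟩ := IsLeftAbelianEnvelope.exists_equivalence h₂.isLeftAbelianEnvelope hL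
    exact D.exists_isHighestWeight_op (h₂.of_isEquivalence H.op (NatIso.op e.symm))
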